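/- All graphs are simple and locally finite. For a vertex $v$ of a graph $G$ let $N_G(v,\ell)$ be the number of self-avoiding walks of length $\ell$ starting at $v$. The connective constant of an infinite graph $G=(V,E)$ is $\sup_{v\in V}\limsup_{\ell\to\infty}N_G(v,\ell)^{1/\ell}$. A family $\mathcal F$ of (finite or infinite) graphs has connective constant at most $\Delta$, with threshold constant $a\in\mathbb R$, if every infinite member has connective constant at most $\Delta$ and there is a constant $c$ such that $\sum_{j=1}^{\ell}N_G(v,j)\le c\,\Delta^{\ell}$ for every finite $G=(V,E)\in\mathcal F$, every $v\in V$ and every integer $\ell\ge a\log|V|$. The hard core model with activity $\lambda>0$ on a finite graph $G$ gives weight $\lambda^{|I|}$ to every independent set $I$, and $Z(G,\lambda)=\sum_I\lambda^{|I|}$ is its partition function; on an infinite graph it is given by the (DLR) Gibbs measures with these weights. A boundary condition $\sigma$ is a set $S$ of vertices with an independent set $I_S\subseteq S$; $p_v(\sigma,G)$ is the probability that $v$ is occupied, conditioned on the configuration on $S$ being $I_S$, and $R_v(\sigma,G)=p_v(\sigma,G)/(1-p_v(\sigma,G))$. Theorem. Let $\lambda>0$ and $\Delta>0$ satisfy $\lambda<\lambda_c(\Delta+1)$,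 where $\lambda_c(d)=\frac{d^d}{(d-1)^{d+1}}$, and let $\mathcal F$ be a family of (finite or infinite) graphs with connective constant at most $\Delta$, with threshold constant $a$. No bound on the degrees is assumed. Then: 1. The hard core model with activity $\lambda$ exhibits strong spatial mixing on $\mathcal F$, that is: (finite members) there are constants $C$ and $\kappa>0$ such that for every finite $G=(V,E)\in\mathcal F$, every $v\in V$, every integer $\ell\ge 1$ with $\ell\ge a\log|V|$, and any two boundary conditions $\sigma,\tau$ on $G$ that differ only at distance at least $\ell$ from $v$, $|R_v(\sigma,G)-R_v(\tau,G)|\le C e^{-\kappa\ell}$; (infinite members) for every infinite $G\in\mathcal F$ and every vertex $v$ of $G$ there are constants $C$ and $\kappa>0$ such that the same inequality holds for every integer $\ell\ge1$ and any two boundary conditions $\sigma,\tau$ on $G$ that differ only at distance at least $\ell$ from $v$, for any choice of Gibbs measures with the boundary conditions $\sigma$ and $\tau$. 2. If all members of $\mathcal F$ are finite, there is an FPTAS for the partition function on $\mathcal F$: one deterministic random access machine program with logarithmic (bit) cost and with access to the binary digits $\lfloor\lambda2^k\rfloor$ of the fixed number $\lambda$ (at cost at least $k$) which, given the adjacency matrix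 of any graph $G\in\mathcal F$ with $n$ vertices (labelled in any order) and an integer $m\ge1$, outputs in time polynomial in $n$ and $m$ a rational number $\hat Z$ with $|\hat Z-Z(G,\lambda)|\le Z(G,\lambda)/m$. -/

import Mathlib

open Filter MeasureTheory
open scoped ENNReal

namespace HardCore

/-- The critical activity `λ_c(d) = d^d / (d-1)^(d+1)` of the `d`-ary tree, for real `d > 1`. -/
noncomputable def criticalActivity (d : ℝ) : ℝ := d ^ d / (d - 1) ^ (d + 1)

/-! ### Self-avoiding walks and the connective constant -/

/-- `N(v, ℓ)`: the number of self-avoiding walks of length `ℓ` that start at `v`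
(used for locally finite graphs, where it is a finite number). -/
noncomputable def sawCount {V : Type*} (G : SimpleGraph V) (v : V) (ℓ : ℕ) : ℕ :=
  Set.ncard {p : Σ w : V, G.Walk v w | p.2.IsPath ∧ p.2.length = ℓ}

/-- The connective constant `sup_v limsup_ℓ N(v, ℓ)^(1/ℓ)` of a locally finite infinite graph. -/
noncomputable def connectiveConstant {V : Type*} (G : SimpleGraph V) : ℝ≥0∞ :=
  ⨆ v : V, limsup (fun ℓ : ℕ => (sawCount G v ℓ : ℝ≥0∞) ^ ((1 : ℝ) / (ℓ : ℝ))) atTop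

/-- The family `G` has connective constant at most `Δ`. For the finite members this asks for one
constant `c` with `∑_{j=1}^ℓ N(v, j) ≤ c Δ^ℓ` for all vertices and all `ℓ ≥ a log |V|`; every
infinite member has to have connective constant at most `Δ`. The constant `a` is displayed, so
that it can be referred to; a family has connective constant at most `Δ` if this holds for
some `a`. -/
def ConnectiveConstantAtMost {ι : Type*} {V : ι → Type*} (G : ∀ i, SimpleGraph (V i))
    (Δ a : ℝ) : Prop :=
  (∃ c : ℝ, ∀ i, Finite (V i) → ∀ (v : V i) (ℓ : ℕ), a * Real.log (Nat.card (V i)) ≤ ℓ →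
      (∑ j ∈ Finset.Icc 1 ℓ, (sawCount (G i) v j : ℝ)) ≤ c * Δ ^ ℓ) ∧
  (∀ i, Infinite (V i) → connectiveConstant (G i) ≤ ENNReal.ofReal Δ)

/-! ### The hard core model -/

/-- The partition function `Z(G, λ)` of a finite graph: the sum of `λ^|I|` over all
independent sets `I`. -/
noncomputable def partitionFunction {V : Type*} (lam : ℝ) (G : SimpleGraph V) : ℝ :=
  ∑ᶠ I ∈ {I : Set V | G.IsIndepSet I}, lam ^ I.ncard

/-- A boundary condition: a set `dom` of vertices and an independent set `occ` on it. -/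
structure BoundaryCondition {V : Type*} (G : SimpleGraph V) where
  /-- the vertices whose state is fixed -/
  dom : Set V
  /-- the vertices that are fixed to be occupied -/
  occ : Set V
  occ_subset : occ ⊆ dom
  indep : G.IsIndepSet occ

/-- Two boundary conditions differ only at vertices at distance at least `ℓ` from `v`. -/
def BoundaryCondition.DifferOnlyFrom {V : Type*} {G : SimpleGraph V}
    (σ τ : BoundaryCondition G) (v : V) (ℓ : ℕ) : Prop :=
  ∀ u : V, G.edist v u < (ℓ : ℕ∞) → (u ∈ σ.dom ↔ u ∈ τ.dom) ∧ (u ∈ σ.occ ↔ u ∈ τ.occ)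

/-- The occupation probability of `v` in a finite graph under a boundary condition. -/
noncomputable def occProb {V : Type*} (lam : ℝ) (G : SimpleGraph V)
    (σ : BoundaryCondition G) (v : V) : ℝ :=
  (∑ᶠ I ∈ {I : Set V | G.IsIndepSet I ∧ I ∩ σ.dom = σ.occ ∧ v ∈ I}, lam ^ I.ncard) /
    (∑ᶠ I ∈ {I : Set V | G.IsIndepSet I ∧ I ∩ σ.dom = σ.occ}, lam ^ I.ncard)

/-- The occupation ratio that belongs to an occupation probability `p`. -/
noncomputable def ratio (p : ℝ) : ℝ := p / (1 - p)

open Classical in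
/-- The weight of the configuration `A` inside the finite region `Λ`, given that the configuration
outside `Λ` is `X \ Λ`. -/
noncomputable def regionWeight {V : Type*} (lam : ℝ) (G : SimpleGraph V) (Λ A : Finset V)
    (X : Set V) : ℝ :=
  if G.IsIndepSet (A : Set V) ∧ ∀ u ∈ A, ∀ w ∈ X \ (Λ : Set V), ¬ G.Adj u w
  then lam ^ A.card else 0

/-- The conditional probability, in the hard core model, of seeing `A` inside the finite
region `Λ`, given that the configuration outside `Λ` is `X \ Λ`. -/
noncomputable def regionProb {V : Type*} (lam : ℝ) (G : SimpleGraph V) (Λ A : Finset V)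
    (X : Set V) : ℝ :=
  regionWeight lam G Λ A X / ∑ A' ∈ Λ.powerset, regionWeight lam G Λ A' X

/-- `μ` is a Gibbs measure (in the sense of Dobrushin, Lanford and Ruelle) of the hard core model
on `G` under the boundary condition `σ`: the states of the fixed vertices are as prescribed, and
the configuration in any finite set `Λ` of free vertices, given the configuration outside `Λ`,
follows the hard core distribution. The events `B` below are the events that depend only on the
configuration outside `Λ`. -/
structure IsGibbsMeasure {V : Type*} (lam : ℝ) (G : SimpleGraph V) (σ : BoundaryCondition G)
    (μ : Measure (Set V)) : Prop where
  prob : IsProbabilityMeasure μ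
  boundary : ∀ u ∈ σ.dom, ∀ᵐ X ∂μ, (u ∈ X ↔ u ∈ σ.occ)
  dlr : ∀ Λ : Finset V, Disjoint (Λ : Set V) σ.dom → ∀ A : Finset V, A ⊆ Λ →
    ∀ B : Set (Set V), MeasurableSet B →
      (∀ X Y : Set V, X \ (Λ : Set V) = Y \ (Λ : Set V) → (X ∈ B ↔ Y ∈ B)) →
      μ (B ∩ {X : Set V | X ∩ (Λ : Set V) = (A : Set V)}) =
        ∫⁻ X in B, ENNReal.ofReal (regionProb lam G Λ A X) ∂μ

/-- Strong spatial mixing on a family of graphs: if two boundary conditions differ only at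
distance at least `ℓ` from `v`, then the occupation ratios at `v` differ by at most
`exp (-Ω(ℓ))`. On the finite members the implied constants are uniform over the family and over
all vertices, and `ℓ` ranges over the scales `ℓ ≥ a log |V|` on which the connective constant
of a finite family is defined. On an infinite member all `ℓ ≥ 1` are allowed, the implied constants
may depend on the graph and on `v`, and the bound holds for all Gibbs measures that belong to the
two boundary conditions. (As `ℓ ≥ 1`, the vertex `v` is fixed in both of the boundary conditions
or in none; if it is fixed, then there is no difference at `v` at all.) -/
def StrongSpatialMixing {ι : Type*} {V : ι → Type*} (lam : ℝ) (G : ∀ i, SimpleGraph (V i))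
    (a : ℝ) : Prop :=
  (∃ C κ : ℝ, 0 < κ ∧ ∀ i, Finite (V i) → ∀ (v : V i) (ℓ : ℕ), 1 ≤ ℓ →
      a * Real.log (Nat.card (V i)) ≤ ℓ →
      ∀ σ τ : BoundaryCondition (G i), σ.DifferOnlyFrom τ v ℓ →
        |ratio (occProb lam (G i) σ v) - ratio (occProb lam (G i) τ v)|
          ≤ C * Real.exp (-(κ * ℓ))) ∧
  (∀ i, Infinite (V i) → ∀ v : V i, ∃ C κ : ℝ, 0 < κ ∧ ∀ ℓ : ℕ, 1 ≤ ℓ →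
      ∀ σ τ : BoundaryCondition (G i), σ.DifferOnlyFrom τ v ℓ →
      ∀ μ ν : Measure (Set (V i)), IsGibbsMeasure lam (G i) σ μ → IsGibbsMeasure lam (G i) τ ν →
        |ratio (μ.real {X | v ∈ X}) - ratio (ν.real {X | v ∈ X})|
          ≤ C * Real.exp (-(κ * ℓ)))

/-! ### A random access machine with logarithmic cost -/

/-- The memory of the machine: a natural number in every cell. -/
abbrev Store : Type := ℕ → ℕ

/-- Expressions: constants, (indirect) memory access, arithmetic (truncated subtraction, division
rounding down), and a query to an external function `O : ℕ → ℕ`. -/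
inductive Expr : Type
  | const (c : ℕ)
  | load (e : Expr)
  | add (e f : Expr)
  | sub (e f : Expr)
  | mul (e f : Expr)
  | div (e f : Expr)
  | query (e : Expr)

/-- The value of an expression. -/
def Expr.eval (O : ℕ → ℕ) (s : Store) : Expr → ℕ
  | .const c => c
  | .load e => s (e.eval O s)
  | .add e f => e.eval O s + f.eval O s
  | .sub e f => e.eval O s - f.eval O s
  | .mul e f => e.eval O s * f.eval O s
  | .div e f => e.eval O s / f.eval O s
  | .query e => O (e.eval O s)

/-- The number of steps needed to evaluate an expression. All operations are charged according to
the binary lengths (`Nat.size`) of the numbers involved; multiplication and division are charged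
the product of the lengths, and a query with argument `k` is charged `k` plus the length
of the answer. -/
def Expr.cost (O : ℕ → ℕ) (s : Store) : Expr → ℕ
  | .const c => Nat.size c + 1
  | .load e => e.cost O s + Nat.size (e.eval O s) + Nat.size (s (e.eval O s)) + 1
  | .add e f => e.cost O s + f.cost O s + Nat.size (e.eval O s) + Nat.size (f.eval O s) + 1
  | .sub e f => e.cost O s + f.cost O s + Nat.size (e.eval O s) + Nat.size (f.eval O s) + 1
  | .mul e f =>
      e.cost O s + f.cost O s + (Nat.size (e.eval O s) + 1) * (Nat.size (f.eval O s) + 1)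
  | .div e f =>
      e.cost O s + f.cost O s + (Nat.size (e.eval O s) + 1) * (Nat.size (f.eval O s) + 1)
  | .query e => e.cost O s + e.eval O s + Nat.size (O (e.eval O s)) + 1

/-- Programs. A test succeeds if the value of the expression is not `0`. -/
inductive Program : Type
  | skip
  | assign (addr val : Expr)
  | seq (P Q : Program)
  | ite (test : Expr) (P Q : Program)
  | loop (test : Expr) (P : Program)

/-- `P.Runs O s s' t`: the program `P`, started with memory `s`, halts after exactly `t` steps
with memory `s'`. Here `loop test P` repeats `P` as long as the test succeeds. -/
inductive Program.Runs (O : ℕ → ℕ) : Program → Store → Store → ℕ → Prop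
  | skip (s : Store) : Runs O .skip s s 1
  | assign (addr val : Expr) (s : Store) :
      Runs O (.assign addr val) s (Function.update s (addr.eval O s) (val.eval O s))
        (addr.cost O s + val.cost O s + Nat.size (addr.eval O s) + Nat.size (val.eval O s) + 1)
  | seq {P Q : Program} {s s' s'' : Store} {t t' : ℕ} (hP : Runs O P s s' t)
      (hQ : Runs O Q s' s'' t') : Runs O (.seq P Q) s s'' (t + t' + 1)
  | ite_true {test : Expr} {P Q : Program} {s s' : Store} {t : ℕ} (h : test.eval O s ≠ 0)
      (hP : Runs O P s s' t) : Runs O (.ite test P Q) s s' (test.cost O s + t + 1)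
  | ite_false {test : Expr} {P Q : Program} {s s' : Store} {t : ℕ} (h : test.eval O s = 0)
      (hQ : Runs O Q s s' t) : Runs O (.ite test P Q) s s' (test.cost O s + t + 1)
  | loop_done {test : Expr} {P : Program} {s : Store} (h : test.eval O s = 0) :
      Runs O (.loop test P) s s (test.cost O s + 1)
  | loop_step {test : Expr} {P : Program} {s s' s'' : Store} {t t' : ℕ} (h : test.eval O s ≠ 0)
      (hP : Runs O P s s' t) (hL : Runs O (.loop test P) s' s'' t') :
      Runs O (.loop test P) s s'' (test.cost O s + t + t' + 1)

/-- The binary digits of the activity: `⌊λ 2^k⌋`. -/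
noncomputable def digits (lam : ℝ) (k : ℕ) : ℕ := ⌊lam * 2 ^ k⌋₊

open Classical in
/-- The input: cell `0` holds the number `n` of vertices, cell `1` the accuracy parameter `m`, and
cell `2 + (i * n + j)` the entry `(i, j)` of the adjacency matrix. All other cells hold `0`. -/
noncomputable def inputStore {n : ℕ} (m : ℕ) (H : SimpleGraph (Fin n)) : Store := fun k =>
  if k = 0 then n
  else if k = 1 then m
  else if ∃ i j : Fin n, k = 2 + ((i : ℕ) * n + (j : ℕ)) ∧ H.Adj i j then 1 else 0

/-- A fully polynomial time approximation scheme (deterministic) for the partition function on a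
family of finite graphs. There is one program that, for every graph of the family, every
labelling `e` of its vertices by `0, …, n - 1` and every accuracy `1 / m`, halts within a number of
steps polynomial in `n` and `m`, with a rational number `s 0 / s 1` in its first two cells that
approximates the partition function within a factor `1 ± 1 / m`. The fixed real number `λ` is
accessible to the program through its binary digits. -/
def HasFPTAS {ι : Type*} {V : ι → Type*} (lam : ℝ) (G : ∀ i, SimpleGraph (V i)) : Prop :=
  ∃ (P : Program) (C k : ℕ), ∀ (i : ι) (n : ℕ) (e : Fin n ≃ V i) (m : ℕ), 1 ≤ m →
    ∃ (s : Store) (t : ℕ),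
      P.Runs (digits lam) (inputStore m ((G i).comap e)) s t ∧
      t ≤ C * (n + m) ^ k ∧
      s 1 ≠ 0 ∧
      |(s 0 : ℝ) / (s 1 : ℝ) - partitionFunction lam (G i)|
        ≤ partitionFunction lam (G i) / (m : ℝ)

end HardCore

/-! Write Z(S) for the partition function of the graph induced on S and R(S, v) = λ Z(S∖N(v)) / Z(S)
for the occupation ratio of v ∉ S. Since Z(S) = Z(S∖u)(1 + R(S∖u, u)), removing the neighbours u₁,
u₂, … of v in S one by one telescopes to R(S, v) = λ ∏ᵢ (1 + R(S∖{u₁,…,uᵢ}, uᵢ))⁻¹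
(`occRatio_eq_chain`). A vertex is removed before its subtree is entered, so the branches of this
recursion are self-avoiding walks, and level k has at most N(v, k) nodes (`levelCount_le_sawCount`).

Errors are measured in the message arsinh √R, in which one step of the recursion is m = arsinh(√λ
exp(-∑ log cosh mᵢ)). The Cauchy–Schwarz inequality along a segment, together with tanh² ≤ 2 log
cosh, bounds the squared change of m by α times the sum of the squared changes of the mᵢ, as soon as
sλ ≤ α(λ + e^s) for all s, and this follows from λ ≤ α e^(1+α) (`message_contraction`). The number
of children does not enter, so degrees need no bound. As λ_c(Δ+1) ≤ Δ⁻¹ e^(1+1/Δ), some α < 1/Δ is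
admissible. After k levels the squared error is at most a constant times α^k N(v, k), hence of order
(αΔ)^k (`sq_message_treeRatio_sub_le`).

For spatial mixing, delete the fixed vertices and those blocked by occupied ones. Boundary
conditions that agree at distances less than ℓ leave vertex sets that agree up to distance ℓ - 2.
For a Gibbs measure, condition on the configuration outside the free part of a ball: all conditional
probabilities that can occur almost surely, under either measure, are close to each other, hence so
are their averages (`IsGibbsMeasure.real_mem_Icc`).

For the algorithm, 1/Z is the same product taken at a virtual root that is adjacent to every vertex.
With b = (n+1)(m+1), a recursion of depth about K log₂ b has an error that is polynomially small in
b, while the number of its nodes is bounded through partial sums of walk counts by about Δ^depth, a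
polynomial in b. A depth first search on a stack evaluates the tree with integer fractions. The
product of the weights on the stack grows by a factor of at most N + D per step, where N/D is the
rounded activity, so all binary lengths stay polynomial (`StackInv.step`). -/

namespace HardCore

/-! ### The contraction of the tree recursion -/

/-- The contraction rate: below the critical activity some `α < 1 / Δ` has `λ ≤ α e^(1+α)`. -/
lemma exists_contraction_rate {lam Δ : ℝ} (hΔ : 0 < Δ) (hcrit : lam < criticalActivity (Δ + 1)) :
    ∃ α : ℝ, 0 < α ∧ α * Δ < 1 ∧ lam ≤ α * Real.exp (1 + α) := by
  -- From (1 + 1/Δ)^(Δ+1) ≤ e^((Δ+1)/Δ). The critical activity is thus at most x e^(1+x) at x = 1/Δ,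
  -- and the strict inequality for λ survives at some x slightly below 1/Δ.
  have hcrit' : criticalActivity (Δ + 1) ≤ Δ⁻¹ * Real.exp (1 + Δ⁻¹) := by
    unfold criticalActivity
    have h1 : Δ + 1 - 1 = Δ := by ring
    rw [h1, Real.rpow_add hΔ (Δ + 1) 1, Real.rpow_one, ← div_div,
      ← Real.div_rpow (by positivity) hΔ.le, div_eq_mul_inv, mul_comm]
    apply mul_le_mul_of_nonneg_left _ (by positivity)
    have h2 : (Δ + 1) / Δ ≤ Real.exp (Δ⁻¹) := by
      have := Real.add_one_le_exp (Δ⁻¹)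
      have h3 : (Δ + 1) / Δ = Δ⁻¹ + 1 := by field_simp; ring
      rw [h3]; exact this
    calc ((Δ + 1) / Δ) ^ (Δ + 1) ≤ (Real.exp (Δ⁻¹)) ^ (Δ + 1) :=
          Real.rpow_le_rpow (by positivity) h2 (by positivity)
      _ = Real.exp (1 + Δ⁻¹) := by
          rw [← Real.exp_mul]; congr 1; field_simp
  have hcont : ContinuousAt (fun x : ℝ => x * Real.exp (1 + x)) Δ⁻¹ := by fun_prop
  have hev : ∀ᶠ x in nhds Δ⁻¹, lam < x * Real.exp (1 + x) :=
    hcont.eventually (lt_mem_nhds (hcrit.trans_le hcrit'))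
  have hpos : ∀ᶠ x in nhds Δ⁻¹, 0 < x := lt_mem_nhds (by positivity)
  have h : ∀ᶠ x in nhdsWithin Δ⁻¹ (Set.Iio Δ⁻¹), x < Δ⁻¹ := self_mem_nhdsWithin
  obtain ⟨x, ⟨hx1, hx2⟩, hx3⟩ :=
    (((hev.and hpos).filter_mono nhdsWithin_le_nhds).and h).exists
  refine ⟨x, hx2, ?_, hx1.le⟩
  calc x * Δ < Δ⁻¹ * Δ := by gcongr
    _ = 1 := inv_mul_cancel₀ hΔ.ne'

/-- The tangent line of exp at s = 1 + α. Equality holds there if λ = α e^(1+α), which explains the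
form of the condition on α. -/
lemma mul_le_mul_add_exp {lam α s : ℝ} (hlam : 0 ≤ lam)
    (h : lam ≤ α * Real.exp (1 + α)) : s * lam ≤ α * (lam + Real.exp s) := by
  have h1 : Real.exp s = Real.exp (1 + α) * Real.exp (s - 1 - α) := by
    rw [← Real.exp_add]; congr 1; ring
  have h2 : s - α ≤ Real.exp (s - 1 - α) := by
    have := Real.add_one_le_exp (s - 1 - α); linarith
  have h3 := Real.exp_pos (s - 1 - α)
  calc s * lam = α * lam + lam * (s - α) := by ring
    _ ≤ α * lam + lam * Real.exp (s - 1 - α) := by gcongr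
    _ ≤ α * lam + α * Real.exp (1 + α) * Real.exp (s - 1 - α) := by gcongr
    _ = α * (lam + Real.exp s) := by rw [h1]; ring

/-- With y = cosh² x this reads 1 - 1/y ≤ log y. -/
lemma sq_tanh_le_log_cosh (x : ℝ) : (Real.sinh x / Real.cosh x) ^ 2 ≤ 2 * Real.log (Real.cosh x) := by
  have hc := Real.cosh_pos x
  have h1 := Real.one_sub_inv_le_log_of_pos (pow_pos hc 2)
  rw [Real.log_pow] at h1
  have h2 : (Real.sinh x / Real.cosh x) ^ 2 = 1 - (Real.cosh x ^ 2)⁻¹ := by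
    rw [div_pow, Real.sinh_sq]; field_simp
  rw [h2]; simpa using h1

/-- The tree recursion in the coordinates of the message `arsinh √x`. -/
lemma arsinh_exp_contraction {ι : Type*} [Fintype ι] {lam α : ℝ} (hlam : 0 ≤ lam) (hα : 0 < α)
    (h : lam ≤ α * Real.exp (1 + α)) (a b : ι → ℝ) :
    (Real.arsinh (√lam * Real.exp (-∑ i, Real.log (Real.cosh (b i)))) -
      Real.arsinh (√lam * Real.exp (-∑ i, Real.log (Real.cosh (a i))))) ^ 2 ≤
      α * ∑ i, (b i - a i) ^ 2 := by
  -- Linear interpolation in the message coordinates; a bound on the derivative along the segment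
  -- then suffices.
  set z : ι → ℝ → ℝ := fun i t => a i + t * (b i - a i) with hz
  set L : ℝ → ℝ := fun t => ∑ i, Real.log (Real.cosh (z i t)) with hL
  set L' : ℝ → ℝ := fun t => ∑ i, Real.sinh (z i t) / Real.cosh (z i t) * (b i - a i) with hL'
  set w : ℝ → ℝ := fun t => √lam * Real.exp (-L t) with hw
  have hzd : ∀ i t, HasDerivAt (z i) (b i - a i) t := by
    intro i t
    have := ((hasDerivAt_id t).mul_const (b i - a i)).const_add (a i)
    simpa [hz] using this
  have hLd : ∀ t, HasDerivAt L (L' t) t := by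
    intro t
    have : ∀ i ∈ Finset.univ, HasDerivAt (fun t => Real.log (Real.cosh (z i t)))
        (Real.sinh (z i t) / Real.cosh (z i t) * (b i - a i)) t := by
      intro i _
      have := ((hzd i t).cosh).log (Real.cosh_pos _).ne'
      convert this using 1; ring
    exact HasDerivAt.fun_sum this
  have hg : ∀ t, HasDerivAt (fun t => Real.arsinh (w t))
      ((√(1 + w t ^ 2))⁻¹ * (w t * (-L' t))) t := by
    intro t
    have hwd : HasDerivAt w (w t * (-L' t)) t := by
      exact (((hLd t).neg.exp).const_mul (√lam)).congr_deriv (mul_assoc _ _ _).symm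
    have := hwd.arsinh
    simpa [smul_eq_mul] using this
  set D : ℝ := ∑ i, (b i - a i) ^ 2 with hD
  have hD0 : 0 ≤ D := Finset.sum_nonneg fun i _ => sq_nonneg _
  have hbound : ∀ t, ‖(√(1 + w t ^ 2))⁻¹ * (w t * (-L' t))‖ ≤ √(α * D) := by
    intro t
    apply Real.le_sqrt_of_sq_le
    rw [Real.norm_eq_abs, sq_abs, mul_pow, inv_pow, Real.sq_sqrt (add_nonneg zero_le_one (sq_nonneg _)),
      mul_pow (w t), neg_sq]
    -- Cauchy–Schwarz separates the increments b - a. The remaining sum of tanh² is at most 2L, so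
    -- the number of children drops out.
    have hL2 : L' t ^ 2 ≤ (2 * L t) * D := by
      calc L' t ^ 2 ≤ (∑ i, (Real.sinh (z i t) / Real.cosh (z i t)) ^ 2) * D :=
            Finset.sum_mul_sq_le_sq_mul_sq _ _ _
        _ ≤ (2 * L t) * D := by
            apply mul_le_mul_of_nonneg_right _ hD0
            rw [hL, Finset.mul_sum]
            exact Finset.sum_le_sum fun i _ => sq_tanh_le_log_cosh _
    have hw2 : w t ^ 2 = lam * Real.exp (-(2 * L t)) := by
      simp only [hw]
      rw [mul_pow, Real.sq_sqrt hlam, ← Real.exp_nat_mul]; congr 2; push_cast; ring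
    -- The tangent line inequality at s = 2L, multiplied by e^(-2L).
    have hkey : w t ^ 2 * (2 * L t) ≤ α * (1 + w t ^ 2) := by
      have h1 := mul_le_mul_add_exp (s := 2 * L t) hlam h
      have h2 := Real.exp_pos (-(2 * L t))
      have h3 : Real.exp (2 * L t) * Real.exp (-(2 * L t)) = 1 := by
        rw [← Real.exp_add]; simp
      rw [hw2]
      calc lam * Real.exp (-(2 * L t)) * (2 * L t) = 2 * L t * lam * Real.exp (-(2 * L t)) := by ring
        _ ≤ α * (lam + Real.exp (2 * L t)) * Real.exp (-(2 * L t)) := by gcongr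
        _ = α * (lam * Real.exp (-(2 * L t)) +
              Real.exp (2 * L t) * Real.exp (-(2 * L t))) := by ring
        _ = _ := by rw [h3]; ring
    rw [inv_mul_le_iff₀ (by positivity)]
    calc w t ^ 2 * L' t ^ 2 ≤ w t ^ 2 * ((2 * L t) * D) := by gcongr
      _ = (w t ^ 2 * (2 * L t)) * D := by ring
      _ ≤ α * (1 + w t ^ 2) * D := by gcongr
      _ = _ := by ring
  have hmv := norm_image_sub_le_of_norm_deriv_le_segment_01'
    (f := fun t => Real.arsinh (w t)) (C := √(α * D))
    (fun t _ => (hg t).hasDerivWithinAt) (fun t _ => hbound t)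
  have e1 : w 1 = √lam * Real.exp (-∑ i, Real.log (Real.cosh (b i))) := by simp [hw, hL, hz]
  have e0 : w 0 = √lam * Real.exp (-∑ i, Real.log (Real.cosh (a i))) := by simp [hw, hL, hz]
  rw [← e1, ← e0, ← Real.sq_sqrt (mul_nonneg hα.le hD0), ← sq_abs]
  exact pow_le_pow_left₀ (abs_nonneg _) hmv 2

/-- The message of an occupation ratio. -/
noncomputable def message (x : ℝ) : ℝ := Real.arsinh (√x)

/-- As cosh (arsinh √x) = √(1 + x), the factors 1 + x of the recursion become additive in log cosh
of the messages. -/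
lemma log_cosh_message {x : ℝ} (hx : 0 ≤ x) :
    Real.log (Real.cosh (message x)) = Real.log (1 + x) / 2 := by
  have h : Real.cosh (message x) = √(1 + x) := by
    unfold message; rw [Real.cosh_arsinh, Real.sq_sqrt hx]
  rw [h, Real.log_sqrt (by linarith)]

lemma message_list_recursion {lam : ℝ} (hlam : 0 ≤ lam) {ι : Type*} [Fintype ι] {x : ι → ℝ}
    (hx : ∀ i, 0 ≤ x i) : message (lam * ∏ i, (1 + x i)⁻¹) =
      Real.arsinh (√lam * Real.exp (-∑ i, Real.log (Real.cosh (message (x i))))) := by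
  unfold message
  rw [Real.sqrt_mul hlam]
  congr 2
  have : ∀ i, Real.log (Real.cosh (message (x i))) = Real.log (1 + x i) / 2 :=
    fun i => log_cosh_message (hx i)
  unfold message at this
  simp only [this]
  have hpos : ∀ i, 0 < 1 + x i := fun i => by have := hx i; positivity
  rw [Real.sqrt_eq_iff_mul_self_eq (Finset.prod_nonneg fun i _ => inv_nonneg.2 (hpos i).le)
    (Real.exp_pos _).le, ← Real.exp_add, ← Finset.sum_div, ← neg_add, add_halves, Real.exp_neg,
    Real.exp_sum, Finset.prod_inv_distrib]
  congr 1
  exact Finset.prod_congr rfl fun i _ => (Real.exp_log (hpos i)).symm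

/-- One step of the tree recursion contracts the messages in mean square. -/
lemma message_contraction {lam α : ℝ} (hlam : 0 ≤ lam) (hα : 0 < α)
    (h : lam ≤ α * Real.exp (1 + α)) (l : List (ℝ × ℝ)) (hl : ∀ p ∈ l, 0 ≤ p.1 ∧ 0 ≤ p.2) :
    (message (lam * (l.map fun p => (1 + p.1)⁻¹).prod) -
      message (lam * (l.map fun p => (1 + p.2)⁻¹).prod)) ^ 2 ≤
      α * (l.map fun p => (message p.1 - message p.2) ^ 2).sum := by
  have e (f : ℝ × ℝ → ℝ) : (l.map f).prod = ∏ i : Fin l.length, f l[i.1] :=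
    (Fin.prod_univ_fun_getElem l f).symm
  have e' (f : ℝ × ℝ → ℝ) : (l.map f).sum = ∑ i : Fin l.length, f l[i.1] :=
    (Fin.sum_univ_fun_getElem l f).symm
  rw [e, e, e', message_list_recursion hlam fun i : Fin l.length => (hl _ (List.getElem_mem i.2)).1,
    message_list_recursion hlam fun i : Fin l.length => (hl _ (List.getElem_mem i.2)).2]
  exact arsinh_exp_contraction hlam hα h _ _

lemma message_nonneg (x : ℝ) : 0 ≤ message x := Real.arsinh_nonneg_iff.2 (Real.sqrt_nonneg _)

lemma message_mono {x y : ℝ} (h : x ≤ y) : message x ≤ message y :=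
  Real.arsinh_le_arsinh.2 (Real.sqrt_le_sqrt h)

lemma sq_message_sub_le {lam x y : ℝ} (hx : x ≤ lam) (hy : y ≤ lam) :
    (message x - message y) ^ 2 ≤ message lam ^ 2 := by
  have h1 := message_nonneg x
  have h2 := message_nonneg y
  have h3 := message_mono hx
  have h4 := message_mono hy
  apply sq_le_sq'
  · linarith
  · linarith

/-- log (1 + x) is 2 log cosh of the message, and log cosh is 1-Lipschitz because its derivative is
tanh. -/
lemma abs_log_sub_log_le {x y : ℝ} (hx : 0 ≤ x) (hy : 0 ≤ y) :
    |Real.log (1 + x) - Real.log (1 + y)| ≤ 2 * |message x - message y| := by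
  have hd : ∀ t ∈ (Set.univ : Set ℝ), HasDerivWithinAt (fun t => Real.log (Real.cosh t))
      (Real.sinh t / Real.cosh t) Set.univ t := fun t _ =>
    ((Real.hasDerivAt_cosh t).log (Real.cosh_pos t).ne').hasDerivWithinAt
  have hb : ∀ t ∈ (Set.univ : Set ℝ), ‖Real.sinh t / Real.cosh t‖ ≤ 1 := by
    intro t _
    rw [Real.norm_eq_abs, abs_div, abs_of_pos (Real.cosh_pos t), div_le_one (Real.cosh_pos t)]
    apply abs_le_of_sq_le_sq _ (Real.cosh_pos t).le
    rw [Real.sinh_sq]; linarith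
  have := convex_univ.norm_image_sub_le_of_norm_hasDerivWithin_le hd hb (Set.mem_univ (message y))
    (Set.mem_univ (message x))
  rw [log_cosh_message hx, log_cosh_message hy, Real.norm_eq_abs, Real.norm_eq_abs, ← sub_div,
    abs_div, abs_two, div_le_iff₀ two_pos] at this
  linarith

/-- (1 + x)⁻¹ is the probability that a vertex with ratio x is vacant; this carries message errors
over to probabilities. -/
lemma abs_inv_sub_inv_le {x y : ℝ} (hx : 0 ≤ x) (hy : 0 ≤ y) :
    |(1 + x)⁻¹ - (1 + y)⁻¹| ≤ 2 * |message x - message y| := by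
  refine le_trans ?_ (abs_log_sub_log_le hx hy)
  wlog hxy : x ≤ y generalizing x y
  · rw [abs_sub_comm, abs_sub_comm (Real.log _)]
    exact this hy hx (le_of_not_ge hxy)
  have h1 : (1 + y)⁻¹ ≤ (1 + x)⁻¹ := by gcongr
  have h2 : Real.log (1 + x) ≤ Real.log (1 + y) := Real.log_le_log (by linarith) (by linarith)
  rw [abs_of_nonneg (by linarith), abs_sub_comm, abs_of_nonneg (by linarith),
    ← Real.log_div (by linarith) (by linarith)]
  have h3 := Real.one_sub_inv_le_log_of_pos (x := (1 + y) / (1 + x)) (by positivity)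
  refine le_trans ?_ h3
  have h4 : (1 + x)⁻¹ - (1 + y)⁻¹ = (1 + x)⁻¹ * (1 - ((1 + y) / (1 + x))⁻¹) := by
    field_simp
  rw [h4]
  have h5 : (1 + x)⁻¹ ≤ 1 := inv_le_one_of_one_le₀ (by linarith)
  have h6 : 0 ≤ 1 - ((1 + y) / (1 + x))⁻¹ := by
    rw [inv_div, sub_nonneg]; exact (div_le_one (by linarith)).2 (by linarith)
  nlinarith

/-! ### Independent sets inside a finite set of vertices -/

section Recursion

variable {V : Type*} (lam : ℝ) (G : SimpleGraph V)

open Classical in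
/-- The partition function of the subgraph induced on `S`. -/
noncomputable def indepSum (S : Finset V) : ℝ :=
  ∑ I ∈ S.powerset.filter (fun I : Finset V => G.IsIndepSet (I : Set V)), lam ^ I.card

open Classical in
/-- The occupation ratio of `v ∉ S` in the subgraph induced on `S ∪ {v}`. -/
noncomputable def occRatio (S : Finset V) (v : V) : ℝ :=
  lam * indepSum lam G (S.filter fun u => ¬ G.Adj v u) / indepSum lam G S

open Classical in
/-- The product of `(1 + F)⁻¹` over the vertices in `us` which lie in `S` and satisfy `p`; every
vertex is removed from `S` before `F` is evaluated at it. -/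
noncomputable def chain (F : Finset V → V → ℝ) (p : V → Prop) : List V → Finset V → ℝ
  | [], _ => 1
  | u :: us, S => if u ∈ S ∧ p u then (1 + F (S.erase u) u)⁻¹ * chain F p us (S.erase u)
      else chain F p us S

open Classical in
/-- The sum of `F` over the same pairs that enter into `chain`. -/
noncomputable def childSum (F : Finset V → V → ℕ) (p : V → Prop) : List V → Finset V → ℕ
  | [], _ => 0
  | u :: us, S => if u ∈ S ∧ p u then F (S.erase u) u + childSum F p us (S.erase u)
      else childSum F p us S

/-- The tree recursion of depth `k`, with the values `g` at the leaves. -/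
noncomputable def treeRatio (E : List V) (g : Finset V → V → ℝ) : ℕ → Finset V → V → ℝ
  | 0 => g
  | k + 1 => fun S v => lam * chain (treeRatio E g k) (G.Adj v) E S

/-- The number of vertices at depth `k` of the recursion tree. -/
noncomputable def levelCount (E : List V) : ℕ → Finset V → V → ℕ
  | 0 => fun _ _ => 1
  | k + 1 => fun S v => childSum (levelCount E k) (G.Adj v) E S

variable {lam G}

lemma treeRatio_succ (E : List V) (g : Finset V → V → ℝ) (k : ℕ) (S : Finset V) (v : V) :
    treeRatio lam G E g (k + 1) S v = lam * chain (treeRatio lam G E g k) (G.Adj v) E S := rfl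

lemma levelCount_succ (E : List V) (k : ℕ) (S : Finset V) (v : V) :
    levelCount G E (k + 1) S v = childSum (levelCount G E k) (G.Adj v) E S := rfl

lemma indepSum_empty : indepSum lam G ∅ = 1 := by
  simp [indepSum, Finset.filter_singleton]

lemma one_le_indepSum (hlam : 0 ≤ lam) (S : Finset V) : 1 ≤ indepSum lam G S := by
  classical
  have h : (∅ : Finset V) ∈ S.powerset.filter fun I : Finset V => G.IsIndepSet (I : Set V) := by
    simp
  have := Finset.single_le_sum (f := fun I : Finset V => lam ^ I.card)
    (fun I _ => pow_nonneg hlam _) h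
  simpa [indepSum] using this

lemma indepSum_pos (hlam : 0 ≤ lam) (S : Finset V) : 0 < indepSum lam G S :=
  one_pos.trans_le (one_le_indepSum hlam S)

open Classical in
lemma sum_indep_insert (lam : ℝ) (G : SimpleGraph V) {S : Finset V} {v : V} (hv : v ∉ S) :
    ∑ I ∈ (insert v S).powerset.filter (fun I : Finset V => G.IsIndepSet (I : Set V) ∧ v ∈ I),
      lam ^ I.card =
      lam * indepSum lam G (S.filter fun u => ¬ G.Adj v u) := by
  rw [indepSum, Finset.mul_sum]
  symm
  refine Finset.sum_bij (fun I _ => insert v I) ?_ ?_ ?_ ?_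
  · intro I hI
    simp only [Finset.mem_filter, Finset.mem_powerset] at hI ⊢
    refine ⟨Finset.insert_subset_insert v (hI.1.trans (Finset.filter_subset _ _)), ?_,
      Finset.mem_insert_self _ _⟩
    rw [Finset.coe_insert, SimpleGraph.IsIndepSet, Set.pairwise_insert]
    refine ⟨hI.2, fun u hu _ => ?_⟩
    have := (Finset.mem_filter.1 (hI.1 hu)).2
    exact ⟨this, fun h => this h.symm⟩
  · intro I hI J hJ hIJ
    simp only [Finset.mem_filter, Finset.mem_powerset] at hI hJ
    have hI' : v ∉ I := fun h => hv (Finset.mem_filter.1 (hI.1 h)).1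
    have hJ' : v ∉ J := fun h => hv (Finset.mem_filter.1 (hJ.1 h)).1
    rw [← Finset.erase_insert hI', hIJ, Finset.erase_insert hJ']
  · intro J hJ
    simp only [Finset.mem_filter, Finset.mem_powerset] at hJ
    refine ⟨J.erase v, ?_, Finset.insert_erase hJ.2.2⟩
    simp only [Finset.mem_filter, Finset.mem_powerset]
    refine ⟨fun u hu => ?_, ?_⟩
    · have hu' := Finset.mem_erase.1 hu
      refine Finset.mem_filter.2 ⟨(Finset.mem_insert.1 (hJ.1 hu'.2)).resolve_left hu'.1, ?_⟩
      exact hJ.2.1 hJ.2.2 hu'.2 hu'.1.symm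
    · exact Set.Pairwise.mono (by simp) hJ.2.1
  · intro I hI
    simp only [Finset.mem_filter, Finset.mem_powerset] at hI
    have hI' : v ∉ I := fun h => hv (Finset.mem_filter.1 (hI.1 h)).1
    rw [Finset.card_insert_of_notMem hI', pow_succ, mul_comm]

open Classical in
lemma indepSum_insert {S : Finset V} {v : V} (hv : v ∉ S) :
    indepSum lam G (insert v S) =
      indepSum lam G S + lam * indepSum lam G (S.filter fun u => ¬ G.Adj v u) := by
  rw [← sum_indep_insert lam G hv, indepSum, ← Finset.sum_filter_add_sum_filter_not _ (v ∈ ·),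
    Finset.filter_filter, Finset.filter_filter, add_comm, indepSum]
  congr 1
  apply Finset.sum_congr _ fun _ _ => rfl
  ext I
  simp only [Finset.mem_filter, Finset.mem_powerset]
  constructor
  · rintro ⟨h1, h2, h3⟩
    exact ⟨(Finset.subset_insert_iff_of_notMem h3).1 h1, h2⟩
  · rintro ⟨h1, h2⟩
    exact ⟨h1.trans (Finset.subset_insert _ _), h2, fun h => hv (h1 h)⟩

lemma occRatio_nonneg (hlam : 0 ≤ lam) (S : Finset V) (v : V) : 0 ≤ occRatio lam G S v :=
  div_nonneg (mul_nonneg hlam (indepSum_pos hlam _).le) (indepSum_pos hlam _).le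

open Classical in
lemma indepSum_eq_erase (hlam : 0 ≤ lam) {S : Finset V} {u : V} (hu : u ∈ S) :
    indepSum lam G S = indepSum lam G (S.erase u) * (1 + occRatio lam G (S.erase u) u) := by
  have h := indepSum_insert (lam := lam) (G := G) (Finset.notMem_erase u S)
  rw [Finset.insert_erase hu] at h
  have := (indepSum_pos (G := G) hlam (S.erase u)).ne'
  rw [h, occRatio]
  field_simp

-- Telescoping: each factor (1 + R(S∖u, u))⁻¹ equals Z(S∖u) / Z(S).
open Classical in
lemma chain_occRatio (hlam : 0 ≤ lam) (p : V → Prop) (us : List V) (S : Finset V) :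
    chain (occRatio lam G) p us S =
      indepSum lam G (S.filter fun u => ¬ (u ∈ us ∧ p u)) / indepSum lam G S := by
  induction us generalizing S with
  | nil => simp [chain, (indepSum_pos (G := G) hlam S).ne']
  | cons u us ih =>
    rw [chain]
    split_ifs with h
    · rw [ih, indepSum_eq_erase hlam h.1]
      have h1 : (S.erase u).filter (fun x => ¬ (x ∈ us ∧ p x)) =
          S.filter fun x => ¬ (x ∈ u :: us ∧ p x) := by
        ext x
        simp only [Finset.mem_filter, Finset.mem_erase, List.mem_cons]
        by_cases hx : x = u
        · subst hx; simp [h.2]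
        · simp [hx]
      rw [h1, div_eq_mul_inv, div_eq_mul_inv, mul_inv]
      ring
    · rw [ih]
      congr 2
      ext x
      simp only [Finset.mem_filter, List.mem_cons]
      by_cases hx : x = u
      · subst hx; tauto
      · simp [hx]

lemma occRatio_eq_chain (hlam : 0 ≤ lam) {E : List V} {S : Finset V} (hS : ∀ u ∈ S, u ∈ E)
    (v : V) : occRatio lam G S v = lam * chain (occRatio lam G) (G.Adj v) E S := by
  classical
  rw [chain_occRatio hlam, occRatio, mul_div_assoc]
  congr 3
  exact Finset.filter_congr fun u hu => by simp [hS u hu]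

/-- Telescoping down to the empty graph, as if at a virtual root adjacent to every vertex. The
algorithm starts from this product. -/
lemma inv_indepSum_eq_chain (hlam : 0 ≤ lam) {E : List V} {S : Finset V} (hS : ∀ u ∈ S, u ∈ E) :
    (indepSum lam G S)⁻¹ = chain (occRatio lam G) (fun _ => True) E S := by
  classical
  rw [chain_occRatio hlam]
  rw [← one_div, ← indepSum_empty (lam := lam) (G := G)]
  congr 2
  ext u
  simpa using hS u

lemma chain_congr {F F' : Finset V → V → ℝ} (p : V → Prop) (us : List V) {S : Finset V}
    (h : ∀ T ⊆ S, ∀ u, F T u = F' T u) : chain F p us S = chain F' p us S := by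
  classical
  induction us generalizing S with
  | nil => rfl
  | cons u us ih =>
    rw [chain, chain, ih h, ih fun T hT => h T (hT.trans (Finset.erase_subset _ _)),
      h _ (Finset.erase_subset _ _)]

/-- Exact leaf values make the recursion exact at every depth. True ratios can therefore be compared
with each other, or with a truncation, through their leaves alone. -/
lemma treeRatio_occRatio (hlam : 0 ≤ lam) {E : List V} (k : ℕ) {S : Finset V}
    (hS : ∀ u ∈ S, u ∈ E) (v : V) :
    treeRatio lam G E (occRatio lam G) k S v = occRatio lam G S v := by
  induction k generalizing S v with
  | zero => rfl
  | succ k ih =>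
    rw [treeRatio_succ, occRatio_eq_chain hlam hS]
    congr 1
    exact chain_congr _ _ fun T hT u => ih (fun x hx => hS x (hT hx)) u

lemma chain_mem {F : Finset V → V → ℝ} (hF : ∀ S u, 0 ≤ F S u) (p : V → Prop) (us : List V)
    (S : Finset V) : 0 < chain F p us S ∧ chain F p us S ≤ 1 := by
  classical
  induction us generalizing S with
  | nil => simp [chain]
  | cons u us ih =>
    rw [chain]
    split_ifs
    · have h1 := hF (S.erase u) u
      have h2 := ih (S.erase u)
      exact ⟨mul_pos (by positivity) h2.1,
        mul_le_one₀ (inv_le_one_of_one_le₀ (by linarith)) h2.1.le h2.2⟩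
    · exact ih S

lemma treeRatio_mem (hlam : 0 ≤ lam) (E : List V) {g : Finset V → V → ℝ}
    (hg : ∀ S u, 0 ≤ g S u ∧ g S u ≤ lam) (k : ℕ) (S : Finset V) (v : V) :
    0 ≤ treeRatio lam G E g k S v ∧ treeRatio lam G E g k S v ≤ lam := by
  induction k generalizing S v with
  | zero => exact hg S v
  | succ k ih =>
    have := chain_mem (fun S u => (ih S u).1) (G.Adj v) E S
    exact ⟨mul_nonneg hlam this.1.le, mul_le_of_le_one_right hlam this.2⟩

lemma occRatio_mem (hlam : 0 ≤ lam) (S : Finset V) (v : V) :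
    0 ≤ occRatio lam G S v ∧ occRatio lam G S v ≤ lam := by
  refine ⟨occRatio_nonneg hlam S v, ?_⟩
  rw [occRatio_eq_chain (E := S.toList) hlam (by simp)]
  exact mul_le_of_le_one_right hlam (chain_mem (occRatio_nonneg hlam) _ _ _).2

/-- Two sets of vertices agree up to distance `k` from `v`. -/
def AgreeWithin (G : SimpleGraph V) (k : ℕ) (S S' : Finset V) (v : V) : Prop :=
  ∀ u, G.edist v u ≤ (k : ℕ∞) → (u ∈ S ↔ u ∈ S')

lemma AgreeWithin.of_adj {k : ℕ} {S S' : Finset V} {v u : V} (h : AgreeWithin G (k + 1) S S' v)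
    (huv : G.Adj v u) : AgreeWithin G k S S' u := by
  intro w hw
  apply h
  calc G.edist v w ≤ G.edist v u + G.edist u w := G.edist_triangle
    _ ≤ 1 + k := add_le_add (SimpleGraph.edist_eq_one_iff_adj.2 huv).le hw
    _ = ((k + 1 : ℕ) : ℕ∞) := by push_cast; rw [add_comm]

open Classical in
lemma AgreeWithin.erase {k : ℕ} {S S' : Finset V} {v : V} (h : AgreeWithin G k S S' v) (u : V) :
    AgreeWithin G k (S.erase u) (S'.erase u) v := by
  intro w hw
  rw [Finset.mem_erase, Finset.mem_erase, h w hw]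

/-- The decay of correlations along the tree recursion. -/
theorem sq_message_treeRatio_sub_le {α : ℝ} (hlam : 0 ≤ lam) (hα : 0 < α)
    (h : lam ≤ α * Real.exp (1 + α)) (E : List V) {g g' : Finset V → V → ℝ}
    (hg : ∀ S u, 0 ≤ g S u ∧ g S u ≤ lam) (hg' : ∀ S u, 0 ≤ g' S u ∧ g' S u ≤ lam) (k : ℕ)
    {S S' : Finset V} {v : V} (hS : AgreeWithin G k S S' v) :
    (message (treeRatio lam G E g k S v) - message (treeRatio lam G E g' k S' v)) ^ 2 ≤
      α ^ k * message lam ^ 2 * levelCount G E k S v := by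
  classical
  induction k generalizing S S' v with
  | zero =>
    simpa [treeRatio, levelCount] using sq_message_sub_le (hg S v).2 (hg' S' v).2
  | succ k ih =>
    -- Both chains visit the same children in the same order, because S and S' agree at the
    -- neighbours of v and erasing a vertex from both preserves this. The ratios are therefore
    -- collected in a single list of pairs.
    have key : ∀ (us : List V) (S S' : Finset V),
        (∀ u, G.Adj v u → AgreeWithin G k S S' u) →
        ∃ l : List (ℝ × ℝ), (∀ p ∈ l, 0 ≤ p.1 ∧ 0 ≤ p.2) ∧
          chain (treeRatio lam G E g k) (G.Adj v) us S = (l.map fun p => (1 + p.1)⁻¹).prod ∧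
          chain (treeRatio lam G E g' k) (G.Adj v) us S' = (l.map fun p => (1 + p.2)⁻¹).prod ∧
          (l.map fun p => (message p.1 - message p.2) ^ 2).sum ≤
            α ^ k * message lam ^ 2 * childSum (levelCount G E k) (G.Adj v) us S := by
      intro us
      induction us with
      | nil => exact fun S S' _ => ⟨[], by simp, rfl, rfl, by simp [childSum]⟩
      | cons u us ihl =>
        intro S S' hSS
        by_cases hu : u ∈ S ∧ G.Adj v u
        · have hu' : u ∈ S' ∧ G.Adj v u :=
            ⟨(hSS u hu.2 u (by simp)).1 hu.1, hu.2⟩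
          have hE : ∀ w, G.Adj v w → AgreeWithin G k (S.erase u) (S'.erase u) w :=
            fun w hw => (hSS w hw).erase u
          obtain ⟨l, h1, h2, h3, h4⟩ := ihl _ _ hE
          refine ⟨(treeRatio lam G E g k (S.erase u) u, treeRatio lam G E g' k (S'.erase u) u) :: l,
            ?_, ?_, ?_, ?_⟩
          · intro p hp
            rcases List.mem_cons.1 hp with rfl | hp
            · exact ⟨(treeRatio_mem hlam E hg k _ _).1, (treeRatio_mem hlam E hg' k _ _).1⟩
            · exact h1 p hp
          · rw [chain, if_pos hu, h2, List.map_cons, List.prod_cons]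
          · rw [chain, if_pos hu', h3, List.map_cons, List.prod_cons]
          · rw [childSum, if_pos hu, List.map_cons, List.sum_cons, Nat.cast_add, mul_add]
            exact add_le_add (ih (hE u hu.2)) h4
        · have hu' : ¬ (u ∈ S' ∧ G.Adj v u) := fun h' =>
            hu ⟨(hSS u h'.2 u (by simp)).2 h'.1, h'.2⟩
          obtain ⟨l, h1, h2, h3, h4⟩ := ihl _ _ hSS
          refine ⟨l, h1, ?_, ?_, ?_⟩
          · rw [chain, if_neg hu, h2]
          · rw [chain, if_neg hu', h3]
          · rw [childSum, if_neg hu]; exact h4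
    obtain ⟨l, h1, h2, h3, h4⟩ := key E S S' fun u hu => hS.of_adj hu
    rw [treeRatio_succ, treeRatio_succ, h2, h3]
    refine (message_contraction hlam hα h l h1).trans ?_
    rw [levelCount_succ, pow_succ]
    calc _ ≤ α * (α ^ k * message lam ^ 2 * childSum (levelCount G E k) (G.Adj v) E S) := by
          gcongr
      _ = _ := by ring

end Recursion

/-! ### Counting self-avoiding walks -/

section Counting

variable {V : Type*} {G : SimpleGraph V}

/-- `Set.ncard` is 0 on infinite sets, so the comparisons of walk counts rest on this finiteness. -/
lemma finite_walks_length (hG : ∀ v, (G.neighborSet v).Finite) (k : ℕ) (v : V) :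
    {p : Σ w : V, G.Walk v w | p.2.length = k}.Finite := by
  induction k generalizing v with
  | zero =>
    refine (Set.finite_singleton (⟨v, SimpleGraph.Walk.nil⟩ : Σ w : V, G.Walk v w)).subset ?_
    rintro ⟨w, p⟩ hp
    cases p with
    | nil => rfl
    | cons h p => simp at hp
  | succ k ih =>
    have := (hG v).biUnion' (t := fun u hu => (fun p : Σ w : V, G.Walk u w =>
        (⟨p.1, SimpleGraph.Walk.cons hu p.2⟩ : Σ w : V, G.Walk v w)) ''
          {p : Σ w : V, G.Walk u w | p.2.length = k}) fun u hu => (ih u).image _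
    refine this.subset ?_
    rintro ⟨w, p⟩ hp
    cases p with
    | nil => simp at hp
    | @cons _ u _ h p =>
      simp only [Set.mem_iUnion]
      exact ⟨u, h, ⟨w, p⟩, by simpa using hp, rfl⟩

/-- The self-avoiding walks of length `k` from `v` that stay in `S ∪ {v}`. -/
def sawsIn (G : SimpleGraph V) (k : ℕ) (S : Finset V) (v : V) : Set (Σ w : V, G.Walk v w) :=
  {p | p.2.IsPath ∧ p.2.length = k ∧ ∀ x ∈ p.2.support, x = v ∨ x ∈ S}

lemma sawsIn_finite (hG : ∀ v, (G.neighborSet v).Finite) (k : ℕ) (S : Finset V) (v : V) :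
    (sawsIn G k S v).Finite :=
  (finite_walks_length hG k v).subset fun _ hp => hp.2.1

/-- A child is erased before its subtree is explored, so a branch never returns to it. The walks are
sorted by their second vertex. -/
lemma levelCount_le_ncard (hG : ∀ v, (G.neighborSet v).Finite) {E : List V} (hE : E.Nodup) (k : ℕ)
    {S : Finset V} {v : V} (hv : v ∉ S) : levelCount G E k S v ≤ (sawsIn G k S v).ncard := by
  classical
  induction k generalizing S v with
  | zero =>
    have : (⟨v, SimpleGraph.Walk.nil⟩ : Σ w : V, G.Walk v w) ∈ sawsIn G 0 S v := by
      simp [sawsIn]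
    exact (Set.ncard_pos (sawsIn_finite hG 0 S v)).2 ⟨_, this⟩
  | succ k ih =>
    have key : ∀ (us : List V), us.Nodup → ∀ (S : Finset V), v ∉ S →
        childSum (levelCount G E k) (G.Adj v) us S ≤
          {p ∈ sawsIn G (k + 1) S v | p.2.snd ∈ us}.ncard := by
      intro us
      induction us with
      | nil => simp [childSum]
      | cons u us ihl =>
        intro hus S hv
        rw [List.nodup_cons] at hus
        have hfin : {p ∈ sawsIn G (k + 1) S v | p.2.snd ∈ u :: us}.Finite :=
          (sawsIn_finite hG (k + 1) S v).subset fun _ hp => hp.1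
        rw [childSum]
        split_ifs with hu
        · have hv' : v ∉ S.erase u := fun h => hv (Finset.mem_of_mem_erase h)
          let c : (Σ w : V, G.Walk u w) → Σ w : V, G.Walk v w :=
            fun p => ⟨p.1, SimpleGraph.Walk.cons hu.2 p.2⟩
          have hc : Function.Injective c := by
            rintro ⟨w, p⟩ ⟨w', p'⟩ hpp
            simp only [c, Sigma.mk.injEq] at hpp
            obtain ⟨rfl, hpp⟩ := hpp
            simpa using hpp
          -- The second vertex is u on one side and lies in `us` on the other; the list has no
          -- duplicates.
          have hdisj : Disjoint (c '' sawsIn G k (S.erase u) u)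
              {p ∈ sawsIn G (k + 1) (S.erase u) v | p.2.snd ∈ us} := by
            rw [Set.disjoint_left]
            rintro _ ⟨p, _, rfl⟩ ⟨_, hp⟩
            exact hus.1 (by simpa [c] using hp)
          calc _ ≤ (sawsIn G k (S.erase u) u).ncard +
                {p ∈ sawsIn G (k + 1) (S.erase u) v | p.2.snd ∈ us}.ncard :=
                add_le_add (ih (Finset.notMem_erase u S)) (ihl hus.2 _ hv')
            _ = (c '' sawsIn G k (S.erase u) u ∪
                {p ∈ sawsIn G (k + 1) (S.erase u) v | p.2.snd ∈ us}).ncard := by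
                rw [Set.ncard_union_eq hdisj ((sawsIn_finite hG _ _ _).image _)
                  ((sawsIn_finite hG (k + 1) _ v).subset fun _ hp => hp.1),
                  Set.ncard_image_of_injective _ hc]
            _ ≤ _ := by
                refine Set.ncard_le_ncard ?_ hfin
                rintro p (⟨q, hq, rfl⟩ | hp)
                · have hmem : ∀ x ∈ q.2.support, x ∈ S := fun x hx =>
                    (hq.2.2 x hx).elim (fun h => h ▸ hu.1) Finset.mem_of_mem_erase
                  refine ⟨⟨?_, ?_, ?_⟩, ?_⟩
                  · exact hq.1.cons fun h => hv (hmem _ h)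
                  · simp [c, hq.2.1]
                  · intro x hx
                    simp only [c, SimpleGraph.Walk.support_cons, List.mem_cons] at hx
                    exact hx.imp_right (hmem x)
                  · simp [c]
                · exact ⟨⟨hp.1.1, hp.1.2.1, fun x hx =>
                    (hp.1.2.2 x hx).imp_right Finset.mem_of_mem_erase⟩, List.mem_cons_of_mem _ hp.2⟩
        · exact (ihl hus.2 S hv).trans (Set.ncard_le_ncard
            (fun p hp => ⟨hp.1, List.mem_cons_of_mem _ hp.2⟩) hfin)
    exact (key E hE S hv).trans (Set.ncard_le_ncard (fun p hp => hp.1) (sawsIn_finite hG _ _ _))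

lemma levelCount_le_sawCount (hG : ∀ v, (G.neighborSet v).Finite) {E : List V} (hE : E.Nodup)
    (k : ℕ) {S : Finset V} {v : V} (hv : v ∉ S) : levelCount G E k S v ≤ sawCount G v k :=
  (levelCount_le_ncard hG hE k hv).trans (Set.ncard_le_ncard (fun _ hp => ⟨hp.1, hp.2.1⟩)
    ((finite_walks_length hG k v).subset fun _ hp => hp.2))

end Counting

/-! ### Occupation probabilities in finite regions -/

section Region

variable {V : Type*} {lam : ℝ} {G : SimpleGraph V}

open Classical in
/-- The vertices of `Λ` which are not blocked by an occupied vertex of `X` outside `Λ`. -/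
noncomputable def freePart (G : SimpleGraph V) (Λ : Finset V) (X : Set V) : Finset V :=
  Λ.filter fun u => ∀ w ∈ X \ (Λ : Set V), ¬ G.Adj u w

open Classical in
/-- The conditional probability that `v` is occupied, given `X` outside `Λ`. -/
noncomputable def regionOcc (lam : ℝ) (G : SimpleGraph V) (Λ : Finset V) (X : Set V) (v : V) : ℝ :=
  ∑ A ∈ Λ.powerset.filter (fun A => v ∈ A), regionProb lam G Λ A X

-- The configuration outside the region acts only by blocking vertices, so what remains is the hard
-- core model on the free part.
open Classical in
lemma sum_regionWeight (lam : ℝ) (G : SimpleGraph V) (Λ : Finset V) (X : Set V)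
    (Q : Finset V → Prop) [DecidablePred Q] :
    ∑ A ∈ Λ.powerset.filter Q, regionWeight lam G Λ A X =
      ∑ A ∈ (freePart G Λ X).powerset.filter (fun A : Finset V => G.IsIndepSet (A : Set V) ∧ Q A),
        lam ^ A.card := by
  simp only [regionWeight]
  rw [← Finset.sum_filter, Finset.filter_filter]
  apply Finset.sum_congr _ fun _ _ => rfl
  ext A
  simp only [Finset.mem_filter, Finset.mem_powerset, freePart]
  constructor
  · rintro ⟨h1, h2, h3, h4⟩
    exact ⟨fun u hu => Finset.mem_filter.2 ⟨h1 hu, h4 u hu⟩, h3, h2⟩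
  · rintro ⟨h1, h2, h3⟩
    exact ⟨fun u hu => (Finset.mem_filter.1 (h1 hu)).1, h3, h2,
      fun u hu => (Finset.mem_filter.1 (h1 hu)).2⟩

lemma sum_regionWeight_univ (lam : ℝ) (G : SimpleGraph V) (Λ : Finset V) (X : Set V) :
    ∑ A ∈ Λ.powerset, regionWeight lam G Λ A X = indepSum lam G (freePart G Λ X) := by
  classical
  have := sum_regionWeight lam G Λ X fun _ => True
  simpa [indepSum] using this

lemma regionWeight_nonneg (hlam : 0 ≤ lam) (Λ A : Finset V) (X : Set V) :
    0 ≤ regionWeight lam G Λ A X := by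
  unfold regionWeight
  split_ifs
  · positivity
  · rfl

lemma regionProb_nonneg (hlam : 0 ≤ lam) (Λ A : Finset V) (X : Set V) :
    0 ≤ regionProb lam G Λ A X :=
  div_nonneg (regionWeight_nonneg hlam _ _ _)
    (Finset.sum_nonneg fun _ _ => regionWeight_nonneg hlam _ _ _)

lemma regionOcc_eq_div (lam : ℝ) (G : SimpleGraph V) (Λ : Finset V) (X : Set V) (v : V)
    [DecidablePred fun A : Finset V => v ∈ A] :
    regionOcc lam G Λ X v = (∑ A ∈ Λ.powerset.filter (fun A => v ∈ A), regionWeight lam G Λ A X) /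
      ∑ A ∈ Λ.powerset, regionWeight lam G Λ A X := by
  rw [Finset.sum_div, regionOcc]
  refine Finset.sum_congr ?_ fun _ _ => rfl
  ext; simp

lemma regionOcc_of_notMem {Λ : Finset V} {X : Set V} {v : V} (hv : v ∉ freePart G Λ X) :
    regionOcc lam G Λ X v = 0 := by
  classical
  rw [regionOcc_eq_div, sum_regionWeight, Finset.filter_false_of_mem, Finset.sum_empty, zero_div]
  rintro A hA ⟨_, h⟩
  exact hv (Finset.mem_powerset.1 hA h)

open Classical in
lemma one_sub_regionOcc_of_mem (hlam : 0 ≤ lam) {Λ : Finset V} {X : Set V} {v : V}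
    (hv : v ∈ freePart G Λ X) :
    1 - regionOcc lam G Λ X v = (1 + occRatio lam G ((freePart G Λ X).erase v) v)⁻¹ := by
  have h1 := indepSum_eq_erase (G := G) hlam hv
  have h2 := sum_indep_insert lam G (Finset.notMem_erase v (freePart G Λ X))
  rw [Finset.insert_erase hv] at h2
  rw [regionOcc_eq_div, sum_regionWeight_univ, sum_regionWeight, h2, h1]
  have h3 := indepSum_pos (G := G) hlam ((freePart G Λ X).erase v)
  have h4 := occRatio_nonneg (G := G) hlam ((freePart G Λ X).erase v) v
  have h5 : lam * indepSum lam G (((freePart G Λ X).erase v).filter fun u => ¬ G.Adj v u) =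
      occRatio lam G ((freePart G Λ X).erase v) v *
        indepSum lam G ((freePart G Λ X).erase v) := by
    rw [occRatio, div_mul_cancel₀ _ h3.ne']
  rw [h5]
  have h6 : (1 + occRatio lam G ((freePart G Λ X).erase v) v) ≠ 0 := by positivity
  field_simp
  ring

lemma regionOcc_nonneg (hlam : 0 ≤ lam) (Λ : Finset V) (X : Set V) (v : V) :
    0 ≤ regionOcc lam G Λ X v :=
  Finset.sum_nonneg fun _ _ => regionProb_nonneg hlam _ _ _

/-- Occupation ratios never exceed λ, whatever the degree. This keeps p away from 1, where p / (1 -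
p) would stop being Lipschitz. -/
lemma inv_one_add_le_one_sub_regionOcc (hlam : 0 ≤ lam) (Λ : Finset V) (X : Set V) (v : V) :
    (1 + lam)⁻¹ ≤ 1 - regionOcc lam G Λ X v := by
  classical
  by_cases hv : v ∈ freePart G Λ X
  · rw [one_sub_regionOcc_of_mem hlam hv]
    have := occRatio_mem (G := G) hlam ((freePart G Λ X).erase v) v
    exact inv_anti₀ (by linarith) (by linarith)
  · rw [regionOcc_of_notMem hv, sub_zero]
    exact inv_le_one_of_one_le₀ (by linarith)

/-- If the free parts agree up to distance `k` from `v`, the occupation probabilities are close. -/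
lemma abs_regionOcc_sub_le {α B : ℝ} (hlam : 0 ≤ lam) (hα : 0 < α)
    (h : lam ≤ α * Real.exp (1 + α)) (hG : ∀ v, (G.neighborSet v).Finite)
    {Λ Λ' : Finset V} {X X' : Set V} {v : V} {k : ℕ}
    (hagree : AgreeWithin G k (freePart G Λ X) (freePart G Λ' X') v)
    (hB : α ^ k * sawCount G v k ≤ B) :
    |regionOcc lam G Λ X v - regionOcc lam G Λ' X' v| ≤ 2 * message lam * √B := by
  classical
  by_cases hv : v ∈ freePart G Λ X
  · have hv' : v ∈ freePart G Λ' X' := (hagree v (by simp)).1 hv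
    set F := freePart G Λ X
    set F' := freePart G Λ' X'
    -- One enumeration for both free parts, so that the two recursion trees match child by child.
    set E := (F ∪ F').toList with hE
    have hF : ∀ u ∈ F.erase v, u ∈ E := fun u hu => by
      rw [hE, Finset.mem_toList, Finset.mem_union]; exact Or.inl (Finset.mem_of_mem_erase hu)
    have hF' : ∀ u ∈ F'.erase v, u ∈ E := fun u hu => by
      rw [hE, Finset.mem_toList, Finset.mem_union]; exact Or.inr (Finset.mem_of_mem_erase hu)
    have h1 := sq_message_treeRatio_sub_le hlam hα h E (occRatio_mem (G := G) hlam)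
      (occRatio_mem (G := G) hlam) k (hagree.erase v)
    rw [treeRatio_occRatio hlam k hF, treeRatio_occRatio hlam k hF'] at h1
    have h2 := levelCount_le_sawCount hG (Finset.nodup_toList (F ∪ F')) k (Finset.notMem_erase v F)
    have h3 := abs_inv_sub_inv_le (occRatio_nonneg (G := G) hlam (F.erase v) v)
      (occRatio_nonneg (G := G) hlam (F'.erase v) v)
    rw [← one_sub_regionOcc_of_mem hlam hv, ← one_sub_regionOcc_of_mem hlam hv',
      sub_sub_sub_cancel_left, abs_sub_comm] at h3
    refine h3.trans ?_
    rw [mul_assoc]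
    gcongr
    rw [← Real.sqrt_sq (message_nonneg lam), ← Real.sqrt_mul (sq_nonneg _)]
    apply Real.abs_le_sqrt
    refine h1.trans ?_
    calc _ = message lam ^ 2 * (α ^ k * levelCount G E k (F.erase v) v) := by ring
      _ ≤ message lam ^ 2 * (α ^ k * sawCount G v k) := by gcongr
      _ ≤ _ := by gcongr
  · have hv' : v ∉ freePart G Λ' X' := fun h' => hv ((hagree v (by simp)).2 h')
    rw [regionOcc_of_notMem hv, regionOcc_of_notMem hv', sub_zero, abs_zero]
    have := message_nonneg lam
    positivity

lemma abs_ratio_sub_le {p q ε : ℝ} (hlam : 0 ≤ lam) (hp : (1 + lam)⁻¹ ≤ 1 - p)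
    (hq : (1 + lam)⁻¹ ≤ 1 - q) (h : |p - q| ≤ ε) : |ratio p - ratio q| ≤ (1 + lam) ^ 2 * ε := by
  have h0 : 0 < (1 + lam)⁻¹ := by positivity
  have hp0 : 0 < 1 - p := h0.trans_le hp
  have hq0 : 0 < 1 - q := h0.trans_le hq
  have h1 : (1 - p)⁻¹ ≤ 1 + lam := inv_le_of_inv_le₀ (by positivity) hp
  have h2 : (1 - q)⁻¹ ≤ 1 + lam := inv_le_of_inv_le₀ (by positivity) hq
  have h3 : ratio p - ratio q = (1 - p)⁻¹ * (1 - q)⁻¹ * (p - q) := by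
    unfold ratio; field_simp; ring
  rw [h3, abs_mul, abs_of_pos (mul_pos (inv_pos.2 hp0) (inv_pos.2 hq0)), sq]
  gcongr

end Region

/-! ### Strong spatial mixing on finite graphs -/

section Finite

variable {V : Type*} {lam : ℝ} {G : SimpleGraph V}

-- The sets compatible with σ are A ∪ `σ.occ` with A among the free vertices. The constant weight of
-- `σ.occ` cancels in quotients; `P` lets one statement serve both numerator and denominator.
open Classical in
lemma finsum_boundary_eq [Fintype V] (lam : ℝ) (σ : BoundaryCondition G) (P : Set V → Prop)
    (Q : Finset V → Prop) [DecidablePred Q] (hPQ : ∀ A : Finset V, P (A ∪ σ.occ) ↔ Q A) :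
    ∑ᶠ I ∈ {I : Set V | G.IsIndepSet I ∧ I ∩ σ.dom = σ.occ ∧ P I}, lam ^ I.ncard =
      lam ^ σ.occ.ncard * ∑ A ∈ (Finset.univ.filter (· ∉ σ.dom)).powerset.filter Q,
        regionWeight lam G (Finset.univ.filter (· ∉ σ.dom)) A σ.occ := by
  set Λ : Finset V := Finset.univ.filter (· ∉ σ.dom) with hΛ
  have hocc : σ.occ \ (Λ : Set V) = σ.occ := by
    ext u
    simp only [hΛ, Finset.coe_filter, Finset.mem_univ, true_and, Set.mem_sdiff, Set.mem_ofPred_eq,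
      not_not, and_iff_left_iff_imp]
    exact fun h => σ.occ_subset h
  simp only [regionWeight, hocc]
  rw [← Finset.sum_filter, Finset.filter_filter, Finset.mul_sum]
  rw [← finsum_mem_coe_finset]
  symm
  have hdisj : ∀ A ∈ Λ.powerset, Disjoint (A : Set V) σ.occ := by
    intro A hA
    rw [Set.disjoint_left]
    intro u hu hu'
    have := Finset.mem_powerset.1 hA hu
    simp only [hΛ, Finset.mem_filter, Finset.mem_univ, true_and] at this
    exact this (σ.occ_subset hu')
  refine finsum_mem_eq_of_bijOn (fun A : Finset V => (A : Set V) ∪ σ.occ) ⟨?_, ?_, ?_⟩ ?_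
  · intro A hA
    simp only [Finset.coe_filter, Set.mem_ofPred_eq] at hA
    obtain ⟨hA, hQ, hi, hn⟩ := hA
    refine ⟨?_, ?_, (hPQ A).2 hQ⟩
    · have : Std.Symm fun a b => ¬ G.Adj a b := ⟨fun _ _ h h' => h h'.symm⟩
      rw [SimpleGraph.IsIndepSet, Set.pairwise_union_of_symm]
      exact ⟨hi, σ.indep, fun a ha b hb _ => hn a ha b hb⟩
    · rw [Set.union_inter_distrib_right, Set.inter_eq_left.2 σ.occ_subset]
      have : (A : Set V) ∩ σ.dom = ∅ := by
        rw [← Set.disjoint_iff_inter_eq_empty, Set.disjoint_left]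
        intro u hu
        have := Finset.mem_powerset.1 hA hu
        simpa [hΛ] using this
      rw [this, Set.empty_union]
  · intro A hA B hB hAB
    simp only [Finset.coe_filter, Set.mem_ofPred_eq] at hA hB
    have h1 := hdisj A hA.1
    have h2 := hdisj B hB.1
    have h3 : ((A : Set V) ∪ σ.occ) \ σ.occ = ((B : Set V) ∪ σ.occ) \ σ.occ :=
      congrArg (· \ σ.occ) hAB
    rw [Set.union_sdiff_right, Set.union_sdiff_right, h1.sdiff_eq_left, h2.sdiff_eq_left] at h3
    exact Finset.coe_injective h3
  · rintro I ⟨hi, hd, hP⟩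
    have hI : ((I.toFinset.filter (· ∉ σ.dom) : Finset V) : Set V) ∪ σ.occ = I := by
      ext u
      have := Set.ext_iff.1 hd u
      simp only [Set.mem_inter_iff] at this
      simp only [Finset.coe_filter, Set.mem_toFinset, Set.mem_union, Set.mem_ofPred_eq]
      tauto
    refine ⟨I.toFinset.filter (· ∉ σ.dom), ?_, hI⟩
    simp only [Finset.coe_filter, Set.mem_ofPred_eq]
    refine ⟨?_, (hPQ _).1 (by rwa [hI]), hi.mono fun u hu => ?_, ?_⟩
    · rw [Finset.mem_powerset]
      intro u hu
      simpa [hΛ] using (Finset.mem_filter.1 hu).2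
    · simp at hu; exact hu.1
    · intro a ha b hb
      have ha' : a ∈ I ∧ a ∉ σ.dom := by simpa using ha
      have hb' : b ∈ I := by rw [← hI]; exact Or.inr hb
      refine hi ha'.1 hb' ?_
      rintro rfl
      exact ha'.2 (σ.occ_subset hb)
  · intro A hA
    simp only [Finset.coe_filter, Set.mem_ofPred_eq] at hA
    rw [Set.ncard_union_eq (hdisj A hA.1), Set.ncard_coe_finset, pow_add, mul_comm]

open Classical in
lemma occProb_eq_regionOcc [Fintype V] (hlam : 0 < lam) (σ : BoundaryCondition G) {v : V}
    (hv : v ∉ σ.dom) :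
    occProb lam G σ v = regionOcc lam G (Finset.univ.filter (· ∉ σ.dom)) σ.occ v := by
  have h1 := finsum_boundary_eq lam σ (fun I => v ∈ I) (fun A => v ∈ A) fun A => by
    have : v ∉ σ.occ := fun h => hv (σ.occ_subset h)
    simp [this]
  have h2 := finsum_boundary_eq lam σ (fun _ => True) (fun _ => True) fun A => Iff.rfl
  simp only [and_true, Finset.filter_true] at h2
  rw [occProb, h1, h2, regionOcc_eq_div, mul_div_mul_left _ _ (pow_pos hlam _).ne']

lemma occProb_of_mem (σ : BoundaryCondition G) {v : V} (hv : v ∈ σ.dom) :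
    (v ∉ σ.occ → occProb lam G σ v = 0) ∧ (v ∈ σ.occ → occProb lam G σ v =
      (∑ᶠ I ∈ {I : Set V | G.IsIndepSet I ∧ I ∩ σ.dom = σ.occ}, lam ^ I.ncard) /
      (∑ᶠ I ∈ {I : Set V | G.IsIndepSet I ∧ I ∩ σ.dom = σ.occ}, lam ^ I.ncard)) := by
  constructor
  · intro h
    have : {I : Set V | G.IsIndepSet I ∧ I ∩ σ.dom = σ.occ ∧ v ∈ I} = ∅ := by
      ext I
      simp only [Set.mem_ofPred_eq, Set.mem_empty_iff_false, iff_false]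
      rintro ⟨-, h1, h2⟩
      exact h (h1 ▸ ⟨h2, hv⟩)
    rw [occProb, this, finsum_mem_empty, zero_div]
  · intro h
    have : {I : Set V | G.IsIndepSet I ∧ I ∩ σ.dom = σ.occ ∧ v ∈ I} =
        {I : Set V | G.IsIndepSet I ∧ I ∩ σ.dom = σ.occ} := by
      ext I
      simp only [Set.mem_ofPred_eq]
      constructor
      · rintro ⟨h1, h2, -⟩; exact ⟨h1, h2⟩
      · rintro ⟨h1, h2⟩; exact ⟨h1, h2, (h2 ▸ h : v ∈ I ∩ σ.dom).1⟩
    rw [occProb, this]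

lemma occProb_eq_one [Finite V] (hlam : 0 < lam) (σ : BoundaryCondition G) {v : V}
    (hv : v ∈ σ.occ) : occProb lam G σ v = 1 := by
  classical
  have := Fintype.ofFinite V
  rw [(occProb_of_mem σ (σ.occ_subset hv)).2 hv]
  have h2 := finsum_boundary_eq lam σ (fun _ => True) (fun _ => True) fun A => Iff.rfl
  simp only [and_true, Finset.filter_true] at h2
  rw [h2, sum_regionWeight_univ, div_self]
  exact (mul_pos (pow_pos hlam _) (indepSum_pos hlam.le _)).ne'

lemma lt_of_add_one_lt {v u : V} {k ℓ : ℕ} (h : G.edist v u ≤ (k : ℕ∞)) (hk : k + 2 ≤ ℓ) :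
    G.edist v u < (ℓ : ℕ∞) :=
  h.trans_lt (by exact_mod_cast (by omega : k < ℓ))

lemma edist_lt_of_adj {v u w : V} {k ℓ : ℕ} (h : G.edist v u ≤ (k : ℕ∞)) (huw : G.Adj u w)
    (hk : k + 2 ≤ ℓ) : G.edist v w < (ℓ : ℕ∞) :=
  calc G.edist v w ≤ G.edist v u + G.edist u w := G.edist_triangle
    _ ≤ k + 1 := add_le_add h (SimpleGraph.edist_eq_one_iff_adj.2 huw).le
    _ < (ℓ : ℕ∞) := by exact_mod_cast (by omega : k + 1 < ℓ)

lemma abs_ratio_occProb_sub_le [Finite V] {α B : ℝ} (hlam : 0 < lam) (hα : 0 < α)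
    (h : lam ≤ α * Real.exp (1 + α)) {σ τ : BoundaryCondition G} {v : V} {ℓ : ℕ} (hℓ : 1 ≤ ℓ)
    (hst : σ.DifferOnlyFrom τ v ℓ) (hB1 : ℓ = 1 → 1 ≤ B)
    (hB : ∀ k, ℓ = k + 2 → 2 * message lam * √(α ^ k * sawCount G v k) ≤ B) (hB0 : 0 ≤ B) :
    |ratio (occProb lam G σ v) - ratio (occProb lam G τ v)| ≤ (1 + lam) ^ 2 * B := by
  classical
  have := Fintype.ofFinite V
  have hvv : G.edist v v < (ℓ : ℕ∞) := by
    rw [SimpleGraph.edist_self]; exact_mod_cast hℓ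
  obtain ⟨hdom, hocc⟩ := hst v hvv
  -- A fixed v has the same probability under σ and τ, so even the default value 1 / 0 = 0 of the
  -- ratio cancels.
  by_cases hv : v ∈ σ.dom
  · have hv' := hdom.1 hv
    have : occProb lam G σ v = occProb lam G τ v := by
      by_cases ho : v ∈ σ.occ
      · rw [occProb_eq_one hlam σ ho, occProb_eq_one hlam τ (hocc.1 ho)]
      · rw [(occProb_of_mem σ hv).1 ho, (occProb_of_mem τ hv').1 fun h => ho (hocc.2 h)]
    rw [this, sub_self, abs_zero]
    positivity
  · have hv' : v ∉ τ.dom := fun h => hv (hdom.2 h)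
    rw [occProb_eq_regionOcc hlam σ hv, occProb_eq_regionOcc hlam τ hv']
    apply abs_ratio_sub_le hlam.le (inv_one_add_le_one_sub_regionOcc hlam.le _ _ _)
      (inv_one_add_le_one_sub_regionOcc hlam.le _ _ _)
    -- Whether u is free depends on its neighbours: free parts that agree up to distance k need
    -- boundary conditions that agree up to k + 1 < ℓ, hence ℓ = k + 2. For ℓ = 1 only |p - q| ≤ 1
    -- is used.
    rcases Nat.lt_or_ge ℓ 2 with h2 | h2
    · refine le_trans ?_ (hB1 (by omega))
      have h0 : 0 < (1 + lam)⁻¹ := by positivity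
      have h1 := inv_one_add_le_one_sub_regionOcc (G := G) hlam.le
        (Finset.univ.filter (· ∉ σ.dom)) σ.occ v
      have h2 := inv_one_add_le_one_sub_regionOcc (G := G) hlam.le
        (Finset.univ.filter (· ∉ τ.dom)) τ.occ v
      have h3 := regionOcc_nonneg (G := G) hlam.le (Finset.univ.filter (· ∉ σ.dom)) σ.occ v
      have h4 := regionOcc_nonneg (G := G) hlam.le (Finset.univ.filter (· ∉ τ.dom)) τ.occ v
      rw [abs_le]; constructor <;> linarith
    · obtain ⟨k, rfl⟩ := Nat.exists_eq_add_of_le' h2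
      refine (abs_regionOcc_sub_le hlam.le hα h (fun v => Set.toFinite _) ?_ le_rfl).trans
        (hB k rfl)
      have hfree : ∀ (ρ : BoundaryCondition G) (u : V),
          u ∈ freePart G (Finset.univ.filter (· ∉ ρ.dom)) ρ.occ ↔
            u ∉ ρ.dom ∧ ∀ w, G.Adj u w → w ∉ ρ.occ := by
        intro ρ u
        simp only [freePart, Finset.mem_filter, Finset.mem_univ, true_and, Set.mem_sdiff,
          Finset.coe_filter, Set.mem_ofPred_eq, not_not]
        refine and_congr_right fun _ => ⟨fun h' w hw hw' => h' w ⟨hw', ρ.occ_subset hw'⟩ hw,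
          fun h' w hw hw' => h' w hw' hw.1⟩
      intro u hu
      rw [hfree, hfree, (hst u (lt_of_add_one_lt hu le_rfl)).1]
      refine and_congr_right fun _ => forall_congr' fun w => forall_congr' fun hw => ?_
      rw [(hst w (edist_lt_of_adj hu hw le_rfl)).2]

end Finite

/-! ### Strong spatial mixing for Gibbs measures -/

section Infinite

variable {V : Type*} {lam : ℝ} {G : SimpleGraph V}

lemma ball_finite (hG : ∀ v, (G.neighborSet v).Finite) (v : V) (ℓ : ℕ) :
    {u | G.edist v u < (ℓ : ℕ∞)}.Finite := by
  have : (⋃ j ∈ Finset.range ℓ, (fun p : Σ w : V, G.Walk v w => p.1) ''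
      {p : Σ w : V, G.Walk v w | p.2.length = j}).Finite :=
    (Finset.range ℓ).finite_toSet.biUnion fun j _ => (finite_walks_length hG j v).image _
  refine this.subset fun u hu => ?_
  obtain ⟨p, hp⟩ := SimpleGraph.exists_walk_of_edist_ne_top (ne_top_of_lt hu)
  simp only [Set.mem_iUnion]
  refine ⟨p.length, ?_, ⟨u, p⟩, rfl, rfl⟩
  rw [Finset.mem_range]
  have : (p.length : ℕ∞) < ℓ := hp ▸ hu
  exact_mod_cast this

/-- The lower integral is superadditive without any measurability, so the conditional probabilities
need not be shown measurable in the outside configuration. -/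
lemma sum_lintegral_le {Ω β : Type*} [MeasurableSpace Ω] (μ : Measure Ω) (s : Finset β)
    (f : β → Ω → ℝ≥0∞) : ∑ b ∈ s, ∫⁻ x, f b x ∂μ ≤ ∫⁻ x, ∑ b ∈ s, f b x ∂μ := by
  classical
  induction s using Finset.induction_on with
  | empty => simp
  | insert b s hb ih =>
    rw [Finset.sum_insert hb]
    simp only [Finset.sum_insert hb]
    exact (add_le_add_right ih _).trans (le_lintegral_add _ _)

-- The DLR equations with B the whole space, summed over the configurations A that satisfy `Q`.
open Classical in
lemma IsGibbsMeasure.measure_le {σ : BoundaryCondition G} {μ : Measure (Set V)} (hlam : 0 ≤ lam)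
    (hμ : IsGibbsMeasure lam G σ μ) {Λ : Finset V} (hΛ : Disjoint (Λ : Set V) σ.dom)
    (Q : Finset V → Prop) [DecidablePred Q] {c : ℝ}
    (hc : ∀ᵐ X ∂μ, ∑ A ∈ Λ.powerset.filter Q, regionProb lam G Λ A X ≤ c) :
    μ {X | ∃ A ⊆ Λ, Q A ∧ X ∩ (Λ : Set V) = (A : Set V)} ≤ ENNReal.ofReal c := by
  have := hμ.prob
  have hsub : {X | ∃ A ⊆ Λ, Q A ∧ X ∩ (Λ : Set V) = (A : Set V)} ⊆
      ⋃ A ∈ Λ.powerset.filter Q, {X : Set V | X ∩ (Λ : Set V) = (A : Set V)} := by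
    rintro X ⟨A, h1, h2, h3⟩
    simp only [Set.mem_iUnion]
    exact ⟨A, by simp [h1, h2], h3⟩
  calc _ ≤ _ := measure_mono hsub
    _ ≤ ∑ A ∈ Λ.powerset.filter Q, μ {X : Set V | X ∩ (Λ : Set V) = (A : Set V)} :=
        measure_biUnion_finset_le _ _
    _ = ∑ A ∈ Λ.powerset.filter Q, ∫⁻ X, ENNReal.ofReal (regionProb lam G Λ A X) ∂μ := by
        refine Finset.sum_congr rfl fun A hA => ?_
        have h := hμ.dlr Λ hΛ A (by simpa using (Finset.mem_filter.1 hA).1) Set.univ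
          MeasurableSet.univ fun _ _ _ => by simp
        simpa using h
    _ ≤ ∫⁻ X, ∑ A ∈ Λ.powerset.filter Q, ENNReal.ofReal (regionProb lam G Λ A X) ∂μ :=
        sum_lintegral_le _ _ _
    _ ≤ ∫⁻ _, ENNReal.ofReal c ∂μ := by
        apply lintegral_mono_ae
        filter_upwards [hc] with X hX
        rw [← ENNReal.ofReal_sum_of_nonneg fun A _ => regionProb_nonneg hlam _ _ _]
        exact ENNReal.ofReal_le_ofReal hX
    _ = ENNReal.ofReal c := by simp

/-- An average lies between the bounds of the conditional probabilities. The lower bound is the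
upper bound for the complement, since 1 ≤ μ(A) + μ(Aᶜ) by subadditivity alone. -/
lemma IsGibbsMeasure.real_mem_Icc {σ : BoundaryCondition G} {μ : Measure (Set V)} (hlam : 0 ≤ lam)
    (hμ : IsGibbsMeasure lam G σ μ) {Λ : Finset V} (hΛ : Disjoint (Λ : Set V) σ.dom) {v : V}
    (hv : v ∈ Λ) {lo hi : ℝ} (hlo : ∀ᵐ X ∂μ, lo ≤ regionOcc lam G Λ X v)
    (hhi : ∀ᵐ X ∂μ, regionOcc lam G Λ X v ≤ hi) :
    lo ≤ μ.real {X | v ∈ X} ∧ μ.real {X | v ∈ X} ≤ hi := by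
  classical
  have := hμ.prob
  have htot : ∀ X, ∑ A ∈ Λ.powerset.filter (fun A => v ∉ A), regionProb lam G Λ A X =
      1 - regionOcc lam G Λ X v := by
    intro X
    have h1 := Finset.sum_filter_add_sum_filter_not Λ.powerset (fun A => v ∈ A)
      fun A => regionProb lam G Λ A X
    have h2 : ∑ A ∈ Λ.powerset, regionProb lam G Λ A X = 1 := by
      simp only [regionProb]
      rw [← Finset.sum_div, div_self]
      rw [sum_regionWeight_univ]
      exact (indepSum_pos hlam _).ne'
    rw [regionOcc, ← h2, ← h1]
    ring
  obtain ⟨X₁, hX₁⟩ := hhi.exists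
  obtain ⟨X₀, hX₀⟩ := hlo.exists
  have hhi0 : 0 ≤ hi := (regionOcc_nonneg hlam _ _ _).trans hX₁
  have hlo1 : 0 ≤ 1 - lo := by
    have := inv_one_add_le_one_sub_regionOcc (G := G) hlam Λ X₀ v
    have h0 : 0 ≤ (1 + lam)⁻¹ := by positivity
    linarith
  have hset : ∀ X : Set V, ∃ A ⊆ Λ, X ∩ (Λ : Set V) = (A : Set V) ∧ (v ∈ A ↔ v ∈ X) := by
    intro X
    refine ⟨Λ.filter (· ∈ X), Finset.filter_subset _ _, ?_, ?_⟩
    · ext u; simp [and_comm]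
    · simp [hv]
  have h1 : μ {X | v ∈ X} ≤ ENNReal.ofReal hi := by
    refine (measure_mono ?_).trans (hμ.measure_le hlam hΛ (fun A => v ∈ A) hhi)
    intro X hX
    obtain ⟨A, hA, hXA, hvA⟩ := hset X
    exact ⟨A, hA, hvA.2 hX, hXA⟩
  have h2 : μ {X | v ∈ X}ᶜ ≤ ENNReal.ofReal (1 - lo) := by
    refine (measure_mono ?_).trans (hμ.measure_le hlam hΛ (fun A => v ∉ A) (c := 1 - lo) ?_)
    · intro X hX
      obtain ⟨A, hA, hXA, hvA⟩ := hset X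
      exact ⟨A, hA, fun h => hX (hvA.1 h), hXA⟩
    · filter_upwards [hlo] with X hX
      rw [htot]; linarith
  have h1' : μ.real {X | v ∈ X} ≤ hi := ENNReal.toReal_le_of_le_ofReal hhi0 h1
  have h2' : μ.real {X | v ∈ X}ᶜ ≤ 1 - lo := ENNReal.toReal_le_of_le_ofReal hlo1 h2
  have h3 : (1 : ℝ) ≤ μ.real {X | v ∈ X} + μ.real {X | v ∈ X}ᶜ := by
    have := measureReal_union_le (μ := μ) {X : Set V | v ∈ X} {X : Set V | v ∈ X}ᶜ
    rwa [Set.union_compl_self, probReal_univ] at this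
  exact ⟨by linarith, h1'⟩

lemma IsGibbsMeasure.real_eq_of_mem {σ : BoundaryCondition G} {μ : Measure (Set V)}
    (hμ : IsGibbsMeasure lam G σ μ) {v : V} (hv : v ∈ σ.dom) :
    μ.real {X | v ∈ X} = open Classical in if v ∈ σ.occ then 1 else 0 := by
  classical
  have := hμ.prob
  have h := hμ.boundary v hv
  split_ifs with ho
  · have : {X : Set V | v ∈ X} =ᵐ[μ] Set.univ := by
      filter_upwards [h] with X hX
      exact eq_true (hX.2 ho)
    rw [measureReal_congr this, probReal_univ]
  · have : {X : Set V | v ∈ X} =ᵐ[μ] (∅ : Set (Set V)) := by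
      filter_upwards [h] with X hX
      exact eq_false fun h' => ho (hX.1 h')
    rw [measureReal_congr this, measureReal_empty]

lemma abs_ratio_gibbs_sub_le {α B : ℝ} (hlam : 0 < lam) (hα : 0 < α)
    (h : lam ≤ α * Real.exp (1 + α)) (hG : ∀ v, (G.neighborSet v).Finite)
    {σ τ : BoundaryCondition G} {v : V} {ℓ : ℕ} (hℓ : 1 ≤ ℓ) (hst : σ.DifferOnlyFrom τ v ℓ)
    {μ ν : Measure (Set V)} (hμ : IsGibbsMeasure lam G σ μ) (hν : IsGibbsMeasure lam G τ ν)
    (hB1 : ℓ = 1 → 1 ≤ B)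
    (hB : ∀ k, ℓ = k + 2 → 2 * message lam * √(α ^ k * sawCount G v k) ≤ B) (hB0 : 0 ≤ B) :
    |ratio (μ.real {X | v ∈ X}) - ratio (ν.real {X | v ∈ X})| ≤ (1 + lam) ^ 2 * B := by
  classical
  have := hμ.prob
  have := hν.prob
  have hvv : G.edist v v < (ℓ : ℕ∞) := by
    rw [SimpleGraph.edist_self]; exact_mod_cast hℓ
  obtain ⟨hdom, hocc⟩ := hst v hvv
  by_cases hv : v ∈ σ.dom
  · have hv' := hdom.1 hv
    rw [hμ.real_eq_of_mem hv, hν.real_eq_of_mem hv']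
    simp only [hocc]
    rw [sub_self, abs_zero]
    positivity
  · have hfin := ball_finite hG v ℓ
    set Λ : Finset V := hfin.toFinset.filter (· ∉ σ.dom) with hΛ
    have hmem : ∀ u, u ∈ Λ ↔ G.edist v u < (ℓ : ℕ∞) ∧ u ∉ σ.dom := fun u => by simp [hΛ]
    have hmem' : ∀ u, u ∈ Λ ↔ G.edist v u < (ℓ : ℕ∞) ∧ u ∉ τ.dom := fun u => by
      rw [hmem]
      exact and_congr_right fun hu => not_congr (hst u hu).1
    have hΛσ : Disjoint (Λ : Set V) σ.dom :=
      Set.disjoint_left.2 fun u hu => ((hmem u).1 hu).2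
    have hΛτ : Disjoint (Λ : Set V) τ.dom :=
      Set.disjoint_left.2 fun u hu => ((hmem' u).1 hu).2
    have hvΛ : v ∈ Λ := (hmem v).2 ⟨hvv, hv⟩
    have hgood : ∀ (ρ : BoundaryCondition G) (m : Measure (Set V)), IsGibbsMeasure lam G ρ m →
        ∀ᵐ X ∂m, ∀ u ∈ {u | G.edist v u < (ℓ : ℕ∞)}, u ∈ ρ.dom → (u ∈ X ↔ u ∈ ρ.occ) := by
      intro ρ m hm
      rw [ae_ball_iff hfin.countable]
      intro u _
      by_cases hu : u ∈ ρ.dom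
      · filter_upwards [hm.boundary u hu] with X hX _
        exact hX
      · exact Eventually.of_forall fun X hX => absurd hX hu
    -- Outside Λ, at distance less than ℓ from v, only fixed vertices remain, and there X and Y
    -- follow σ and τ, which agree. Farther out X and Y are arbitrary, so the bound does not depend
    -- on the choice of the Gibbs measures.
    have hclose : ∀ X Y : Set V,
        (∀ u ∈ {u | G.edist v u < (ℓ : ℕ∞)}, u ∈ σ.dom → (u ∈ X ↔ u ∈ σ.occ)) →
        (∀ u ∈ {u | G.edist v u < (ℓ : ℕ∞)}, u ∈ τ.dom → (u ∈ Y ↔ u ∈ τ.occ)) →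
        |regionOcc lam G Λ X v - regionOcc lam G Λ Y v| ≤ B := by
      intro X Y hX hY
      rcases Nat.lt_or_ge ℓ 2 with h2 | h2
      · refine le_trans ?_ (hB1 (by omega))
        have h0 : 0 < (1 + lam)⁻¹ := by positivity
        have h1 := inv_one_add_le_one_sub_regionOcc (G := G) hlam.le Λ X v
        have h2 := inv_one_add_le_one_sub_regionOcc (G := G) hlam.le Λ Y v
        have h3 := regionOcc_nonneg (G := G) hlam.le Λ X v
        have h4 := regionOcc_nonneg (G := G) hlam.le Λ Y v
        rw [abs_le]; constructor <;> linarith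
      · obtain ⟨k, rfl⟩ := Nat.exists_eq_add_of_le' h2
        refine (abs_regionOcc_sub_le hlam.le hα h hG ?_ le_rfl).trans (hB k rfl)
        intro u hu
        simp only [freePart, Finset.mem_filter]
        refine and_congr_right fun _ => forall_congr' fun w => ?_
        by_cases huw : G.Adj u w
        · have hw := edist_lt_of_adj hu huw le_rfl
          have : w ∈ X \ (Λ : Set V) ↔ w ∈ Y \ (Λ : Set V) := by
            simp only [Set.mem_sdiff, Finset.mem_coe]
            by_cases hwΛ : w ∈ Λ
            · simp [hwΛ]
            · have hwσ : w ∈ σ.dom := by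
                by_contra hc; exact hwΛ ((hmem w).2 ⟨hw, hc⟩)
              rw [hX w hw hwσ, hY w hw ((hst w hw).1.1 hwσ), (hst w hw).2]
          rw [this]
        · simp [huw]
    have hX := hgood σ μ hμ
    have hY := hgood τ ν hν
    -- Y is kept fixed while X is averaged over μ; afterwards Y is averaged over ν.
    have h1 : ∀ Y : Set V, (∀ u ∈ {u | G.edist v u < (ℓ : ℕ∞)}, u ∈ τ.dom →
        (u ∈ Y ↔ u ∈ τ.occ)) → |μ.real {X | v ∈ X} - regionOcc lam G Λ Y v| ≤ B := by
      intro Y hY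
      have := hμ.real_mem_Icc hlam.le hΛσ hvΛ (lo := regionOcc lam G Λ Y v - B)
        (hi := regionOcc lam G Λ Y v + B)
        (by filter_upwards [hX] with X hX; have := (abs_le.1 (hclose X Y hX hY)).1; linarith)
        (by filter_upwards [hX] with X hX; have := (abs_le.1 (hclose X Y hX hY)).2; linarith)
      rw [abs_le]; constructor <;> linarith
    have h2 := hν.real_mem_Icc hlam.le hΛτ hvΛ (lo := μ.real {X | v ∈ X} - B)
        (hi := μ.real {X | v ∈ X} + B)
        (by filter_upwards [hY] with Y hY; have := (abs_le.1 (h1 Y hY)).2; linarith)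
        (by filter_upwards [hY] with Y hY; have := (abs_le.1 (h1 Y hY)).1; linarith)
    have hle : ∀ (ρ : BoundaryCondition G) (m : Measure (Set V)), IsGibbsMeasure lam G ρ m →
        Disjoint (Λ : Set V) ρ.dom → (1 + lam)⁻¹ ≤ 1 - m.real {X | v ∈ X} := by
      intro ρ m hm hd
      have := (hm.real_mem_Icc hlam.le hd hvΛ (lo := 0) (hi := 1 - (1 + lam)⁻¹)
        (Eventually.of_forall fun X => regionOcc_nonneg hlam.le _ _ _)
        (Eventually.of_forall fun X => by
          have := inv_one_add_le_one_sub_regionOcc (G := G) hlam.le Λ X v; linarith)).2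
      linarith
    refine abs_ratio_sub_le hlam.le (hle σ μ hμ hΛσ) (hle τ ν hν hΛτ) ?_
    rw [abs_le]; constructor <;> linarith

end Infinite

/-! ### Growth of the number of self-avoiding walks and strong spatial mixing -/

lemma sawCount_zero_le {V : Type*} (G : SimpleGraph V) (v : V) : sawCount G v 0 ≤ 1 := by
  have : {p : Σ w : V, G.Walk v w | p.2.IsPath ∧ p.2.length = 0} ⊆
      {(⟨v, SimpleGraph.Walk.nil⟩ : Σ w : V, G.Walk v w)} := by
    rintro ⟨w, p⟩ ⟨-, hp⟩
    cases p with
    | nil => rfl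
    | cons h p => simp at hp
  exact (Set.ncard_le_ncard this).trans (Set.ncard_singleton _).le

/-- The limsup lies below Δ', so N ≤ Δ'^k from some length on; c absorbs the finitely many earlier
lengths. -/
lemma exists_sawCount_le {V : Type*} (G : SimpleGraph V) {Δ Δ' : ℝ} (hΔ : 0 < Δ) (hΔ' : Δ < Δ')
    (h : connectiveConstant G ≤ ENNReal.ofReal Δ) (v : V) :
    ∃ c : ℝ, 0 ≤ c ∧ ∀ k, (sawCount G v k : ℝ) ≤ c * Δ' ^ k := by
  have hpos : 0 < Δ' := hΔ.trans hΔ'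
  have hlim : limsup (fun ℓ : ℕ => (sawCount G v ℓ : ℝ≥0∞) ^ ((1 : ℝ) / (ℓ : ℝ))) atTop <
      ENNReal.ofReal Δ' :=
    ((le_iSup (fun v : V => limsup (fun ℓ : ℕ => (sawCount G v ℓ : ℝ≥0∞) ^ ((1 : ℝ) / (ℓ : ℝ)))
      atTop) v).trans h).trans_lt ((ENNReal.ofReal_lt_ofReal_iff hpos).2 hΔ')
  obtain ⟨ℓ₀, hℓ₀⟩ := eventually_atTop.1 (eventually_lt_of_limsup_lt hlim)
  have hlarge : ∀ k, ℓ₀ ≤ k → 1 ≤ k → (sawCount G v k : ℝ) ≤ Δ' ^ k := by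
    intro k hk hk1
    have h1 := (hℓ₀ k hk).le
    have hk0 : (0 : ℝ) < k := by exact_mod_cast hk1
    have h2 := ENNReal.rpow_le_rpow h1 hk0.le
    rw [← ENNReal.rpow_mul, one_div_mul_cancel hk0.ne', ENNReal.rpow_one, ENNReal.rpow_natCast,
      ← ENNReal.ofReal_pow hpos.le] at h2
    have h3 := ENNReal.toReal_mono ENNReal.ofReal_ne_top h2
    rwa [ENNReal.toReal_natCast, ENNReal.toReal_ofReal (by positivity)] at h3
  refine ⟨1 + ∑ j ∈ Finset.range (ℓ₀ + 1), (sawCount G v j : ℝ) / Δ' ^ j, by positivity, fun k => ?_⟩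
  rcases Nat.lt_or_ge k (ℓ₀ + 1) with hk | hk
  · have h1 : (sawCount G v k : ℝ) / Δ' ^ k ≤
        ∑ j ∈ Finset.range (ℓ₀ + 1), (sawCount G v j : ℝ) / Δ' ^ j :=
      Finset.single_le_sum (f := fun j => (sawCount G v j : ℝ) / Δ' ^ j)
        (fun j _ => by positivity) (Finset.mem_range.2 hk)
    calc (sawCount G v k : ℝ) = (sawCount G v k : ℝ) / Δ' ^ k * Δ' ^ k := by field_simp
      _ ≤ _ := by gcongr; linarith
  · refine (hlarge k (by omega) (by omega)).trans (le_mul_of_one_le_left (by positivity) ?_)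
    have : 0 ≤ ∑ j ∈ Finset.range (ℓ₀ + 1), (sawCount G v j : ℝ) / Δ' ^ j := by positivity
    linarith

lemma exp_neg_log_half {ρ : ℝ} (hρ : 0 < ρ) (k : ℕ) :
    √(ρ ^ k) = Real.exp (-(-(Real.log ρ) / 2 * k)) := by
  have : ρ ^ k = Real.exp (-(-(Real.log ρ) / 2 * k)) ^ 2 := by
    rw [← Real.exp_nat_mul]
    conv_lhs => rw [← Real.exp_log hρ, ← Real.exp_nat_mul]
    congr 1; push_cast; ring
  rw [this, Real.sqrt_sq (Real.exp_pos _).le]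

theorem strongSpatialMixing {ι : Type*} {V : ι → Type*} (G : ∀ i, SimpleGraph (V i))
    (hG : ∀ (i : ι) (v : V i), ((G i).neighborSet v).Finite)
    {lam Δ : ℝ} (hlam : 0 < lam) (hΔ : 0 < Δ) (hcrit : lam < criticalActivity (Δ + 1))
    {a : ℝ} (hconn : ConnectiveConstantAtMost G Δ a) : StrongSpatialMixing lam G a := by
  obtain ⟨α, hα, hαΔ, hαlam⟩ := exists_contraction_rate hΔ hcrit
  obtain ⟨⟨c, hc⟩, hinf⟩ := hconn
  have hM := message_nonneg lam
  constructor
  · set ρ := α * Δ with hρ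
    have hρ0 : 0 < ρ := mul_pos hα hΔ
    -- The walk bound is available at ℓ = k + 2, the length known to pass the threshold, and α^k
    -- Δ^(k+2) = α⁻² ρ^(k+2). The second entry serves k = 0, which is missing from the sum over j ≥
    -- 1.
    set c' : ℝ := max (|c| * (α ^ 2)⁻¹) (ρ ^ 2)⁻¹ with hc'
    have hc'0 : 0 ≤ c' := le_max_of_le_right (by positivity)
    -- The summand (√ρ)⁻¹ makes the bound at least 1 at ℓ = 1.
    set K : ℝ := 2 * message lam * √c' + (√ρ)⁻¹ with hK
    refine ⟨(1 + lam) ^ 2 * K, -(Real.log ρ) / 2, ?_, ?_⟩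
    · have := Real.log_neg hρ0 hαΔ
      linarith
    · intro i hfin v ℓ hℓ haℓ σ τ hst
      rw [← exp_neg_log_half hρ0, mul_assoc]
      refine abs_ratio_occProb_sub_le hlam hα hαlam hℓ hst ?_ ?_ (by positivity)
      · rintro rfl
        rw [pow_one, hK, add_mul, inv_mul_cancel₀ (Real.sqrt_pos.2 hρ0).ne']
        have : 0 ≤ 2 * message lam * √c' * √ρ := by positivity
        linarith
      · rintro k rfl
        have hkey : α ^ k * sawCount (G i) v k ≤ c' * ρ ^ (k + 2) := by
          rcases Nat.eq_zero_or_pos k with rfl | hk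
          · have h1 : (sawCount (G i) v 0 : ℝ) ≤ 1 := by exact_mod_cast sawCount_zero_le (G i) v
            calc α ^ 0 * (sawCount (G i) v 0 : ℝ) ≤ (ρ ^ 2)⁻¹ * ρ ^ (0 + 2) := by
                  rw [pow_zero, one_mul, zero_add, inv_mul_cancel₀ (by positivity)]; exact h1
              _ ≤ _ := by gcongr; exact le_max_right _ _
          · have h1 := hc i hfin v (k + 2) haℓ
            have h2 : (sawCount (G i) v k : ℝ) ≤
                ∑ j ∈ Finset.Icc 1 (k + 2), (sawCount (G i) v j : ℝ) :=
              Finset.single_le_sum (f := fun j => (sawCount (G i) v j : ℝ))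
                (fun j _ => by positivity) (Finset.mem_Icc.2 ⟨hk, by omega⟩)
            calc α ^ k * (sawCount (G i) v k : ℝ) ≤ α ^ k * (|c| * Δ ^ (k + 2)) := by
                  gcongr
                  exact (h2.trans h1).trans (by gcongr; exact le_abs_self c)
              _ = (|c| * (α ^ 2)⁻¹) * ρ ^ (k + 2) := by
                  rw [hρ, mul_pow, pow_add α]; field_simp
              _ ≤ _ := by gcongr; exact le_max_left _ _
        calc 2 * message lam * √(α ^ k * sawCount (G i) v k)
            ≤ 2 * message lam * √(c' * ρ ^ (k + 2)) := by gcongr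
          _ = 2 * message lam * √c' * √(ρ ^ (k + 2)) := by rw [Real.sqrt_mul hc'0]; ring
          _ ≤ _ := by
              gcongr
              rw [hK]
              have : 0 ≤ (√ρ)⁻¹ := by positivity
              linarith
  · intro i hi v
    -- The limsup controls only rates above Δ; the gap between Δ and 1/α leaves room for one.
    obtain ⟨Δ', h1, h2⟩ := exists_between ((lt_div_iff₀' hα).2 hαΔ)
    rw [lt_div_iff₀' hα] at h2
    obtain ⟨c, hc0, hcv⟩ := exists_sawCount_le (G i) hΔ h1 (hinf i hi) v
    set ρ := α * Δ' with hρ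
    have hρ0 : 0 < ρ := mul_pos hα (hΔ.trans h1)
    set c' : ℝ := c * (ρ ^ 2)⁻¹ with hc'
    have hc'0 : 0 ≤ c' := by positivity
    set K : ℝ := 2 * message lam * √c' + (√ρ)⁻¹ with hK
    refine ⟨(1 + lam) ^ 2 * K, -(Real.log ρ) / 2, ?_, ?_⟩
    · have := Real.log_neg hρ0 h2
      linarith
    · intro ℓ hℓ σ τ hst μ ν hμ hν
      rw [← exp_neg_log_half hρ0, mul_assoc]
      refine abs_ratio_gibbs_sub_le hlam hα hαlam (hG i) hℓ hst hμ hν ?_ ?_ (by positivity)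
      · rintro rfl
        rw [pow_one, hK, add_mul, inv_mul_cancel₀ (Real.sqrt_pos.2 hρ0).ne']
        have : 0 ≤ 2 * message lam * √c' * √ρ := by positivity
        linarith
      · rintro k rfl
        have hkey : α ^ k * sawCount (G i) v k ≤ c' * ρ ^ (k + 2) := by
          calc α ^ k * (sawCount (G i) v k : ℝ) ≤ α ^ k * (c * Δ' ^ k) := by
                gcongr; exact hcv k
            _ = c' * ρ ^ (k + 2) := by
                have := (hΔ.trans h1).ne'
                rw [hc', pow_add ρ, hρ, mul_pow α Δ' k]; field_simp
        calc 2 * message lam * √(α ^ k * sawCount (G i) v k)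
            ≤ 2 * message lam * √(c' * ρ ^ (k + 2)) := by gcongr
          _ = 2 * message lam * √c' * √(ρ ^ (k + 2)) := by rw [Real.sqrt_mul hc'0]; ring
          _ ≤ _ := by
              gcongr
              rw [hK]
              have : 0 ≤ (√ρ)⁻¹ := by positivity
              linarith

/-! ### Cost bounds for programs without loops -/

lemma size_add_le (a b : ℕ) : Nat.size (a + b) ≤ Nat.size a + Nat.size b + 1 := by
  rw [Nat.size_le]
  have h1 := Nat.lt_size_self a
  have h2 := Nat.lt_size_self b
  have h3 : 2 ^ Nat.size a ≤ 2 ^ (Nat.size a + Nat.size b) :=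
    Nat.pow_le_pow_right two_pos (Nat.le_add_right _ _)
  have h4 : 2 ^ Nat.size b ≤ 2 ^ (Nat.size a + Nat.size b) :=
    Nat.pow_le_pow_right two_pos (Nat.le_add_left _ _)
  rw [pow_succ]
  omega

lemma size_mul_le (a b : ℕ) : Nat.size (a * b) ≤ Nat.size a + Nat.size b := by
  rw [Nat.size_le, pow_add]
  exact Nat.mul_lt_mul'' (Nat.lt_size_self a) (Nat.lt_size_self b)

/-- Expressions without oracle queries. -/
def Expr.QueryFree : Expr → Prop
  | .const _ => True
  | .load e => e.QueryFree
  | .add e f => e.QueryFree ∧ f.QueryFree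
  | .sub e f => e.QueryFree ∧ f.QueryFree
  | .mul e f => e.QueryFree ∧ f.QueryFree
  | .div e f => e.QueryFree ∧ f.QueryFree
  | .query _ => False

/-- A fixed expression performs a bounded number of operations. Each of them keeps lengths linear in
W, and the charge for a product of two lengths is quadratic. -/
lemma Expr.exists_cost_le (e : Expr) (he : e.QueryFree) :
    ∃ c, ∀ (O : ℕ → ℕ) (s : Store) (W : ℕ), (∀ i, Nat.size (s i) ≤ W) →
      Nat.size (e.eval O s) ≤ c * (W + 1) ∧ e.cost O s ≤ c * (W + 1) ^ 2 := by
  induction e with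
  | const c =>
    refine ⟨Nat.size c + 1, fun O s W _ => ⟨?_, ?_⟩⟩
    · simp only [Expr.eval]; nlinarith
    · simp only [Expr.cost]; nlinarith [Nat.one_le_pow 2 (W + 1) (Nat.succ_pos W)]
  | load e ih =>
    obtain ⟨c, hc⟩ := ih he
    refine ⟨2 * c + 1, fun O s W hs => ?_⟩
    obtain ⟨h1, h2⟩ := hc O s W hs
    have h3 := hs (e.eval O s)
    simp only [Expr.eval, Expr.cost]
    constructor
    · nlinarith
    · nlinarith [Nat.zero_le (c * W), Nat.zero_le (c * W ^ 2)]
  | add e f ihe ihf =>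
    obtain ⟨c, hc⟩ := ihe he.1
    obtain ⟨d, hd⟩ := ihf he.2
    refine ⟨2 * c + 2 * d + 1, fun O s W hs => ?_⟩
    obtain ⟨h1, h2⟩ := hc O s W hs
    obtain ⟨h3, h4⟩ := hd O s W hs
    have h5 := size_add_le (e.eval O s) (f.eval O s)
    simp only [Expr.eval, Expr.cost]
    constructor
    · nlinarith
    · nlinarith [Nat.zero_le (c * W), Nat.zero_le (c * W ^ 2), Nat.zero_le (d * W),
        Nat.zero_le (d * W ^ 2)]
  | sub e f ihe ihf =>
    obtain ⟨c, hc⟩ := ihe he.1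
    obtain ⟨d, hd⟩ := ihf he.2
    refine ⟨2 * c + 2 * d + 1, fun O s W hs => ?_⟩
    obtain ⟨h1, h2⟩ := hc O s W hs
    obtain ⟨h3, h4⟩ := hd O s W hs
    have h5 := Nat.size_le_size (Nat.sub_le (e.eval O s) (f.eval O s))
    simp only [Expr.eval, Expr.cost]
    constructor
    · nlinarith
    · nlinarith [Nat.zero_le (c * W), Nat.zero_le (c * W ^ 2), Nat.zero_le (d * W),
        Nat.zero_le (d * W ^ 2)]
  | mul e f ihe ihf =>
    obtain ⟨c, hc⟩ := ihe he.1
    obtain ⟨d, hd⟩ := ihf he.2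
    refine ⟨c + d + (c + 1) * (d + 1), fun O s W hs => ?_⟩
    obtain ⟨h1, h2⟩ := hc O s W hs
    obtain ⟨h3, h4⟩ := hd O s W hs
    have h5 := size_mul_le (e.eval O s) (f.eval O s)
    simp only [Expr.eval, Expr.cost]
    have h6 : (Nat.size (e.eval O s) + 1) * (Nat.size (f.eval O s) + 1) ≤
        ((c + 1) * (W + 1)) * ((d + 1) * (W + 1)) := Nat.mul_le_mul (by nlinarith) (by nlinarith)
    constructor
    · nlinarith [Nat.zero_le ((c + 1) * (d + 1) * (W + 1))]
    · nlinarith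
  | div e f ihe ihf =>
    obtain ⟨c, hc⟩ := ihe he.1
    obtain ⟨d, hd⟩ := ihf he.2
    refine ⟨c + d + (c + 1) * (d + 1), fun O s W hs => ?_⟩
    obtain ⟨h1, h2⟩ := hc O s W hs
    obtain ⟨h3, h4⟩ := hd O s W hs
    have h5 := Nat.size_le_size (Nat.div_le_self (e.eval O s) (f.eval O s))
    simp only [Expr.eval, Expr.cost]
    have h6 : (Nat.size (e.eval O s) + 1) * (Nat.size (f.eval O s) + 1) ≤
        ((c + 1) * (W + 1)) * ((d + 1) * (W + 1)) := Nat.mul_le_mul (by nlinarith) (by nlinarith)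
    constructor
    · nlinarith [Nat.zero_le ((c + 1) * (d + 1) * (W + 1)), Nat.zero_le (d * (W + 1))]
    · nlinarith
  | query e => exact he.elim

/-- Programs without loops and oracle queries. -/
def Program.Simple : Program → Prop
  | .skip => True
  | .assign e f => e.QueryFree ∧ f.QueryFree
  | .seq P Q => P.Simple ∧ Q.Simple
  | .ite e P Q => e.QueryFree ∧ P.Simple ∧ Q.Simple
  | .loop _ _ => False

/-- The effect of a program without loops. -/
def Program.exec (O : ℕ → ℕ) : Program → Store → Store
  | .skip, s => s
  | .assign e f, s => Function.update s (e.eval O s) (f.eval O s)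
  | .seq P Q, s => Q.exec O (P.exec O s)
  | .ite e P Q, s => if e.eval O s ≠ 0 then P.exec O s else Q.exec O s
  | .loop _ _, s => s

/-- The length bound is multiplied by c, so iterating it over a loop would be exponential. For loops
the bound W is instead required of all states that occur. -/
lemma Program.exists_runs_le (P : Program) (hP : P.Simple) :
    ∃ c, ∀ (O : ℕ → ℕ) (s : Store) (W : ℕ), (∀ i, Nat.size (s i) ≤ W) →
      ∃ t, P.Runs O s (P.exec O s) t ∧ t ≤ c * (W + 1) ^ 2 ∧
        ∀ i, Nat.size (P.exec O s i) ≤ c * (W + 1) := by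
  induction P with
  | skip =>
    refine ⟨1, fun O s W hs => ⟨1, .skip s, ?_, fun i => ?_⟩⟩
    · nlinarith [Nat.one_le_pow 2 (W + 1) (Nat.succ_pos W)]
    · have := hs i
      simp only [Program.exec]; omega
  | assign e f =>
    obtain ⟨c, hc⟩ := e.exists_cost_le hP.1
    obtain ⟨d, hd⟩ := f.exists_cost_le hP.2
    refine ⟨2 * c + 2 * d + 1, fun O s W hs => ⟨_, .assign e f s, ?_, fun i => ?_⟩⟩
    · obtain ⟨h1, h2⟩ := hc O s W hs
      obtain ⟨h3, h4⟩ := hd O s W hs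
      nlinarith [Nat.zero_le (c * W), Nat.zero_le (c * W ^ 2), Nat.zero_le (d * W),
        Nat.zero_le (d * W ^ 2)]
    · simp only [Program.exec, Function.update_apply]
      split_ifs
      · have := (hd O s W hs).1
        nlinarith
      · have := hs i
        nlinarith [Nat.zero_le (c * W), Nat.zero_le (d * W)]
  | seq P Q ihP ihQ =>
    obtain ⟨c, hc⟩ := ihP hP.1
    obtain ⟨d, hd⟩ := ihQ hP.2
    refine ⟨c + d * (c + 1) ^ 2 + 1, fun O s W hs => ?_⟩
    obtain ⟨t, h1, h2, h3⟩ := hc O s W hs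
    obtain ⟨t', h4, h5, h6⟩ := hd O _ _ h3
    have h7 : c * (W + 1) + 1 ≤ (c + 1) * (W + 1) := by nlinarith
    refine ⟨_, .seq h1 h4, ?_, fun i => (h6 i).trans ?_⟩
    · have h8 : d * (c * (W + 1) + 1) ^ 2 ≤ d * (c + 1) ^ 2 * (W + 1) ^ 2 := by
        rw [mul_assoc, ← mul_pow]
        exact Nat.mul_le_mul_left _ (Nat.pow_le_pow_left h7 2)
      nlinarith
    · calc d * (c * (W + 1) + 1) ≤ d * ((c + 1) * (W + 1)) := Nat.mul_le_mul_left _ h7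
        _ = (d * (c + 1)) * (W + 1) := by ring
        _ ≤ _ := Nat.mul_le_mul_right _ (by
          have : d * (c + 1) ≤ d * (c + 1) ^ 2 :=
            Nat.mul_le_mul_left _ (Nat.le_self_pow two_ne_zero _)
          omega)
  | ite e P Q ihP ihQ =>
    obtain ⟨b, hb⟩ := e.exists_cost_le hP.1
    obtain ⟨c, hc⟩ := ihP hP.2.1
    obtain ⟨d, hd⟩ := ihQ hP.2.2
    refine ⟨b + c + d + 1, fun O s W hs => ?_⟩
    have h0 := (hb O s W hs).2
    by_cases he : e.eval O s = 0
    · obtain ⟨t, h1, h2, h3⟩ := hd O s W hs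
      have hx : (Program.ite e P Q).exec O s = Q.exec O s := by simp [Program.exec, he]
      rw [hx]
      refine ⟨_, .ite_false he h1, ?_, fun i => (h3 i).trans ?_⟩
      · nlinarith [Nat.zero_le (c * (W + 1) ^ 2), Nat.one_le_pow 2 (W + 1) (Nat.succ_pos W)]
      · exact Nat.mul_le_mul_right _ (by omega)
    · obtain ⟨t, h1, h2, h3⟩ := hc O s W hs
      have hx : (Program.ite e P Q).exec O s = P.exec O s := by simp [Program.exec, he]
      rw [hx]
      refine ⟨_, .ite_true he h1, ?_, fun i => (h3 i).trans ?_⟩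
      · nlinarith [Nat.zero_le (d * (W + 1) ^ 2), Nat.one_le_pow 2 (W + 1) (Nat.succ_pos W)]
      · exact Nat.mul_le_mul_right _ (by omega)
  | loop e P => exact hP.elim

/-- A loop whose states are tracked by a sequence of predicates `I 0, …, I T`. -/
lemma Program.runs_loop {test : Expr} {P : Program} (htest : test.QueryFree)
    (hP : P.Simple) : ∃ c, ∀ (O : ℕ → ℕ) (I : ℕ → Store → Prop) (T W : ℕ),
      (∀ j ≤ T, ∀ s, I j s → ∀ i, Nat.size (s i) ≤ W) →
      (∀ j < T, ∀ s, I j s → test.eval O s ≠ 0 ∧ I (j + 1) (P.exec O s)) →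
      (∀ s, I T s → test.eval O s = 0) → ∀ s, I 0 s →
      ∃ s' t, (Program.loop test P).Runs O s s' t ∧ I T s' ∧ t ≤ c * (T + 1) * (W + 1) ^ 2 := by
  obtain ⟨b, hb⟩ := test.exists_cost_le htest
  obtain ⟨c, hc⟩ := P.exists_runs_le hP
  refine ⟨b + c + 1, fun O I T W hW hstep hdone => ?_⟩
  have key : ∀ r j, j + r = T → ∀ s, I j s → ∃ s' t, (Program.loop test P).Runs O s s' t ∧
      I T s' ∧ t ≤ (b + c + 1) * (r + 1) * (W + 1) ^ 2 := by
    intro r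
    induction r with
    | zero =>
      rintro j rfl s hs
      refine ⟨s, _, .loop_done (hdone s hs), hs, ?_⟩
      have := (hb O s W (hW _ le_rfl s hs)).2
      nlinarith [Nat.zero_le (c * (W + 1) ^ 2), Nat.one_le_pow 2 (W + 1) (Nat.succ_pos W)]
    | succ r ih =>
      intro j hj s hs
      obtain ⟨h1, h2⟩ := hstep j (by omega) s hs
      have hsW := hW j (by omega) s hs
      obtain ⟨t, h3, h4, -⟩ := hc O s W hsW
      obtain ⟨s', t', h5, h6, h7⟩ := ih (j + 1) (by omega) _ h2
      refine ⟨s', _, .loop_step h1 h3 h5, h6, ?_⟩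
      have h8 := (hb O s W hsW).2
      calc test.cost O s + t + t' + 1 ≤ b * (W + 1) ^ 2 + c * (W + 1) ^ 2 +
            (b + c + 1) * (r + 1) * (W + 1) ^ 2 + (W + 1) ^ 2 := by
            have : 1 ≤ (W + 1) ^ 2 := Nat.one_le_pow _ _ (Nat.succ_pos W)
            omega
        _ = _ := by ring
  intro s hs
  exact key T 0 (by omega) s hs

/-! ### A stack machine for the tree recursion -/

/-- A frame of the depth first search: the current vertex (or the virtual root, which is adjacent
to all vertices), the next vertex `ptr` to look at and `bit = 2 ^ ptr`, the set of removed vertices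
as a bit mask, the fuel that is halved at every level, and the weights of the part of the subtree
that has been explored, with the current vertex occupied and vacant. -/
structure Frame where
  root : ℕ
  vtx : ℕ
  ptr : ℕ
  bit : ℕ
  mask : ℕ
  fuel : ℕ
  occ : ℕ
  vac : ℕ

/-- Nonzero if the next vertex is a child of the frame; `a` is the adjacency matrix. -/
def Frame.allowed (n : ℕ) (a : ℕ → ℕ) (f : Frame) : ℕ :=
  (f.root + a (f.vtx * n + f.ptr)) * f.fuel * (1 - (f.mask / f.bit - 2 * (f.mask / f.bit / 2)))

/-- The frame of the next child. -/
def Frame.child (f : Frame) : Frame :=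
  ⟨0, f.ptr, 0, 1, f.mask + f.bit, f.fuel / 2, 1, 1⟩

/-- The frame after its next child has been pushed. -/
def Frame.take (f : Frame) : Frame :=
  ⟨f.root, f.vtx, f.ptr + 1, f.bit + f.bit, f.mask + f.bit, f.fuel, f.occ, f.vac⟩

/-- The frame after the next vertex has been skipped. -/
def Frame.skip (f : Frame) : Frame :=
  ⟨f.root, f.vtx, f.ptr + 1, f.bit + f.bit, f.mask, f.fuel, f.occ, f.vac⟩

/-- The frame `g` after its child `f` has been explored. -/
def Frame.absorb (N D : ℕ) (g f : Frame) : Frame :=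
  ⟨g.root, g.vtx, g.ptr, g.bit, g.mask, g.fuel, g.occ * (D * f.vac),
    g.vac * (N * f.occ + D * f.vac)⟩

/-- One step of the depth first search for the activity `N / D`. -/
def dfsStep (n : ℕ) (a : ℕ → ℕ) (N D : ℕ) : List Frame → List Frame
  | [] => []
  | f :: l =>
    if f.ptr < n then
      if f.allowed n a ≠ 0 then f.child :: f.take :: l else f.skip :: l
    else match l with
      | [] => [f]
      | g :: l' => g.absorb N D f :: l'

/-- The number of nodes of the recursion tree of depth `k`. -/
noncomputable def nodeCount {V : Type*} (G : SimpleGraph V) (E : List V) :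
    ℕ → Finset V → V → ℕ
  | 0 => fun _ _ => 1
  | k + 1 => fun S v => 1 + childSum (nodeCount G E k) (G.Adj v) E S

/-- The binary length of the fuel is the depth that remains; halving decrements it, and no logarithm
has to be computed. -/
lemma size_div_two {q k : ℕ} (h : Nat.size q = k + 1) : Nat.size (q / 2) = k := by
  apply le_antisymm
  · rw [Nat.size_le]
    have := Nat.lt_size_self q
    rw [h, pow_succ] at this
    omega
  · rcases k with _ | k
    · exact Nat.zero_le _
    · have h1 : k + 1 < Nat.size q := by omega
      rw [Nat.lt_size, pow_succ] at h1
      have : k < Nat.size (q / 2) := by rw [Nat.lt_size]; omega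
      exact this

/-- Bit u of S is 0, so the addition produces no carry. -/
lemma testBit_add_two_pow {S u : ℕ} (h : S.testBit u = false) (w : ℕ) :
    (S + 2 ^ u).testBit w = (decide (w = u) || S.testBit w) := by
  have h1 : S / 2 ^ u % 2 = 0 := by
    rw [Nat.testBit_eq_decide_div_mod_eq] at h
    have := of_decide_eq_false h
    omega
  set a := S / 2 ^ u / 2
  set b := S % 2 ^ u
  have hb : b < 2 ^ u := Nat.mod_lt _ (by positivity)
  have hS : S = 2 ^ (u + 1) * a + b := by
    have h2 := Nat.div_add_mod S (2 ^ u)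
    have h3 := Nat.div_add_mod (S / 2 ^ u) 2
    rw [h1, add_zero] at h3
    rw [pow_succ, mul_assoc, h3, h2]
  have hu : 2 ^ (u + 1) = 2 ^ u + 2 ^ u := by rw [pow_succ]; ring
  have hS' : S + 2 ^ u = 2 ^ (u + 1) * a + (2 ^ u + b) := by omega
  rw [hS', Nat.testBit_two_pow_mul_add _ (by omega)]
  conv_rhs => rw [hS, Nat.testBit_two_pow_mul_add _ (by omega : b < 2 ^ (u + 1))]
  split_ifs with hw
  · rcases Nat.lt_or_ge w u with h2 | h2
    · rw [Nat.testBit_two_pow_add_gt h2]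
      simp [h2.ne]
    · have : w = u := by omega
      subst this
      rw [Nat.testBit_two_pow_add_eq, Nat.testBit_lt_two_pow hb]
      simp
  · have : w ≠ u := by omega
    simp [this]

/-- The vertices that are not removed. -/
def availSet (n S : ℕ) : Finset (Fin n) := Finset.univ.filter fun w => S.testBit w = false

/-! ### Correctness and number of steps of the depth first search -/

section Machine

variable {n : ℕ} {H : SimpleGraph (Fin n)} {a : ℕ → ℕ} {N D : ℕ}

lemma availSet_add {S : ℕ} {u : Fin n} (h : u ∈ availSet n S) [inst : DecidableEq (Fin n)] :
    availSet n (S + 2 ^ (u : ℕ)) = (availSet n S).erase u := by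
  have h' : S.testBit u = false := by simpa [availSet] using h
  ext w
  simp only [availSet, Finset.mem_filter, Finset.mem_univ, true_and, testBit_add_two_pow h',
    Finset.mem_erase, Bool.or_eq_false_iff, decide_eq_false_iff_not, Fin.val_inj, ne_eq]

lemma one_sub_bit_ne_zero_iff {S u : ℕ} :
    1 - (S / 2 ^ u - 2 * (S / 2 ^ u / 2)) ≠ 0 ↔ S.testBit u = false := by
  rw [Nat.testBit_eq_decide_div_mod_eq, decide_eq_false_iff_not]
  omega

lemma allowed_ne_zero_iff {f : Frame} {p : Fin n → Prop} {u : Fin n} (hptr : f.ptr = u)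
    (hbit : f.bit = 2 ^ f.ptr)
    (hp : ∀ w : Fin n, p w ↔ f.root + a (f.vtx * n + w) ≠ 0) :
    f.allowed n a ≠ 0 ↔ f.fuel ≠ 0 ∧ u ∈ availSet n f.mask ∧ p u := by
  rw [Frame.allowed, hbit, hptr, mul_ne_zero_iff, mul_ne_zero_iff, ← hp,
    one_sub_bit_ne_zero_iff]
  simp only [availSet, Finset.mem_filter, Finset.mem_univ, true_and]
  tauto

lemma drop_finRange {i : ℕ} (hi : i < n) :
    (List.finRange n).drop i = ⟨i, hi⟩ :: (List.finRange n).drop (i + 1) := by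
  rw [List.drop_eq_getElem_cons (by simpa using hi)]
  simp

lemma dfsStep_child {f : Frame} {l : List Frame} (h : f.ptr < n) (h' : f.allowed n a ≠ 0) :
    dfsStep n a N D (f :: l) = f.child :: f.take :: l := by
  cases l <;> simp [dfsStep, h, h']

lemma dfsStep_skip {f : Frame} {l : List Frame} (h : f.ptr < n) (h' : f.allowed n a = 0) :
    dfsStep n a N D (f :: l) = f.skip :: l := by
  cases l <;> simp [dfsStep, h, h']

lemma dfsStep_absorb {f g : Frame} {l : List Frame} (hf : n ≤ f.ptr) :
    dfsStep n a N D (f :: g :: l) = g.absorb N D f :: l := by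
  simp [dfsStep, hf]

lemma dfsStep_done {f : Frame} (hf : n ≤ f.ptr) : dfsStep n a N D [f] = [f] := by
  simp [dfsStep, hf]

/-- Without fuel, a frame skips all vertices. -/
lemma dfs_of_fuel_eq_zero {f : Frame} {l : List Frame} (hfuel : f.fuel = 0) {j : ℕ}
    (hj : f.ptr + j = n) :
    ∃ f' : Frame, (dfsStep n a N D)^[j] (f :: l) = f' :: l ∧ f'.ptr = n ∧ f'.occ = f.occ ∧
      f'.vac = f.vac ∧ f'.root = f.root := by
  induction j generalizing f with
  | zero => exact ⟨f, rfl, hj, rfl, rfl, rfl⟩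
  | succ j ih =>
    obtain ⟨f', h1, h2, h3, h4, h5⟩ := ih (f := f.skip) hfuel (by simp only [Frame.skip]; omega)
    refine ⟨f', ?_, h2, h3, h4, h5⟩
    rw [Function.iterate_succ_apply, ← h1]
    congr 1
    exact dfsStep_skip (by omega) (by simp [Frame.allowed, hfuel])

variable (n H a N D) in
/-- The machine evaluates the subtree of a child correctly, and then removes its frame. -/
def Evaluates (k : ℕ) : Prop :=
  ∀ (w : Fin n) (S fuel : ℕ), Nat.size fuel = k → ∀ (g : Frame) (l : List Frame),
    ∃ f : Frame, 0 < f.occ ∧ 0 < f.vac ∧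
      (N / D : ℝ) * (f.occ / f.vac) = treeRatio (N / D) H (List.finRange n) (fun _ _ => N / D) k
        (availSet n S) w ∧
      (dfsStep n a N D)^[(n + 1) * nodeCount H (List.finRange n) k (availSet n S) w]
        (⟨0, w, 0, 1, S, fuel, 1, 1⟩ :: g :: l) = g.absorb N D f :: l

/-- Induction on the number of vertices still to be scanned. An ordinary vertex (`p` is adjacency)
and the virtual root (`p` is true) are treated at once. A child with weights occ and vac has ratio R
= N occ / (D vac), so that (1 + R)⁻¹ = D vac / (N occ + D vac), the factor in `Frame.absorb`. -/
lemma dfs_scan (hD : 0 < D) {k : ℕ} (hk : Evaluates n H a N D k) {p : Fin n → Prop} {l : List Frame}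
    {f : Frame} (hfuel : Nat.size f.fuel = k + 1) (hbit : f.bit = 2 ^ f.ptr)
    (hp : ∀ w : Fin n, p w ↔ f.root + a (f.vtx * n + w) ≠ 0) (hocc : 0 < f.occ) (hvac : 0 < f.vac)
    {j : ℕ} (hj : f.ptr + j = n) :
    ∃ f' : Frame, (dfsStep n a N D)^[j + (n + 1) * childSum (nodeCount H (List.finRange n) k) p
        ((List.finRange n).drop f.ptr) (availSet n f.mask)] (f :: l) = f' :: l ∧ f'.ptr = n ∧
      0 < f'.occ ∧ 0 < f'.vac ∧ f'.root = f.root ∧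
      (f'.occ / f'.vac : ℝ) = f.occ / f.vac *
        chain (treeRatio (N / D) H (List.finRange n) (fun _ _ => N / D) k) p
          ((List.finRange n).drop f.ptr) (availSet n f.mask) := by
  classical
  induction j generalizing f with
  | zero =>
    have : (List.finRange n).drop f.ptr = [] := by
      rw [List.drop_eq_nil_iff]; simp; omega
    rw [this]
    exact ⟨f, rfl, hj, hocc, hvac, rfl, by simp [chain]⟩
  | succ j ih =>
    have hlt : f.ptr < n := by omega
    rw [drop_finRange hlt]
    have hfuel0 : f.fuel ≠ 0 := by
      intro h; rw [h] at hfuel; simp at hfuel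
    have hal := allowed_ne_zero_iff (u := ⟨f.ptr, hlt⟩) rfl hbit hp
    by_cases hu : (⟨f.ptr, hlt⟩ : Fin n) ∈ availSet n f.mask ∧ p ⟨f.ptr, hlt⟩
    · rw [childSum, if_pos hu, chain, if_pos hu]
      have hmask := availSet_add (inst := fun a b => Classical.propDecidable (a = b)) hu.1
      simp only [← hbit] at hmask
      obtain ⟨c, hc1, hc2, hc3, hc4⟩ := hk ⟨f.ptr, hlt⟩ (f.mask + f.bit) (f.fuel / 2)
        (size_div_two hfuel) f.take l
      obtain ⟨f', h1, h2, h3, h4, h5, h6⟩ := ih (f := f.take.absorb N D c) hfuel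
        (by simp only [Frame.take, Frame.absorb, hbit, pow_succ]; ring) hp
        (by simp only [Frame.take, Frame.absorb]; positivity)
        (by simp only [Frame.take, Frame.absorb]; positivity)
        (by simp only [Frame.take, Frame.absorb]; omega)
      refine ⟨f', ?_, h2, h3, h4, h5, ?_⟩
      · rw [← h1]
        simp only [Frame.take, Frame.absorb] at hc4 ⊢
        rw [hmask] at hc4
        rw [hmask, ← hc4, ← Function.iterate_add_apply,
          show ∀ x y : ℕ, j + 1 + (n + 1) * (x + y) = (j + (n + 1) * y + (n + 1) * x) + 1 by
            intro x y; ring, Function.iterate_succ_apply, dfsStep_child hlt (hal.2 ⟨hfuel0, hu⟩)]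
        rfl
      · rw [h6]
        simp only [Frame.take, Frame.absorb, hmask]
        rw [hmask] at hc3
        rw [← hc3, ← mul_assoc (f.occ / f.vac : ℝ)]
        congr 1
        have h7 : (0 : ℝ) < D := by exact_mod_cast hD
        have h8 : (0 : ℝ) < c.occ := by exact_mod_cast hc1
        have h9 : (0 : ℝ) < c.vac := by exact_mod_cast hc2
        have h10 : (0 : ℝ) < f.vac := by exact_mod_cast hvac
        have h11 : (0 : ℝ) < D * c.vac + N * c.occ := by positivity
        push_cast
        field_simp
        rw [add_comm]
    · rw [childSum, if_neg hu, chain, if_neg hu]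
      obtain ⟨f', h1, h2, h3, h4, h5, h6⟩ := ih (f := f.skip) hfuel
        (by simp only [Frame.skip, hbit, pow_succ]; ring) hp hocc hvac
        (by simp only [Frame.skip]; omega)
      refine ⟨f', ?_, h2, h3, h4, h5, h6⟩
      rw [← h1, add_right_comm, Function.iterate_succ_apply]
      simp only [Frame.skip]
      rw [dfsStep_skip hlt (by_contra fun h => hu (hal.1 h).2)]
      rfl

/-- Each node costs n moves of its pointer, a push being one of its parent's moves, and one final
pop. A leaf keeps the weights 1 and 1, which encode the ratio N / D. -/
theorem evaluates (hD : 0 < D) (ha : ∀ i j : Fin n, a (i * n + j) ≠ 0 ↔ H.Adj i j) (k : ℕ) :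
    Evaluates n H a N D k := by
  induction k with
  | zero =>
    intro w S fuel hfuel g l
    have hfuel : fuel = 0 := Nat.size_eq_zero.1 hfuel
    obtain ⟨f', h1, h2, h3, h4, -⟩ := dfs_of_fuel_eq_zero (n := n) (a := a) (N := N) (D := D)
      (f := ⟨0, w, 0, 1, S, fuel, 1, 1⟩) (l := g :: l) hfuel (j := n) (by simp)
    refine ⟨f', by simp [h3], by simp [h4], by simp [h3, h4, treeRatio], ?_⟩
    rw [nodeCount, mul_one, Function.iterate_succ_apply', h1, dfsStep_absorb h2.ge]
  | succ k ih =>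
    intro w S fuel hfuel g l
    obtain ⟨f', h1, h2, h3, h4, -, h5⟩ := dfs_scan hD ih (p := H.Adj w) (l := g :: l)
      (f := ⟨0, w, 0, 1, S, fuel, 1, 1⟩) hfuel rfl (fun v => by simp [← ha]) one_pos one_pos
      (j := n) (by simp)
    refine ⟨f', h3, h4, ?_, ?_⟩
    · rw [h5, treeRatio_succ]; simp
    · rw [← dfsStep_absorb (n := n) (a := a) h2.ge, ← h1,
        ← Function.iterate_succ_apply' (dfsStep n a N D)]
      congr 2
      simp only [nodeCount, List.drop_zero, Nat.succ_eq_add_one]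
      ring

/-- The frame of the virtual root. -/
def rootFrame (q : ℕ) : Frame := ⟨1, 0, 0, 1, 0, q, 1, 1⟩

theorem dfs_root (hD : 0 < D) (ha : ∀ i j : Fin n, a (i * n + j) ≠ 0 ↔ H.Adj i j) {k q : ℕ}
    (hq : Nat.size q = k + 1) :
    ∃ f' : Frame, (dfsStep n a N D)^[n + (n + 1) * childSum (nodeCount H (List.finRange n) k)
        (fun _ => True) (List.finRange n) Finset.univ] [rootFrame q] = [f'] ∧ f'.ptr = n ∧
      0 < f'.occ ∧ 0 < f'.vac ∧ f'.root = 1 ∧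
      (f'.occ / f'.vac : ℝ) =
        chain (treeRatio (N / D) H (List.finRange n) (fun _ _ => N / D) k) (fun _ => True)
          (List.finRange n) Finset.univ := by
  have h0 : availSet n 0 = Finset.univ := by simp [availSet]
  obtain ⟨f', h1, h2, h3, h4, h5, h6⟩ := dfs_scan hD (evaluates hD ha k) (p := fun _ => True)
    (l := []) (f := rootFrame q) hq rfl (fun v => by simp [rootFrame]) one_pos one_pos
    (j := n) (by simp [rootFrame])
  simp only [rootFrame, h0, List.drop_zero] at h1 h6
  exact ⟨f', h1, h2, h3, h4, h5, by simpa using h6⟩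

/-! ### Bounds for the numbers that occur in the computation -/

/-- Exactly the bottom frame of the stack belongs to the virtual root. -/
def RootAtBottom : List Frame → Prop
  | [] => False
  | [f] => f.root = 1
  | f :: g :: l => f.root = 0 ∧ RootAtBottom (g :: l)

lemma RootAtBottom.cons_congr {f f' : Frame} {l : List Frame} (h : RootAtBottom (f :: l))
    (hf : f'.root = f.root) : RootAtBottom (f' :: l) := by
  cases l with
  | nil => simp only [RootAtBottom] at h ⊢; rw [hf, h]
  | cons g l => simp only [RootAtBottom] at h ⊢; rw [hf]; exact h

/-- Bounds for the fields of a frame after `t` steps. -/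
structure Frame.Bounded (n q t : ℕ) (f : Frame) : Prop where
  root : f.root ≤ 1
  vtx : f.vtx ≤ n - 1
  ptr : f.ptr ≤ n
  bit : f.bit = 2 ^ f.ptr
  mask : f.mask ≤ t * 2 ^ n
  fuel : f.fuel ≤ q
  occ : 0 < f.occ
  vac : 0 < f.vac

/-- The invariant of the machine. -/
structure StackInv (n N D q t : ℕ) (l : List Frame) : Prop where
  root : RootAtBottom l
  length : l.length ≤ t + 1
  bounded : ∀ f ∈ l, f.Bounded n q t
  weight : (l.map fun f => max f.occ f.vac).prod ≤ (N + D) ^ t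

lemma Frame.Bounded.succ {q t : ℕ} {f : Frame} (h : f.Bounded n q t) : f.Bounded n q (t + 1) :=
  { h with mask := h.mask.trans (Nat.mul_le_mul_right _ (Nat.le_succ t)) }

lemma Frame.Bounded.bit_le {q t : ℕ} {f : Frame} (h : f.Bounded n q t) : f.bit ≤ 2 ^ n :=
  h.bit ▸ Nat.pow_le_pow_right two_pos h.ptr

lemma stackInv_root (n N D q : ℕ) : StackInv n N D q 0 [rootFrame q] where
  root := rfl
  length := by simp
  bounded f hf := by
    obtain rfl := List.mem_singleton.1 hf
    exact ⟨le_rfl, Nat.zero_le _, Nat.zero_le _, rfl, Nat.zero_le _, le_rfl, one_pos, one_pos⟩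
  weight := by simp [rootFrame]

/-- Weights are controlled through their product over the whole stack: a push contributes a factor
1, and a pop replaces two factors by at most N + D times their product. Hence lengths grow linearly
in t. The crude estimate t 2^n for the mask suffices, as only its length matters. -/
lemma StackInv.step {q t : ℕ} {l : List Frame} (hD : 0 < D) (h : StackInv n N D q t l) :
    StackInv n N D q (t + 1) (dfsStep n a N D l) := by
  have hND : (N + D) ^ t ≤ (N + D) ^ (t + 1) := Nat.pow_le_pow_right (by omega) (Nat.le_succ t)
  cases l with
  | nil => exact absurd h.root (by simp [RootAtBottom])
  | cons f l =>
    have hf := h.bounded f (by simp)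
    have hl : ∀ g ∈ l, g.Bounded n q (t + 1) := fun g hg =>
      (h.bounded g (List.mem_cons_of_mem _ hg)).succ
    have hlen := h.length
    have hw := h.weight
    simp only [List.length_cons, List.map_cons, List.prod_cons] at hlen hw
    have hmask : f.mask + f.bit ≤ (t + 1) * 2 ^ n := by
      have := hf.mask; have := hf.bit_le; rw [add_mul, one_mul]; omega
    by_cases h1 : f.ptr < n
    · by_cases h2 : f.allowed n a = 0
      · rw [dfsStep_skip h1 h2]
        have hbit : f.bit + f.bit = 2 ^ (f.ptr + 1) := by rw [hf.bit, pow_succ]; ring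
        refine ⟨h.root.cons_congr rfl, by simp only [List.length_cons]; omega, ?_, ?_⟩
        · intro g hg
          rcases List.mem_cons.1 hg with rfl | hg
          · exact ⟨hf.root, hf.vtx, h1, hbit, hf.succ.mask, hf.fuel, hf.occ, hf.vac⟩
          · exact hl g hg
        · simpa [Frame.skip] using hw.trans hND
      · rw [dfsStep_child h1 h2]
        have hbit : f.bit + f.bit = 2 ^ (f.ptr + 1) := by rw [hf.bit, pow_succ]; ring
        refine ⟨⟨rfl, h.root.cons_congr rfl⟩, by simp only [List.length_cons]; omega, ?_, ?_⟩
        · intro g hg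
          rcases List.mem_cons.1 hg with rfl | hg
          · exact ⟨Nat.zero_le _, by simp only [Frame.child]; omega, Nat.zero_le _, rfl, hmask,
              (Nat.div_le_self _ _).trans hf.fuel, one_pos, one_pos⟩
          · rcases List.mem_cons.1 hg with rfl | hg
            · exact ⟨hf.root, hf.vtx, h1, hbit, hmask, hf.fuel, hf.occ, hf.vac⟩
            · exact hl g hg
        · simpa [Frame.child, Frame.take] using hw.trans hND
    · cases l with
      | nil =>
        rw [dfsStep_done (not_lt.1 h1)]
        refine ⟨h.root, by simp, ?_, ?_⟩
        · intro g hg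
          obtain rfl := List.mem_singleton.1 hg
          exact hf.succ
        · simpa using hw.trans hND
      | cons g l =>
        rw [dfsStep_absorb (not_lt.1 h1)]
        have hg := hl g (by simp)
        have hocc := hf.occ
        have hvac := hf.vac
        have hgocc := hg.occ
        have hgvac := hg.vac
        refine ⟨RootAtBottom.cons_congr h.root.2 rfl, by
          simp only [List.length_cons] at hlen ⊢; omega, ?_, ?_⟩
        · intro x hx
          rcases List.mem_cons.1 hx with rfl | hx
          · exact ⟨hg.root, hg.vtx, hg.ptr, hg.bit, hg.mask, hg.fuel,
              by simp only [Frame.absorb]; positivity, by simp only [Frame.absorb]; positivity⟩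
          · exact hl x (List.mem_cons_of_mem _ hx)
        · simp only [List.map_cons, List.prod_cons, Frame.absorb] at hw ⊢
          have h3 : max (g.occ * (D * f.vac)) (g.vac * (N * f.occ + D * f.vac)) ≤
              (N + D) * (max f.occ f.vac * max g.occ g.vac) := by
            have e1 := le_max_left f.occ f.vac
            have e2 := le_max_right f.occ f.vac
            have e3 := le_max_left g.occ g.vac
            have e4 := le_max_right g.occ g.vac
            have e5 : N * f.occ + D * f.vac ≤ (N + D) * max f.occ f.vac := by
              rw [add_mul]; gcongr
            have e6 : D * f.vac ≤ (N + D) * max f.occ f.vac := by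
              rw [add_mul]
              exact (Nat.mul_le_mul_left D e2).trans (Nat.le_add_left _ _)
            apply max_le
            · calc _ ≤ max g.occ g.vac * ((N + D) * max f.occ f.vac) := Nat.mul_le_mul e3 e6
                _ = _ := by ring
            · calc _ ≤ max g.occ g.vac * ((N + D) * max f.occ f.vac) := Nat.mul_le_mul e4 e5
                _ = _ := by ring
          calc _ ≤ (N + D) * (max f.occ f.vac * max g.occ g.vac) *
                (l.map fun f => max f.occ f.vac).prod := Nat.mul_le_mul_right _ h3
            _ = (max f.occ f.vac * (max g.occ g.vac *
                (l.map fun f => max f.occ f.vac).prod)) * (N + D) := by ring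
            _ ≤ _ := by rw [pow_succ]; exact Nat.mul_le_mul_right _ hw

lemma StackInv.weight_le {q t : ℕ} {l : List Frame} (h : StackInv n N D q t l) {f : Frame}
    (hf : f ∈ l) : f.occ ≤ (N + D) ^ t ∧ f.vac ≤ (N + D) ^ t := by
  have h1 : max f.occ f.vac ≤ (l.map fun f => max f.occ f.vac).prod := by
    apply Nat.le_of_dvd ?_ (List.dvd_prod (List.mem_map_of_mem hf))
    apply List.prod_pos
    intro x hx
    obtain ⟨g, hg, rfl⟩ := List.mem_map.1 hx
    exact lt_max_of_lt_left (h.bounded g hg).occ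
  exact ⟨(le_max_left _ _).trans (h1.trans h.weight), (le_max_right _ _).trans (h1.trans h.weight)⟩

end Machine

/-! ### The program of the stack machine

Cell `0` holds `n`, cell `1` the address of the top frame, the cells from `2` on the adjacency
matrix, the cells `n * n + 2` and `n * n + 3` numerator and denominator of the activity. The stack
starts at the cell `n * n + 4`, and a frame takes eight cells. -/

/-- A list of assignments. -/
def Program.block : List (Expr × Expr) → Program
  | [] => .skip
  | p :: l => .seq (.assign p.1 p.2) (block l)

lemma Program.block_simple {l : List (Expr × Expr)}
    (h : ∀ p ∈ l, p.1.QueryFree ∧ p.2.QueryFree) : (Program.block l).Simple := by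
  induction l with
  | nil => trivial
  | cons p l ih =>
    exact ⟨h p (by simp), ih fun q hq => h q (List.mem_cons_of_mem _ hq)⟩

/-- Several values are written into the memory. -/
def writes : List (ℕ × ℕ) → Store → Store
  | [], s => s
  | p :: l, s => writes l (Function.update s p.1 p.2)

lemma Program.exec_block_cons {O : ℕ → ℕ} {s : Store} {p : Expr × Expr} {l : List (Expr × Expr)}
    {x y : ℕ} {ws : List (ℕ × ℕ)} (hx : p.1.eval O s = x) (hy : p.2.eval O s = y)
    (h : (Program.block l).exec O (Function.update s x y) = writes ws (Function.update s x y)) :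
    (Program.block (p :: l)).exec O s = writes ((x, y) :: ws) s := by
  rw [writes, ← h, ← hx, ← hy]; rfl

lemma writes_le {l : List (ℕ × ℕ)} {s : Store} {B : ℕ} (hl : ∀ p ∈ l, p.2 ≤ B)
    (hs : ∀ i, s i ≤ B) (i : ℕ) : writes l s i ≤ B := by
  induction l generalizing s with
  | nil => exact hs i
  | cons p l ih =>
    refine ih (fun q hq => hl q (List.mem_cons_of_mem _ hq)) fun i => ?_
    rw [Function.update_apply]
    split_ifs
    · exact hl p (by simp)
    · exact hs i

lemma writes_of_notMem {l : List (ℕ × ℕ)} {s : Store} {i : ℕ} (h : ∀ p ∈ l, i ≠ p.1) :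
    writes l s i = s i := by
  induction l generalizing s with
  | nil => rfl
  | cons p l ih =>
    rw [writes, ih fun q hq => h q (List.mem_cons_of_mem _ hq),
      Function.update_of_ne (h p (by simp))]

/-- The number of vertices. -/
def vertexNumber : Expr := .load (.const 0)

/-- The address of cell `j` relative to the top frame. -/
def slot (j : ℕ) : Expr := .add (.load (.const 1)) (.const j)

/-- The field `j` of the top frame. -/
def field (j : ℕ) : Expr := .load (slot j)

/-- The address `j` cells below the top frame. -/
def below (j : ℕ) : Expr := .sub (.load (.const 1)) (.const j)

/-- The address `n * n + j`. -/
def glob (j : ℕ) : Expr := .add (.mul vertexNumber vertexNumber) (.const j)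

/-- The order matters: the child and the new masks are computed from `ptr` and `bit` before these
advance, and the stack pointer moves last. -/
def pushProgram : Program := .block
  [(slot 8, .const 0), (slot 9, field 2), (slot 10, .const 0), (slot 11, .const 1),
    (slot 12, .add (field 4) (field 3)), (slot 13, .div (field 5) (.const 2)),
    (slot 14, .const 1), (slot 15, .const 1), (slot 4, .add (field 4) (field 3)),
    (slot 2, .add (field 2) (.const 1)), (slot 3, .add (field 3) (field 3)), (.const 1, slot 8)]

def skipProgram : Program := .block
  [(slot 2, .add (field 2) (.const 1)), (slot 3, .add (field 3) (field 3))]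

/-- The cells 2 and 1 below the top frame are `occ` and `vac` of the frame underneath. Popped cells
keep stale values, and a later push overwrites all eight. -/
def popProgram : Program := .block
  [(below 2, .mul (.load (below 2)) (.mul (.load (glob 3)) (field 7))),
    (below 1, .mul (.load (below 1))
      (.add (.mul (.load (glob 2)) (field 6)) (.mul (.load (glob 3)) (field 7)))),
    (.const 1, below 8)]

/-- The expression for `Frame.allowed`. -/
def allowedExpr : Expr :=
  .mul (.mul (.add (field 0)
      (.load (.add (.const 2) (.add (.mul (field 1) vertexNumber) (field 2))))) (field 5))
    (.sub (.const 1) (.sub (.div (field 4) (field 3))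
      (.mul (.const 2) (.div (.div (field 4) (field 3)) (.const 2)))))

def dfsBody : Program :=
  .ite (.sub vertexNumber (field 2)) (.ite allowedExpr pushProgram skipProgram) popProgram

/-- It vanishes exactly when the scan of the top frame is over and this frame is the virtual root.
-/
def dfsTest : Expr := .add (.sub vertexNumber (field 2)) (.sub (.const 1) (field 0))

lemma dfsBody_simple : dfsBody.Simple := by
  refine ⟨?_, ⟨?_, Program.block_simple ?_, Program.block_simple ?_⟩, Program.block_simple ?_⟩ <;>
    simp [Expr.QueryFree, vertexNumber, field, slot, allowedExpr, below, glob]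

lemma dfsTest_queryFree : dfsTest.QueryFree := by
  simp [Expr.QueryFree, vertexNumber, field, slot, dfsTest]

/-! ### Effect of the three updates on the memory -/

section Exec

variable {O : ℕ → ℕ} {s : Store} {σ : ℕ}

lemma exec_push (h1 : s 1 = σ) (hσ : 4 ≤ σ) : pushProgram.exec O s =
    writes [(σ + 8, 0), (σ + 9, s (σ + 2)), (σ + 10, 0), (σ + 11, 1),
      (σ + 12, s (σ + 4) + s (σ + 3)), (σ + 13, s (σ + 5) / 2), (σ + 14, 1), (σ + 15, 1),
      (σ + 4, s (σ + 4) + s (σ + 3)), (σ + 2, s (σ + 2) + 1), (σ + 3, s (σ + 3) + s (σ + 3)),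
      (1, σ + 8)] s := by
  unfold pushProgram
  iterate 12
    refine Program.exec_block_cons ?_ ?_ ?_
    rotate_left 2
  · rfl
  all_goals
    simp (disch := omega) only [Expr.eval, slot, field, Function.update_of_ne, h1]

lemma exec_skip (h1 : s 1 = σ) (hσ : 4 ≤ σ) : skipProgram.exec O s =
    writes [(σ + 2, s (σ + 2) + 1), (σ + 3, s (σ + 3) + s (σ + 3))] s := by
  simp (disch := omega) only [skipProgram, Program.block, Program.exec, Expr.eval, slot, field,
    Function.update_of_ne, h1, writes]

lemma exec_pop {n : ℕ} (h0 : s 0 = n) (h1 : s 1 = σ) (hσ : n * n + 12 ≤ σ) :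
    popProgram.exec O s =
      writes [(σ - 2, s (σ - 2) * (s (n * n + 3) * s (σ + 7))),
        (σ - 1, s (σ - 1) * (s (n * n + 2) * s (σ + 6) + s (n * n + 3) * s (σ + 7))),
        (1, σ - 8)] s := by
  simp (disch := omega) only [popProgram, Program.block, Program.exec, Expr.eval, below, glob,
    vertexNumber, slot, field, Function.update_of_ne, h1, h0, writes]

end Exec

/-- The cells from `addr` on hold the frame `f`. -/
def frameAt (s : Store) (addr : ℕ) (f : Frame) : Prop :=
  s addr = f.root ∧ s (addr + 1) = f.vtx ∧ s (addr + 2) = f.ptr ∧ s (addr + 3) = f.bit ∧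
    s (addr + 4) = f.mask ∧ s (addr + 5) = f.fuel ∧ s (addr + 6) = f.occ ∧ s (addr + 7) = f.vac

/-- The cells from `base` on hold the stack `l` (whose top is its head). -/
def stackAt (s : Store) (base : ℕ) : List Frame → Prop
  | [] => True
  | f :: l => frameAt s (base + 8 * l.length) f ∧ stackAt s base l

lemma stackAt.congr {s s' : Store} {base : ℕ} {l : List Frame} (h : stackAt s base l)
    (hs : ∀ i, base ≤ i → i < base + 8 * l.length → s' i = s i) : stackAt s' base l := by
  induction l with
  | nil => trivial
  | cons f l ih =>
    simp only [List.length_cons] at hs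
    refine ⟨?_, ih h.2 fun i h1 h2 => hs i h1 (by omega)⟩
    have h1 := h.1
    unfold frameAt at h1 ⊢
    rwa [hs _ (by omega) (by omega), hs _ (by omega) (by omega), hs _ (by omega) (by omega),
      hs _ (by omega) (by omega), hs _ (by omega) (by omega), hs _ (by omega) (by omega),
      hs _ (by omega) (by omega), hs _ (by omega) (by omega)]

/-- The memory represents the stack `l` of the machine. -/
structure Represents (n : ℕ) (a : ℕ → ℕ) (N D : ℕ) (s : Store) (l : List Frame) : Prop where
  size : s 0 = n
  top : s 1 + 8 = n * n + 4 + 8 * l.length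
  adj : ∀ k < n * n, s (2 + k) = a k
  num : s (n * n + 2) = N
  den : s (n * n + 3) = D
  stack : stackAt s (n * n + 4) l

/-- All fields of the frame are at most `B`. -/
def Frame.FieldsLe (B : ℕ) (f : Frame) : Prop :=
  f.root ≤ B ∧ f.vtx ≤ B ∧ f.ptr ≤ B ∧ f.bit ≤ B ∧ f.mask ≤ B ∧ f.fuel ≤ B ∧ f.occ ≤ B ∧ f.vac ≤ B

/-! ### One pass through the loop body simulates one step of the search -/

section Simulation

variable {n N D : ℕ} {a : ℕ → ℕ} {s : Store} {O : ℕ → ℕ}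

lemma Represents.top_eq {f : Frame} {l : List Frame} (h : Represents n a N D s (f :: l)) :
    s 1 = n * n + 4 + 8 * l.length := by
  have := h.top
  simp only [List.length_cons] at this
  omega

lemma Represents.eval_allowed {f : Frame} {l : List Frame} (h : Represents n a N D s (f :: l))
    (hptr : f.ptr < n) (hvtx : f.vtx < n) : allowedExpr.eval O s = f.allowed n a := by
  obtain ⟨f0, f1, f2, f3, f4, f5, f6, f7⟩ := h.stack.1
  have hadj := h.adj (f.vtx * n + f.ptr) (by nlinarith)
  simp only [allowedExpr, Expr.eval, field, slot, vertexNumber, h.top_eq, h.size, add_zero, f0, f1,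
    f2, f3, f4, f5, hadj, Frame.allowed]

lemma Represents.eval_test {f : Frame} {l : List Frame} (h : Represents n a N D s (f :: l)) :
    dfsTest.eval O s = (n - f.ptr) + (1 - f.root) := by
  obtain ⟨f0, f1, f2, -⟩ := h.stack.1
  simp only [dfsTest, Expr.eval, field, slot, vertexNumber, h.top_eq, h.size, add_zero, f0, f2]

lemma Represents.of_writes {l l' : List Frame} {ws : List (ℕ × ℕ)}
    (h : Represents n a N D s l) (hws : ∀ p ∈ ws, p.1 = 1 ∨ n * n + 4 ≤ p.1)
    (htop : writes ws s 1 + 8 = n * n + 4 + 8 * l'.length)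
    (hstack : stackAt (writes ws s) (n * n + 4) l') : Represents n a N D (writes ws s) l' where
  size := by
    rw [writes_of_notMem, h.size]
    intro p hp; have := hws p hp; omega
  top := htop
  adj k hk := by
    rw [writes_of_notMem, h.adj k hk]
    intro p hp; have := hws p hp; omega
  num := by
    rw [writes_of_notMem, h.num]
    intro p hp; have := hws p hp; omega
  den := by
    rw [writes_of_notMem, h.den]
    intro p hp; have := hws p hp; omega
  stack := hstack

/-- The bound B passes to the new memory because every value written is a field of the new stack or
the new stack pointer. -/
theorem Represents.step {f : Frame} {l : List Frame} {B : ℕ} (h : Represents n a N D s (f :: l))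
    (hvtx : f.vtx ≤ n - 1) (hdone : f.ptr < n ∨ l ≠ []) (hs : ∀ i, s i ≤ B)
    (hB : ∀ g ∈ dfsStep n a N D (f :: l), g.FieldsLe B)
    (htop : n * n + 4 + 8 * (l.length + 1) ≤ B) :
    Represents n a N D (dfsBody.exec O s) (dfsStep n a N D (f :: l)) ∧
      ∀ i, dfsBody.exec O s i ≤ B := by
  have h1 := h.top_eq
  set σ := n * n + 4 + 8 * l.length with hσ
  obtain ⟨f0, f1, f2, f3, f4, f5, f6, f7⟩ := h.stack.1
  rw [← hσ] at f0 f1 f2 f3 f4 f5 f6 f7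
  have hsub : (Expr.sub vertexNumber (field 2)).eval O s = n - f.ptr := by
    simp only [Expr.eval, vertexNumber, field, slot, h1, h.size, f2]
  by_cases hptr : f.ptr < n
  · have hal := h.eval_allowed (O := O) hptr (by omega)
    by_cases hall : f.allowed n a = 0
    · have hexec : dfsBody.exec O s = skipProgram.exec O s := by
        rw [dfsBody, Program.exec, if_pos (by rw [hsub]; omega), Program.exec,
          if_neg (by rw [hal]; omega)]
      rw [hexec, exec_skip h1 (by omega), f2, f3]
      rw [dfsStep_skip hptr hall] at hB ⊢
      have hf := hB f.skip (by simp)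
      simp only [Frame.FieldsLe, Frame.skip] at hf
      refine ⟨h.of_writes ?_ ?_ ⟨?_, ?_⟩, writes_le ?_ hs⟩
      · simp; omega
      · rw [writes_of_notMem (by simp)]; simp only [List.length_cons]; omega
      · rw [← hσ]
        simp (disch := omega) only [frameAt, Frame.skip, writes, Function.update_of_ne,
          Function.update_self, f0, f1, f4, f5, f6, f7, and_self]
      · refine h.stack.2.congr fun i h2 h3 => writes_of_notMem ?_
        simp; omega
      · simp; omega
    · have hexec : dfsBody.exec O s = pushProgram.exec O s := by
        rw [dfsBody, Program.exec, if_pos (by rw [hsub]; omega), Program.exec,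
          if_pos (by rw [hal]; omega)]
      rw [hexec, exec_push h1 (by omega), f2, f3, f4, f5]
      rw [dfsStep_child hptr hall] at hB ⊢
      have hf := hB f.take (by simp)
      have hc := hB f.child (by simp)
      simp only [Frame.FieldsLe, Frame.take] at hf
      simp only [Frame.FieldsLe, Frame.child] at hc
      refine ⟨h.of_writes ?_ ?_ ⟨?_, ?_, ?_⟩, writes_le ?_ hs⟩
      · simp; omega
      · simp (disch := omega) only [writes, Function.update_self, List.length_cons]; omega
      · rw [List.length_cons, show n * n + 4 + 8 * (l.length + 1) = σ + 8 by omega]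
        simp (disch := omega) only [frameAt, Frame.child, writes, Function.update_of_ne,
          Function.update_self, and_self, add_assoc, Nat.reduceAdd]
      · rw [← hσ]
        simp (disch := omega) only [frameAt, Frame.take, writes, Function.update_of_ne,
          Function.update_self, f0, f1, f5, f6, f7, and_self]
      · refine h.stack.2.congr fun i h2 h3 => writes_of_notMem ?_
        simp; omega
      · simp; omega
  · have hexec : dfsBody.exec O s = popProgram.exec O s := by
      rw [dfsBody, Program.exec, if_neg (by rw [hsub]; omega)]
    cases l with
    | nil => simp [hptr] at hdone
    | cons g l =>
      simp only [List.length_cons] at hσ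
      obtain ⟨g0, g1, g2, g3, g4, g5, g6, g7⟩ := h.stack.2.1
      have e6 : n * n + 4 + 8 * l.length + 6 = σ - 2 := by omega
      have e7 : n * n + 4 + 8 * l.length + 7 = σ - 1 := by omega
      rw [e6] at g6
      rw [e7] at g7
      rw [hexec, exec_pop h.size h1 (by omega), h.num, h.den, f6, f7, g6, g7]
      rw [dfsStep_absorb (not_lt.1 hptr)] at hB ⊢
      have hg := hB (g.absorb N D f) (by simp)
      simp only [Frame.FieldsLe, Frame.absorb] at hg
      refine ⟨h.of_writes ?_ ?_ ⟨?_, ?_⟩, writes_le ?_ hs⟩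
      · simp; omega
      · simp (disch := omega) only [writes, Function.update_self, List.length_cons]; omega
      · simp (disch := omega) only [frameAt, Frame.absorb, e6, e7, writes, Function.update_of_ne,
          Function.update_self, g0, g1, g2, g3, g4, g5, and_self]
      · refine h.stack.2.2.congr fun i h2 h3 => writes_of_notMem ?_
        simp; omega
      · simp; omega

end Simulation

/-! ### The main loop -/

lemma StackInv.fieldsLe {n N D q t T B : ℕ} {l : List Frame} (h : StackInv n N D q t l)
    (hD : 0 < D) (ht : t ≤ T) (h1 : (T + 1) * 2 ^ n ≤ B) (h2 : q ≤ B) (h3 : (N + D) ^ T ≤ B)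
    {f : Frame} (hf : f ∈ l) : f.FieldsLe B := by
  have hb := h.bounded f hf
  have hw := h.weight_le hf
  have hpow : (N + D) ^ t ≤ (N + D) ^ T := Nat.pow_le_pow_right (by omega) ht
  have hmask : t * 2 ^ n ≤ T * 2 ^ n := Nat.mul_le_mul_right _ ht
  have hn : n < 2 ^ n := Nat.lt_two_pow_self
  have e1 := hb.root
  have e2 := hb.vtx
  have e3 := hb.ptr
  have e4 := hb.bit_le
  have e5 := hb.mask
  have e6 := hb.fuel
  rw [add_mul, one_mul] at h1
  exact ⟨by omega, by omega, by omega, by omega, by omega, by omega, by omega, by omega⟩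

theorem exists_runs_dfs : ∃ c, ∀ (O : ℕ → ℕ) (n : ℕ) (a : ℕ → ℕ) (N D q T B : ℕ) (s : Store)
    (f' : Frame), 0 < D → Represents n a N D s [rootFrame q] → (∀ i, s i ≤ B) →
    (T + 1) * 2 ^ n ≤ B → q ≤ B → (N + D) ^ T ≤ B → n * n + 4 + 8 * (T + 2) ≤ B →
    (dfsStep n a N D)^[T] [rootFrame q] = [f'] → n ≤ f'.ptr →
    ∃ s' t, (Program.loop dfsTest dfsBody).Runs O s s' t ∧ Represents n a N D s' [f'] ∧
      (∀ i, s' i ≤ B) ∧ t ≤ c * (T + 1) * (Nat.size B + 1) ^ 2 := by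
  obtain ⟨c', hc⟩ := Program.runs_loop dfsTest_queryFree dfsBody_simple
  refine ⟨c', fun O n a N D q T B s f' hD hs hsB h1 h2 h3 h4 hT hf' => ?_⟩
  classical
  -- The loop stops at the first time T' at which the root frame alone is left and finished, while T
  -- is just some such time. That stack is a fixed point of `dfsStep`, so the final frames coincide.
  have hex : ∃ j, ∃ f, (dfsStep n a N D)^[j] [rootFrame q] = [f] ∧ n ≤ f.ptr := ⟨T, f', hT, hf'⟩
  obtain ⟨f, hf, hfn⟩ := Nat.find_spec hex
  have hle : Nat.find hex ≤ T := Nat.find_min' hex ⟨f', hT, hf'⟩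
  have hmin : ∀ j < Nat.find hex, ¬ ∃ f, (dfsStep n a N D)^[j] [rootFrame q] = [f] ∧ n ≤ f.ptr :=
    fun j hj => Nat.find_min hex hj
  set T' := Nat.find hex
  have hff : f = f' := by
    have : (dfsStep n a N D)^[T - T'] ((dfsStep n a N D)^[T'] [rootFrame q]) = [f'] := by
      rw [← Function.iterate_add_apply, Nat.sub_add_cancel hle, hT]
    rw [hf, Function.iterate_fixed (dfsStep_done hfn)] at this
    simpa using this
  have hinv : ∀ j, StackInv n N D q j ((dfsStep n a N D)^[j] [rootFrame q]) := by
    intro j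
    induction j with
    | zero => exact stackInv_root n N D q
    | succ j ih => rw [Function.iterate_succ_apply']; exact ih.step hD
  let I : ℕ → Store → Prop := fun j s =>
    Represents n a N D s ((dfsStep n a N D)^[j] [rootFrame q]) ∧ ∀ i, s i ≤ B
  have hrun := hc O I T' (Nat.size B) ?_ ?_ ?_ s ⟨hs, hsB⟩
  · obtain ⟨s', t, hr, ⟨hs1, hs2⟩, ht⟩ := hrun
    refine ⟨s', t, hr, ?_, hs2, ht.trans ?_⟩
    · rwa [hf, hff] at hs1
    · gcongr
  · exact fun j _ s hs i => Nat.size_le_size (hs.2 i)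
  · rintro j hj s ⟨hs, hsB⟩
    have hI := hinv j
    have hI' := hinv (j + 1)
    have hm := hmin j hj
    simp only [I, Function.iterate_succ_apply'] at hI' hs ⊢
    generalize (dfsStep n a N D)^[j] [rootFrame q] = l at *
    cases l with
    | nil => exact absurd hI.root (by simp [RootAtBottom])
    | cons g l =>
      have hdone : g.ptr < n ∨ l ≠ [] := by
        by_contra hcon
        push Not at hcon
        exact hm ⟨g, by rw [hcon.2], hcon.1⟩
      have hlen := hI.length
      simp only [List.length_cons] at hlen
      refine ⟨?_, hs.step (hI.bounded g (by simp)).vtx hdone hsB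
        (fun x hx => hI'.fieldsLe hD (by omega) h1 h2 h3 hx) (by omega)⟩
      rw [hs.eval_test]
      rcases hdone with h | h
      · omega
      · cases l with
        | nil => exact absurd rfl h
        | cons x l =>
          have := hI.root.1
          omega
  · rintro s ⟨hs, -⟩
    have hI := hinv T'
    rw [hf] at hs hI
    rw [hs.eval_test]
    have h5 : f.root = 1 := hI.root
    omega

/-! ### The complete program -/

/-- The number `(n + 1) * (m + 1)`, before cell `1` is overwritten. -/
def scaleExpr : Expr :=
  .mul (.add vertexNumber (.const 1)) (.add (.load (.const 1)) (.const 1))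

/-- The `K`-th power of `scaleExpr`. -/
def powExpr : ℕ → Expr
  | 0 => .const 1
  | K + 1 => .mul (powExpr K) scaleExpr

/-- Cell n * n + 4 counts up to the precision stored in cell n * n + 2 while cell n * n + 3 is
doubled; this yields the denominator, a power of two. -/
def doublingTest : Expr := .sub (.load (glob 2)) (.load (glob 4))

def doublingBody : Program := .block
  [(glob 3, .add (.load (glob 3)) (.load (glob 3))), (glob 4, .add (.load (glob 4)) (.const 1))]

def digitsInit (c : ℕ) : Program := .block [(glob 3, .const 1), (glob 2, .mul (.const c) scaleExpr)]

def digitsQuery : Program := .assign (glob 2) (.query (.load (glob 2)))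

/-- The cells of `vtx`, `ptr` and `mask` still hold the 0 of the input, and the cell of `root` has
to be reset because it served as the counter. Cell 1 is overwritten last, since the fuel is computed
from m. -/
def rootInit (K : ℕ) : Program := .block
  [(glob 4, .const 1), (glob 7, .const 1), (glob 9, powExpr K), (glob 10, .const 1),
    (glob 11, .const 1), (.const 1, glob 4)]

/-- occ / vac approximates 1/Z, hence the output is vac / occ. Cell 0 is written first because the
fields are addressed through cell 1. -/
def outputProgram : Program := .block [(.const 0, field 7), (.const 1, field 6)]

/-- Approximation of the partition function by depth first search in the tree of self-avoiding
walks: `c` controls the precision of the activity, and `K` the depth of the search. -/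
def approxProgram (c K : ℕ) : Program :=
  .seq (digitsInit c) (.seq (.loop doublingTest doublingBody) (.seq digitsQuery
    (.seq (rootInit K) (.seq (.loop dfsTest dfsBody) outputProgram))))

lemma scaleExpr_queryFree : scaleExpr.QueryFree := by
  simp [Expr.QueryFree, scaleExpr, vertexNumber]

lemma powExpr_queryFree (K : ℕ) : (powExpr K).QueryFree := by
  induction K with
  | zero => trivial
  | succ K ih => exact ⟨ih, scaleExpr_queryFree⟩

lemma glob_queryFree (j : ℕ) : (glob j).QueryFree := by
  simp [Expr.QueryFree, glob, vertexNumber]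

lemma digitsInit_simple (c : ℕ) : (digitsInit c).Simple := by
  refine Program.block_simple ?_
  simp [Expr.QueryFree, glob_queryFree, scaleExpr_queryFree]

lemma doublingBody_simple : doublingBody.Simple := by
  refine Program.block_simple ?_
  simp [Expr.QueryFree, glob_queryFree]

lemma doublingTest_queryFree : doublingTest.QueryFree := by
  simp [Expr.QueryFree, glob_queryFree, doublingTest]

lemma rootInit_simple (K : ℕ) : (rootInit K).Simple := by
  refine Program.block_simple ?_
  simp [Expr.QueryFree, glob_queryFree, powExpr_queryFree]

lemma outputProgram_simple : outputProgram.Simple := by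
  refine Program.block_simple ?_
  simp [Expr.QueryFree, field, slot]

/-! ### Running the phases of the program one after the other -/

section Complete

variable {O : ℕ → ℕ} {s : Store} {n m : ℕ}

lemma eval_glob (h0 : s 0 = n) (j : ℕ) : (glob j).eval O s = n * n + j := by
  simp [glob, Expr.eval, vertexNumber, h0]

lemma eval_powExpr (h0 : s 0 = n) (h1 : s 1 = m) (K : ℕ) :
    (powExpr K).eval O s = ((n + 1) * (m + 1)) ^ K := by
  induction K with
  | zero => rfl
  | succ K ih =>
    simp only [powExpr, Expr.eval, ih, scaleExpr, vertexNumber, h0, h1, pow_succ]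

lemma exec_digitsInit (h0 : s 0 = n) (h1 : s 1 = m) (c : ℕ) : (digitsInit c).exec O s =
    writes [(n * n + 3, 1), (n * n + 2, c * ((n + 1) * (m + 1)))] s := by
  unfold digitsInit
  refine Program.exec_block_cons (eval_glob h0 3) rfl (Program.exec_block_cons
    (eval_glob ?_ 2) ?_ rfl)
  · rwa [Function.update_of_ne (by omega)]
  · simp (disch := omega) only [Expr.eval, scaleExpr, vertexNumber, Function.update_of_ne, h0, h1]

lemma exec_doublingBody (h0 : s 0 = n) : doublingBody.exec O s =
    writes [(n * n + 3, s (n * n + 3) + s (n * n + 3)), (n * n + 4, s (n * n + 4) + 1)] s := by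
  unfold doublingBody
  refine Program.exec_block_cons (eval_glob h0 3) ?_ (Program.exec_block_cons
    (eval_glob ?_ 4) ?_ rfl)
  · simp only [Expr.eval, eval_glob h0]
  · rwa [Function.update_of_ne (by omega)]
  · have h0' : Function.update s (n * n + 3) (s (n * n + 3) + s (n * n + 3)) 0 = n := by
      rwa [Function.update_of_ne (by omega)]
    simp only [Expr.eval, eval_glob h0']
    rw [Function.update_of_ne (by omega)]

lemma exec_rootInit (h0 : s 0 = n) (h1 : s 1 = m) (K : ℕ) : (rootInit K).exec O s =
    writes [(n * n + 4, 1), (n * n + 7, 1), (n * n + 9, ((n + 1) * (m + 1)) ^ K), (n * n + 10, 1),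
      (n * n + 11, 1), (1, n * n + 4)] s := by
  unfold rootInit
  iterate 6
    refine Program.exec_block_cons ?_ ?_ ?_
    rotate_left 2
  · rfl
  all_goals first
    | rfl
    | (refine eval_glob ?_ _
       simpa (disch := omega) only [Function.update_of_ne])
    | (refine eval_powExpr ?_ ?_ _ <;> simpa (disch := omega) only [Function.update_of_ne])

lemma exec_output {f : Frame} {a : ℕ → ℕ} {N D : ℕ} (h : Represents n a N D s [f]) :
    outputProgram.exec O s = writes [(0, f.vac), (1, f.occ)] s := by
  have h1 := h.top_eq
  obtain ⟨-, -, -, -, -, -, f6, f7⟩ := h.stack.1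
  unfold outputProgram
  refine Program.exec_block_cons rfl ?_ (Program.exec_block_cons rfl ?_ rfl)
  · simp only [Expr.eval, field, slot, h1, f7]
  · simp (disch := omega) only [Expr.eval, field, slot, Function.update_of_ne, h1, f6]

/-- The part of the input that describes the graph. -/
noncomputable def adjacency (m : ℕ) (H : SimpleGraph (Fin n)) (k : ℕ) : ℕ := inputStore m H (2 + k)

lemma adjacency_ne_zero_iff (m : ℕ) (H : SimpleGraph (Fin n)) (i j : Fin n) :
    adjacency m H (i * n + j) ≠ 0 ↔ H.Adj i j := by
  unfold adjacency inputStore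
  rw [if_neg (by omega), if_neg (by omega)]
  have : (∃ i' j' : Fin n, 2 + ((i : ℕ) * n + j) = 2 + ((i' : ℕ) * n + j') ∧ H.Adj i' j') ↔
      H.Adj i j := by
    constructor
    · rintro ⟨i', j', h, hadj⟩
      have h' : (i : ℕ) * n + j = (i' : ℕ) * n + j' := by omega
      have hn : 0 < n := i.pos
      have e1 : (i : ℕ) = i' := by
        have := congrArg (· / n) h'
        simpa [Nat.mul_comm _ n, Nat.mul_add_div hn, Nat.div_eq_of_lt j.2,
          Nat.div_eq_of_lt j'.2] using this
      have e2 : (j : ℕ) = j' := by rw [e1] at h'; omega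
      rwa [Fin.ext e1, Fin.ext e2]
    · exact fun h => ⟨i, j, rfl, h⟩
  rw [← this]
  split_ifs with h
  · exact iff_of_true one_ne_zero h
  · exact iff_of_false (fun h => h rfl) h

lemma inputStore_of_le (m : ℕ) (H : SimpleGraph (Fin n)) {k : ℕ} (hk : n * n + 2 ≤ k) :
    inputStore m H k = 0 := by
  unfold inputStore
  rw [if_neg (by omega), if_neg (by omega), if_neg]
  rintro ⟨i, j, h, -⟩
  have h1 : (i : ℕ) * n + j < n * n := by
    have := i.2; have := j.2
    nlinarith
  omega

lemma inputStore_le {B : ℕ} (m : ℕ) (H : SimpleGraph (Fin n)) (hn : n ≤ B) (hm : m ≤ B)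
    (hB : 1 ≤ B) (k : ℕ) : inputStore m H k ≤ B := by
  unfold inputStore
  split_ifs <;> omega

theorem exists_runs_approxProgram (c K : ℕ) : ∃ C, ∀ (O : ℕ → ℕ) (n m : ℕ) (H : SimpleGraph (Fin n))
    (T B : ℕ) (f' : Frame),
    (dfsStep n (adjacency m H) (O (c * ((n + 1) * (m + 1)))) (2 ^ (c * ((n + 1) * (m + 1)))))^[T]
      [rootFrame (((n + 1) * (m + 1)) ^ K)] = [f'] → n ≤ f'.ptr →
    m ≤ B → (T + 1) * 2 ^ n ≤ B → ((n + 1) * (m + 1)) ^ K ≤ B →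
    (O (c * ((n + 1) * (m + 1))) + 2 ^ (c * ((n + 1) * (m + 1)))) ^ (T + 1) ≤ B →
    n * n + 4 + 8 * (T + 2) ≤ B →
    ∃ s t, (approxProgram c K).Runs O (inputStore m H) s t ∧ s 0 = f'.vac ∧ s 1 = f'.occ ∧
      t ≤ C * (T + 1 + c * ((n + 1) * (m + 1))) * (Nat.size B + 1) ^ 2 := by
  obtain ⟨c1, hc1⟩ := (digitsInit c).exists_runs_le (digitsInit_simple c)
  obtain ⟨c2, hc2⟩ := Program.runs_loop doublingTest_queryFree doublingBody_simple
  obtain ⟨c3, hc3⟩ := (glob 2).exists_cost_le (glob_queryFree 2)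
  obtain ⟨c4, hc4⟩ := (Expr.load (glob 2)).exists_cost_le (glob_queryFree 2)
  obtain ⟨c5, hc5⟩ := (rootInit K).exists_runs_le (rootInit_simple K)
  obtain ⟨c6, hc6⟩ := exists_runs_dfs
  obtain ⟨c7, hc7⟩ := outputProgram.exists_runs_le outputProgram_simple
  refine ⟨c1 + c2 + (2 * c3 + c4 + 3) + c5 + c6 + c7 + 5, ?_⟩
  intro O n m H T B f' hT hf' hm h1 h2 h3 h4
  set kk := c * ((n + 1) * (m + 1)) with hkk
  set N := O kk with hN
  set D := 2 ^ kk with hD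
  set q := ((n + 1) * (m + 1)) ^ K with hq
  set a := adjacency m H with ha
  set W := Nat.size B with hW
  have hD0 : 0 < D := by positivity
  -- This is why the hypothesis has the exponent T + 1 and not T: it is positive even for T = 0.
  have hND : N + D ≤ B := (Nat.le_self_pow (Nat.succ_ne_zero T) _).trans h3
  have hkD : kk < D := Nat.lt_two_pow_self
  have hsz : ∀ s : Store, (∀ i, s i ≤ B) → ∀ i, Nat.size (s i) ≤ W :=
    fun s hs i => Nat.size_le_size (hs i)
  -- the input
  set s₀ := inputStore m H with hs₀
  have e0 : s₀ 0 = n := by simp [hs₀, inputStore]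
  have e1 : s₀ 1 = m := by simp [hs₀, inputStore]
  have hz : ∀ k, n * n + 2 ≤ k → s₀ k = 0 := fun k hk => inputStore_of_le m H hk
  have hB₀ : ∀ i, s₀ i ≤ B := inputStore_le m H (by nlinarith) hm (by omega)
  -- initialization
  obtain ⟨t1, r1, b1, -⟩ := hc1 O s₀ W (hsz s₀ hB₀)
  rw [exec_digitsInit e0 e1 c] at r1
  set s₁ := writes [(n * n + 3, 1), (n * n + 2, kk)] s₀ with hs₁
  -- the powers of two
  let I : ℕ → Store → Prop := fun j s => s (n * n + 2) = kk ∧ s (n * n + 3) = 2 ^ j ∧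
    s (n * n + 4) = j ∧ ∀ i, i ≠ n * n + 2 → i ≠ n * n + 3 → i ≠ n * n + 4 → s i = s₀ i
  have hI0 : I 0 s₁ := by
    refine ⟨?_, ?_, ?_, fun i i1 i2 i3 => ?_⟩
    · simp (disch := omega) only [hs₁, writes, Function.update_self]
    · simp (disch := omega) only [hs₁, writes, Function.update_self, Function.update_of_ne,
        pow_zero]
    · rw [hs₁, writes_of_notMem (by simp), hz _ (by omega)]
    · rw [hs₁, writes_of_notMem (by simp; omega)]
  have hIB : ∀ j ≤ kk, ∀ s, I j s → ∀ i, s i ≤ B := by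
    rintro j hj s ⟨i1, i2, i3, i4⟩ i
    have : 2 ^ j ≤ D := Nat.pow_le_pow_right two_pos hj
    by_cases hi1 : i = n * n + 2
    · rw [hi1, i1]; omega
    by_cases hi2 : i = n * n + 3
    · rw [hi2, i2]; omega
    by_cases hi3 : i = n * n + 4
    · rw [hi3, i3]; omega
    · rw [i4 i hi1 hi2 hi3]; exact hB₀ i
  have hItest : ∀ j s, I j s → doublingTest.eval O s = kk - j := by
    rintro j s ⟨i1, i2, i3, i4⟩
    have h0 : s 0 = n := by rw [i4 0 (by omega) (by omega) (by omega), e0]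
    simp only [doublingTest, Expr.eval, eval_glob h0, i1, i3]
  obtain ⟨s₂, t2, r2, hI2, b2⟩ := hc2 O I kk W (fun j hj s hs => hsz s (hIB j hj s hs))
    (fun j hj s hs => by
      refine ⟨by rw [hItest j s hs]; omega, ?_⟩
      obtain ⟨i1, i2, i3, i4⟩ := hs
      have h0 : s 0 = n := by rw [i4 0 (by omega) (by omega) (by omega), e0]
      rw [exec_doublingBody h0, i2, i3]
      refine ⟨?_, ?_, ?_, fun i k1 k2 k3 => ?_⟩
      · rw [writes_of_notMem (by simp), i1]
      · simp (disch := omega) only [writes, Function.update_self, Function.update_of_ne]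
        rw [pow_succ]; ring
      · simp (disch := omega) only [writes, Function.update_self]
      · rw [writes_of_notMem (by simp; omega), i4 i k1 k2 k3])
    (fun s hs => by rw [hItest kk s hs]; omega) s₁ hI0
  have hB₂ := hIB kk le_rfl s₂ hI2
  obtain ⟨i1, i2, i3, i4⟩ := hI2
  -- the digits of the activity
  have h20 : s₂ 0 = n := by rw [i4 0 (by omega) (by omega) (by omega), e0]
  have h21 : s₂ 1 = m := by rw [i4 1 (by omega) (by omega) (by omega), e1]
  have r3 := Program.Runs.assign (O := O) (glob 2) (.query (.load (glob 2))) s₂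
  have v3 : (Expr.load (glob 2)).eval O s₂ = kk := by
    simp only [Expr.eval, eval_glob h20, i1]
  have b3 : (glob 2).cost O s₂ + (Expr.query (.load (glob 2))).cost O s₂ +
      Nat.size ((glob 2).eval O s₂) + Nat.size ((Expr.query (.load (glob 2))).eval O s₂) + 1 ≤
      (2 * c3 + c4 + 3) * (W + 1) ^ 2 + kk := by
    have w1 := hc3 O s₂ W (hsz s₂ hB₂)
    have w2 := (hc4 O s₂ W (hsz s₂ hB₂)).2
    have w3 : Nat.size N ≤ W := Nat.size_le_size (by omega)
    have w4 : (Expr.query (.load (glob 2))).eval O s₂ = N := by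
      rw [Expr.eval, v3]
    have w5 : (Expr.query (.load (glob 2))).cost O s₂ =
        (Expr.load (glob 2)).cost O s₂ + kk + Nat.size N + 1 := by
      rw [hN, ← v3]; rfl
    rw [w4, w5]
    have w6 : W + 1 ≤ (W + 1) ^ 2 := Nat.le_self_pow two_ne_zero _
    have w7 : c3 * (W + 1) ≤ c3 * (W + 1) ^ 2 := Nat.mul_le_mul_left _ w6
    have w8 : (2 * c3 + c4 + 3) * (W + 1) ^ 2 = c3 * (W + 1) ^ 2 + c3 * (W + 1) ^ 2 +
      c4 * (W + 1) ^ 2 + 3 * (W + 1) ^ 2 := by ring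
    omega
  have x3 : Function.update s₂ ((glob 2).eval O s₂) ((Expr.query (.load (glob 2))).eval O s₂) =
      Function.update s₂ (n * n + 2) N := by
    rw [eval_glob h20, Expr.eval, v3]
  rw [x3] at r3
  set s₃ := Function.update s₂ (n * n + 2) N with hs₃
  have hB₃ : ∀ i, s₃ i ≤ B := fun i => by
    rw [hs₃, Function.update_apply]
    split_ifs
    · omega
    · exact hB₂ i
  have h30 : s₃ 0 = n := by rw [hs₃, Function.update_of_ne (by omega), h20]
  have h31 : s₃ 1 = m := by rw [hs₃, Function.update_of_ne (by omega), h21]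
  -- the frame of the root
  obtain ⟨t4, r4, b4, -⟩ := hc5 O s₃ W (hsz s₃ hB₃)
  rw [exec_rootInit h30 h31 K, ← hq] at r4
  set s₄ := writes [(n * n + 4, 1), (n * n + 7, 1), (n * n + 9, q), (n * n + 10, 1),
      (n * n + 11, 1), (1, n * n + 4)] s₃ with hs₄
  have hB₄ : ∀ i, s₄ i ≤ B := writes_le (by simp; omega) hB₃
  have h3z : ∀ k, n * n + 5 ≤ k → s₃ k = 0 := fun k hk => by
    rw [hs₃, Function.update_of_ne (by omega), i4 k (by omega) (by omega) (by omega),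
      hz k (by omega)]
  have hrep : Represents n a N D s₄ [rootFrame q] := by
    refine ⟨?_, ?_, fun k hk => ?_, ?_, ?_, ?_, trivial⟩
    · rw [hs₄, writes_of_notMem (by simp), h30]
    · simp (disch := omega) only [hs₄, writes, Function.update_self, List.length_cons,
        List.length_nil]
    · rw [hs₄, writes_of_notMem (by simp; omega), hs₃, Function.update_of_ne (by omega),
        i4 _ (by omega) (by omega) (by omega)]
      rfl
    · rw [hs₄, writes_of_notMem (by simp), hs₃, Function.update_self]
    · rw [hs₄, writes_of_notMem (by simp), hs₃, Function.update_of_ne (by omega), i2]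
    · simp (disch := omega) only [frameAt, hs₄, writes, Function.update_self, List.length_nil,
        mul_zero, add_zero, add_assoc, Nat.reduceAdd, Function.update_of_ne, h3z, rootFrame,
        and_self]
  -- the main loop
  obtain ⟨s₅, t5, r5, hrep5, hB₅, b5⟩ := hc6 O n a N D q T B s₄ f' hD0 hrep hB₄ h1 h2
    ((Nat.pow_le_pow_right (by omega) (Nat.le_succ T)).trans h3) h4 hT hf'
  -- the output
  obtain ⟨t6, r6, b6, -⟩ := hc7 O s₅ W (hsz s₅ hB₅)
  rw [exec_output hrep5] at r6
  refine ⟨_, _, .seq r1 (.seq r2 (.seq r3 (.seq r4 (.seq r5 r6)))), ?_, ?_, ?_⟩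
  · simp (disch := omega) only [writes, Function.update_self, Function.update_of_ne]
  · simp (disch := omega) only [writes, Function.update_self]
  · set Y := (W + 1) ^ 2 with hY
    have hY1 : 1 ≤ Y := Nat.one_le_pow _ _ (Nat.succ_pos W)
    set X := T + 1 + kk with hX
    have y0 : Y ≤ X * Y := Nat.le_mul_of_pos_left _ (by omega)
    have y1 : c1 * Y ≤ c1 * (X * Y) := Nat.mul_le_mul_left _ y0
    have y2 : c2 * (kk + 1) * Y ≤ c2 * (X * Y) := by
      rw [mul_assoc]; exact Nat.mul_le_mul_left _ (Nat.mul_le_mul_right _ (by omega))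
    have y3 : (2 * c3 + c4 + 3) * Y ≤ (2 * c3 + c4 + 3) * (X * Y) := Nat.mul_le_mul_left _ y0
    have y4 : kk + 5 ≤ 5 * (X * Y) := by
      have : X ≤ X * Y := Nat.le_mul_of_pos_right _ (by omega)
      omega
    have y5 : c5 * Y ≤ c5 * (X * Y) := Nat.mul_le_mul_left _ y0
    have y6 : c6 * (T + 1) * Y ≤ c6 * (X * Y) := by
      rw [mul_assoc]; exact Nat.mul_le_mul_left _ (Nat.mul_le_mul_right _ (by omega))
    have y7 : c7 * Y ≤ c7 * (X * Y) := Nat.mul_le_mul_left _ y0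
    have y8 : (c1 + c2 + (2 * c3 + c4 + 3) + c5 + c6 + c7 + 5) * X * Y = c1 * (X * Y) +
      c2 * (X * Y) + (2 * c3 + c4 + 3) * (X * Y) + c5 * (X * Y) + c6 * (X * Y) + c7 * (X * Y) +
      5 * (X * Y) := by ring
    rw [y8]
    omega

end Complete

/-! ### Relabelling the vertices -/

section Relabel

variable {V : Type*} {n : ℕ}

lemma partitionFunction_eq_indepSum (lam : ℝ) (G : SimpleGraph V) (e : Fin n ≃ V) :
    partitionFunction lam G = indepSum lam (G.comap e) Finset.univ := by
  classical
  rw [partitionFunction, indepSum, ← finsum_mem_coe_finset]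
  symm
  have hfin : Finite V := Finite.of_equiv _ e
  refine finsum_mem_eq_of_bijOn (fun I : Finset (Fin n) => e '' (I : Set (Fin n)))
    ⟨?_, ?_, ?_⟩ ?_
  · intro I hI
    have hI' : (G.comap e).IsIndepSet (I : Set (Fin n)) := by
      simpa using hI
    rintro _ ⟨i, hi, rfl⟩ _ ⟨j, hj, rfl⟩ hij
    exact hI' hi hj fun h => hij (congrArg e h)
  · intro I _ J _ hIJ
    exact Finset.coe_injective (e.injective.image_injective hIJ)
  · intro J hJ
    have hJ' : G.IsIndepSet J := hJ
    refine ⟨Finset.univ.filter fun i => e i ∈ J, ?_, ?_⟩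
    · simp only [Finset.coe_filter, Set.mem_ofPred_eq, Finset.powerset_univ, Finset.mem_univ,
        true_and]
      intro i hi j hj hij
      exact hJ' hi hj fun h => hij (e.injective h)
    · ext x
      simp only [Finset.coe_filter, Finset.mem_univ, true_and, Set.mem_image, Set.mem_ofPred_eq]
      constructor
      · rintro ⟨i, hi, rfl⟩; exact hi
      · intro hx; exact ⟨e.symm x, by simpa using hx, by simp⟩
  · intro I _
    rw [Set.ncard_image_of_injective _ e.injective, Set.ncard_coe_finset]

lemma sawCount_comap_le {G : SimpleGraph V} (hG : ∀ v, (G.neighborSet v).Finite) (e : Fin n ≃ V)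
    (u : Fin n) (k : ℕ) : sawCount (G.comap e) u k ≤ sawCount G (e u) k := by
  let f : G.comap e ↪g G := SimpleGraph.Embedding.comap e.toEmbedding G
  refine Set.ncard_le_ncard_of_injOn
    (fun p => (⟨e p.1, p.2.map f.toHom⟩ : Σ w : V, G.Walk (e u) w)) ?_ ?_
    ((finite_walks_length hG k (e u)).subset fun _ hp => hp.2)
  · rintro ⟨w, p⟩ ⟨h1, h2⟩
    exact ⟨SimpleGraph.Walk.IsPath.map f.injective h1, (SimpleGraph.Walk.length_map _ _).trans h2⟩
  · rintro ⟨w, p⟩ _ ⟨w', p'⟩ _ h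
    obtain ⟨h1, h2⟩ := Sigma.mk.inj_iff.1 h
    have hw : w = w' := e.injective h1
    subst hw
    exact congrArg (Sigma.mk w)
      (SimpleGraph.Walk.map_injective_of_injective (f := f.toHom) f.injective u w (eq_of_heq h2))

end Relabel

/-! ### The size of the recursion tree -/

section Tree

variable {V : Type*} {G : SimpleGraph V}

lemma childSum_le {F : Finset V → V → ℕ} {M : ℕ} (p : V → Prop) (us : List V) (S : Finset V)
    (hF : ∀ S u, u ∉ S → F S u ≤ M) : childSum F p us S ≤ us.length * M := by
  classical
  induction us generalizing S with
  | nil => simp [childSum]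
  | cons u us ih =>
    rw [childSum, List.length_cons, add_mul, one_mul]
    split_ifs
    · have h1 := hF _ _ (Finset.notMem_erase u S)
      have h2 := ih (S.erase u)
      omega
    · have h2 := ih S
      omega

lemma childSum_sum (F : ℕ → Finset V → V → ℕ) (s : Finset ℕ) (p : V → Prop) (us : List V)
    (S : Finset V) :
    childSum (fun S u => ∑ j ∈ s, F j S u) p us S = ∑ j ∈ s, childSum (F j) p us S := by
  classical
  induction us generalizing S with
  | nil => simp [childSum]
  | cons u us ih =>
    by_cases h : u ∈ S ∧ p u
    · simp only [childSum, if_pos h, ih, Finset.sum_add_distrib]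
    · simp only [childSum, if_neg h, ih]

/-- This links the size of the tree to the partial sums of walk counts that the connective constant
of a finite family bounds. -/
lemma nodeCount_eq_sum (E : List V) (k : ℕ) :
    nodeCount G E k = fun S v => ∑ j ∈ Finset.range (k + 1), levelCount G E j S v := by
  induction k with
  | zero => funext S v; simp [nodeCount, levelCount]
  | succ k ih =>
    funext S v
    rw [nodeCount, ih]
    change 1 + childSum (fun S v => ∑ j ∈ Finset.range (k + 1), levelCount G E j S v) (G.Adj v) E S = _
    rw [childSum_sum, Finset.sum_range_succ' _ (k + 1), add_comm]
    rfl

/-- Nothing is contracted at the virtual root: the errors of the logarithms of the factors simply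
add up. -/
lemma abs_log_chain_sub_le {F F' : Finset V → V → ℝ} {ε : ℝ} (hF : ∀ S u, 0 ≤ F S u)
    (hF' : ∀ S u, 0 ≤ F' S u)
    (h : ∀ S u, u ∉ S → |Real.log (1 + F S u) - Real.log (1 + F' S u)| ≤ ε) (hε : 0 ≤ ε)
    (p : V → Prop) (us : List V) (S : Finset V) :
    |Real.log (chain F p us S) - Real.log (chain F' p us S)| ≤ us.length * ε := by
  classical
  induction us generalizing S with
  | nil => simp [chain]
  | cons u us ih =>
    rw [List.length_cons, Nat.cast_add, Nat.cast_one, add_mul, one_mul]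
    by_cases hu : u ∈ S ∧ p u
    · rw [chain, chain, if_pos hu, if_pos hu]
      have h1 := hF (S.erase u) u
      have h2 := hF' (S.erase u) u
      rw [Real.log_mul (by positivity) (chain_mem hF p us _).1.ne',
        Real.log_mul (by positivity) (chain_mem hF' p us _).1.ne', Real.log_inv, Real.log_inv]
      have h3 := abs_le.1 (h _ _ (Finset.notMem_erase u S))
      have h4 := abs_le.1 (ih (S.erase u))
      rw [abs_le]
      constructor <;> linarith
    · rw [chain, chain, if_neg hu, if_neg hu]
      linarith [ih S]

/-- The dependence of the partition function on the activity. -/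
lemma indepSum_le_of_le {lam lam' : ℝ} (h0 : 0 < lam') (h : lam' ≤ lam) (S : Finset V) :
    indepSum lam' G S ≤ indepSum lam G S ∧
      indepSum lam G S ≤ (lam / lam') ^ S.card * indepSum lam' G S := by
  classical
  have hr : 1 ≤ lam / lam' := (one_le_div h0).2 h
  constructor
  · exact Finset.sum_le_sum fun I _ => pow_le_pow_left₀ h0.le h _
  · rw [indepSum, indepSum, Finset.mul_sum]
    refine Finset.sum_le_sum fun I hI => ?_
    have hcard : I.card ≤ S.card :=
      Finset.card_le_card (Finset.mem_powerset.1 (Finset.mem_filter.1 hI).1)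
    calc lam ^ I.card = (lam / lam') ^ I.card * lam' ^ I.card := by
          rw [← mul_pow, div_mul_cancel₀ _ h0.ne']
      _ ≤ _ := by gcongr

end Tree

/-! ### Polynomial bounds -/

/-- The function is bounded by a polynomial in its two arguments. -/
def PolyBounded (f : ℕ → ℕ → ℕ) : Prop :=
  ∃ C k, ∀ n m, 1 ≤ m → f n m ≤ C * (n + m) ^ k

namespace PolyBounded

lemma const (c : ℕ) : PolyBounded fun _ _ => c := ⟨c, 0, fun _ _ _ => by simp⟩

lemma left : PolyBounded fun n _ => n := ⟨1, 1, fun _ _ _ => by simp⟩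

lemma right : PolyBounded fun _ m => m := ⟨1, 1, fun _ _ _ => by simp⟩

lemma add {f g : ℕ → ℕ → ℕ} (hf : PolyBounded f) (hg : PolyBounded g) :
    PolyBounded fun n m => f n m + g n m := by
  obtain ⟨C, k, h⟩ := hf
  obtain ⟨C', k', h'⟩ := hg
  refine ⟨C + C', k + k', fun n m hm => ?_⟩
  have h1 : (n + m) ^ k ≤ (n + m) ^ (k + k') := Nat.pow_le_pow_right (by omega) (by omega)
  have h2 : (n + m) ^ k' ≤ (n + m) ^ (k + k') := Nat.pow_le_pow_right (by omega) (by omega)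
  rw [add_mul]
  exact add_le_add ((h n m hm).trans (Nat.mul_le_mul_left _ h1))
    ((h' n m hm).trans (Nat.mul_le_mul_left _ h2))

lemma mul {f g : ℕ → ℕ → ℕ} (hf : PolyBounded f) (hg : PolyBounded g) :
    PolyBounded fun n m => f n m * g n m := by
  obtain ⟨C, k, h⟩ := hf
  obtain ⟨C', k', h'⟩ := hg
  refine ⟨C * C', k + k', fun n m hm => ?_⟩
  calc f n m * g n m ≤ (C * (n + m) ^ k) * (C' * (n + m) ^ k') :=
        Nat.mul_le_mul (h n m hm) (h' n m hm)
    _ = _ := by ring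

lemma pow {f : ℕ → ℕ → ℕ} (hf : PolyBounded f) (j : ℕ) : PolyBounded fun n m => f n m ^ j := by
  induction j with
  | zero => simpa using const 1
  | succ j ih => simpa only [pow_succ] using ih.mul hf

end PolyBounded

/-! ### The approximation scheme -/

lemma abs_sub_le_of_abs_log_sub_le {x z : ℝ} {m : ℕ} (hx : 0 < x) (hz : 0 < z) (hm : 1 ≤ m)
    (h : |Real.log x - Real.log z| ≤ 1 / (2 * m)) : |x - z| ≤ z / m := by
  have hm' : (1 : ℝ) ≤ m := by exact_mod_cast hm
  have h1 : |Real.log x - Real.log z| ≤ 1 := h.trans (by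
    rw [div_le_one (by positivity)]; linarith)
  have h2 := Real.abs_exp_sub_one_le h1
  have h3 : x - z = z * (Real.exp (Real.log x - Real.log z) - 1) := by
    rw [Real.exp_sub, Real.exp_log hx, Real.exp_log hz]; field_simp
  rw [h3, abs_mul, abs_of_pos hz, div_eq_mul_inv]
  apply mul_le_mul_of_nonneg_left _ hz.le
  refine h2.trans ((mul_le_mul_of_nonneg_left h two_pos.le).trans (le_of_eq ?_))
  field_simp

/-- Already 2^kk ≥ kk makes the relative rounding error of order 1 / ((n+1)(m+1)). Changing the
activity by a factor r changes Z by at most r^n, whose logarithm is estimated here. -/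
lemma activity_error {lam : ℝ} (hlam : 0 < lam) {c kk n m : ℕ} (hc : 8 / lam ≤ c) (hm : 1 ≤ m)
    (hkk : c * ((n + 1) * (m + 1)) ≤ kk) :
    0 < (digits lam kk / (2 ^ kk : ℕ) : ℝ) ∧ (digits lam kk / (2 ^ kk : ℕ) : ℝ) ≤ lam ∧
      n * Real.log (lam / (digits lam kk / (2 ^ kk : ℕ) : ℝ)) ≤ 1 / (4 * m) := by
  have hP : (0 : ℝ) < 2 ^ kk := by positivity
  push_cast
  set x : ℝ := digits lam kk / 2 ^ kk with hx
  have h1 : x ≤ lam := by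
    rw [hx, div_le_iff₀ hP]
    exact Nat.floor_le (by positivity)
  have h2 : lam - x ≤ (2 ^ kk)⁻¹ := by
    have := Nat.lt_floor_add_one (lam * 2 ^ kk)
    have h3 : lam ≤ (digits lam kk + 1) / 2 ^ kk := by
      rw [le_div_iff₀ hP]; exact this.le
    rw [add_div, ← hx, one_div] at h3
    linarith
  have hm' : (1 : ℝ) ≤ m := by exact_mod_cast hm
  have h3 : 8 * ((n + 1) * (m + 1)) / lam ≤ (2 : ℝ) ^ kk := by
    calc 8 * ((n + 1) * (m + 1)) / lam = 8 / lam * ((n + 1) * (m + 1)) := by ring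
      _ ≤ c * ((n + 1) * (m + 1)) := by gcongr
      _ ≤ kk := by exact_mod_cast hkk
      _ ≤ _ := by exact_mod_cast (Nat.lt_two_pow_self (n := kk)).le
  have h4 : (2 ^ kk : ℝ)⁻¹ ≤ lam / (8 * ((n + 1) * (m + 1))) := by
    rw [inv_le_comm₀ hP (by positivity), inv_div]; exact h3
  have h5 : lam / (8 * ((n + 1) * (m + 1))) ≤ lam / 2 := by
    gcongr
    nlinarith [(Nat.cast_nonneg n : (0 : ℝ) ≤ n)]
  have h6 : lam / 2 ≤ x := by linarith
  have hx0 : 0 < x := by linarith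
  refine ⟨hx0, h1, ?_⟩
  have h7 : Real.log (lam / x) ≤ lam / x - 1 := Real.log_le_sub_one_of_pos (by positivity)
  have h8 : lam / x - 1 ≤ 1 / (4 * ((n + 1) * (m + 1))) := by
    have : lam / x - 1 = (lam - x) / x := by field_simp
    rw [this, div_le_iff₀ hx0]
    calc lam - x ≤ lam / (8 * ((n + 1) * (m + 1))) := h2.trans h4
      _ = 1 / (4 * ((n + 1) * (m + 1))) * (lam / 2) := by field_simp; ring
      _ ≤ _ := by gcongr
  calc n * Real.log (lam / x) ≤ n * (1 / (4 * ((n + 1) * (m + 1)))) := by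
        gcongr; exact h7.trans h8
    _ ≤ 1 / (4 * m) := by
        rw [mul_one_div, div_le_div_iff₀ (by positivity) (by positivity)]
        nlinarith [(Nat.cast_nonneg n : (0 : ℝ) ≤ n)]

/-! ### The approximation scheme for a family of graphs -/

/-- The depth k is at least about K log₂ b, so ρ^k is at most a power of 1/b whose exponent grows
with K. -/
lemma exists_error_exponent {ρ A : ℝ} (hρ : 0 < ρ) (hρ1 : ρ < 1) (hA : 0 ≤ A) :
    ∃ K₀ : ℕ, ∀ K k b : ℕ, K₀ ≤ K → 2 ≤ b → b ^ K < 2 ^ (k + 1) → A * b ^ 2 * ρ ^ k ≤ 1 := by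
  obtain ⟨r, hr⟩ := exists_pow_lt_of_lt_one (show (0 : ℝ) < 1 / 2 by norm_num) hρ1
  have hr0 : r ≠ 0 := by rintro rfl; norm_num at hr
  obtain ⟨e, he⟩ := pow_unbounded_of_one_lt (2 * A) (show (1 : ℝ) < 2 by norm_num)
  -- Logarithms are avoided by taking r-th powers: ρ^r < 1/2 gives (ρ^k)^r ≤ 2^(-k), and b^(r(2+e))
  -- ≤ 2^(k+1). The 2 accounts for b², and b^e absorbs the constant 2A.
  refine ⟨r * (2 + e), fun K k b hK hb hk => ?_⟩
  have hb' : (2 : ℝ) ≤ b := by exact_mod_cast hb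
  have hb0 : (0 : ℝ) < b := by linarith
  have h1 : (b : ℝ) ^ (r * (2 + e)) ≤ 2 ^ (k + 1) := by
    exact_mod_cast (Nat.pow_le_pow_right (by omega) hK).trans hk.le
  have h2 : (ρ ^ k) ^ r * b ^ (r * (2 + e)) ≤ 2 := by
    calc (ρ ^ k) ^ r * b ^ (r * (2 + e)) ≤ (1 / 2) ^ k * 2 ^ (k + 1) := by
          rw [pow_right_comm]
          gcongr
      _ = 2 := by rw [pow_succ, ← mul_assoc, ← mul_pow]; norm_num
  have h3 : 2 * A ≤ (b : ℝ) ^ e := he.le.trans (by gcongr)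
  have h4 : (2 * (A * b ^ 2 * ρ ^ k)) ^ r ≤ 2 := by
    calc (2 * (A * b ^ 2 * ρ ^ k)) ^ r = ((2 * A) * b ^ 2 * ρ ^ k) ^ r := by ring
      _ ≤ (b ^ e * b ^ 2 * ρ ^ k) ^ r := by gcongr
      _ = (ρ ^ k) ^ r * b ^ (r * (2 + e)) := by ring
      _ ≤ 2 := h2
  rw [mul_pow] at h4
  have h5 : (2 : ℝ) ≤ 2 ^ r := le_self_pow₀ (by norm_num) hr0
  have h6 : 0 ≤ A * b ^ 2 * ρ ^ k := by positivity
  have h7 : (A * b ^ 2 * ρ ^ k) ^ r ≤ 1 := by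
    by_contra! h
    nlinarith
  exact (pow_le_one_iff_of_nonneg h6 hr0).1 h7

/-! ### Accuracy and tree size at depth k -/

section Family

variable {n : ℕ} {H : SimpleGraph (Fin n)} {Δ c a : ℝ}

/-- The walk bound is used at length k + 1, which `mul_log_le` puts above the threshold. The surplus
factor Δ goes into the constant, whose summand 1 serves k = 0. -/
lemma alpha_pow_mul_levelCount_le {α : ℝ} (hα : 0 < α) (hΔ : 0 < Δ) {k : ℕ}
    {u : Fin n} (h : (∑ j ∈ Finset.Icc 1 (k + 1), (sawCount H u j : ℝ)) ≤ c * Δ ^ (k + 1))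
    {S : Finset (Fin n)} (hu : u ∉ S) :
    α ^ k * levelCount H (List.finRange n) k S u ≤ (1 + |c| * Δ) * (α * Δ) ^ k := by
  have h1 : (levelCount H (List.finRange n) k S u : ℝ) ≤ sawCount H u k := by
    exact_mod_cast levelCount_le_sawCount (fun _ => Set.toFinite _) (List.nodup_finRange n) k hu
  have h2 : (sawCount H u k : ℝ) ≤ (1 + |c| * Δ) * Δ ^ k := by
    rcases Nat.eq_zero_or_pos k with rfl | hk
    · have : (sawCount H u 0 : ℝ) ≤ 1 := by exact_mod_cast sawCount_zero_le H u
      have h3 : 0 ≤ |c| * Δ := by positivity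
      simpa using this.trans (by linarith)
    · calc (sawCount H u k : ℝ) ≤ ∑ j ∈ Finset.Icc 1 (k + 1), (sawCount H u j : ℝ) :=
            Finset.single_le_sum (f := fun j => (sawCount H u j : ℝ)) (fun _ _ => by positivity)
              (Finset.mem_Icc.2 ⟨hk, by omega⟩)
        _ ≤ c * Δ ^ (k + 1) := h
        _ ≤ |c| * Δ ^ (k + 1) := by gcongr; exact le_abs_self c
        _ = (|c| * Δ) * Δ ^ k := by ring
        _ ≤ _ := by gcongr; linarith
  calc α ^ k * levelCount H (List.finRange n) k S u ≤ α ^ k * ((1 + |c| * Δ) * Δ ^ k) := by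
        gcongr; exact h1.trans h2
    _ = _ := by rw [mul_pow]; ring

/-- The size of the tree is exponential in the depth, but Δ ≤ 2^e and 2^k ≤ q turn Δ^(k+1) into the
polynomial (2q)^e. -/
lemma nodeCount_le {c' e q k : ℕ} (hΔ : 0 < Δ) (hc : c ≤ c') (hΔe : Δ ≤ 2 ^ e) (hq : 2 ^ k ≤ q)
    {u : Fin n} (h : (∑ j ∈ Finset.Icc 1 (k + 1), (sawCount H u j : ℝ)) ≤ c * Δ ^ (k + 1))
    {S : Finset (Fin n)} (hu : u ∉ S) :
    nodeCount H (List.finRange n) k S u ≤ 1 + c' * (2 * q) ^ e := by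
  have h0 : (sawCount H u 0 : ℝ) ≤ 1 := by exact_mod_cast sawCount_zero_le H u
  have hq' : (2 : ℝ) ^ k ≤ q := by exact_mod_cast hq
  have key : (nodeCount H (List.finRange n) k S u : ℝ) ≤ 1 + c' * (2 * q) ^ e := by
    rw [nodeCount_eq_sum]
    push_cast
    calc (∑ j ∈ Finset.range (k + 1), (levelCount H (List.finRange n) j S u : ℝ))
        ≤ ∑ j ∈ Finset.range (k + 1), (sawCount H u j : ℝ) := by
          refine Finset.sum_le_sum fun j _ => ?_
          exact_mod_cast
            levelCount_le_sawCount (fun _ => Set.toFinite _) (List.nodup_finRange n) j hu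
      _ ≤ ∑ j ∈ insert 0 (Finset.Icc 1 (k + 1)), (sawCount H u j : ℝ) := by
          refine Finset.sum_le_sum_of_subset_of_nonneg (fun j hj => ?_) fun _ _ _ => by positivity
          rw [Finset.mem_range] at hj
          rw [Finset.mem_insert, Finset.mem_Icc]
          omega
      _ = sawCount H u 0 + ∑ j ∈ Finset.Icc 1 (k + 1), (sawCount H u j : ℝ) :=
          Finset.sum_insert (by simp)
      _ ≤ 1 + c * Δ ^ (k + 1) := add_le_add h0 h
      _ ≤ 1 + c' * (2 ^ e) ^ (k + 1) := by gcongr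
      _ = 1 + c' * (2 * 2 ^ k) ^ e := by rw [pow_right_comm, pow_succ' 2 k]
      _ ≤ _ := by gcongr
  exact_mod_cast key

/-- The depth passes the threshold: k + 1 exceeds K log₂ b, and log 2 ≤ 1. -/
lemma mul_log_le {K k b : ℕ} (ha : |a| ≤ K) (hn : n ≤ b) (hb : 1 ≤ b) (hk : b ^ K < 2 ^ (k + 1)) :
    a * Real.log n ≤ (k + 1 : ℕ) := by
  have hb' : (0 : ℝ) < b := by exact_mod_cast hb
  have hlb : 0 ≤ Real.log b := Real.log_nonneg (by exact_mod_cast hb)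
  have h1 : Real.log n ≤ Real.log b := by
    rcases Nat.eq_zero_or_pos n with rfl | h
    · simpa using hlb
    · exact Real.log_le_log (by exact_mod_cast h) (by exact_mod_cast hn)
  have h2 : (K : ℝ) * Real.log b ≤ ((k + 1 : ℕ) : ℝ) * Real.log 2 := by
    rw [← Real.log_pow, ← Real.log_pow]
    exact Real.log_le_log (by positivity) (by exact_mod_cast hk.le)
  calc a * Real.log n ≤ |a| * Real.log n := by
        gcongr
        exact le_abs_self a
    _ ≤ K * Real.log b := by gcongr
    _ ≤ ((k + 1 : ℕ) : ℝ) * Real.log 2 := h2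
    _ ≤ (k + 1 : ℕ) * 1 := by gcongr; linarith [Real.log_two_lt_d9]
    _ = _ := mul_one _

/-- The accuracy of the tree recursion of depth `k` with leaf values equal to the activity. -/
lemma abs_log_chain_treeRatio_sub_le {lam x α ε : ℝ} (hx : 0 ≤ x) (hxl : x ≤ lam) (hα : 0 < α)
    (h : lam ≤ α * Real.exp (1 + α)) (hε : 0 ≤ ε) {k : ℕ}
    (hcount : ∀ (S : Finset (Fin n)) u, u ∉ S →
      α ^ k * levelCount H (List.finRange n) k S u * message lam ^ 2 ≤ ε ^ 2) :
    |Real.log (chain (treeRatio x H (List.finRange n) (fun _ _ => x) k) (fun _ => True)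
        (List.finRange n) Finset.univ) - Real.log (indepSum x H Finset.univ)⁻¹| ≤ n * (2 * ε) := by
  have hmem := treeRatio_mem (G := H) hx (List.finRange n) (g := fun _ _ => x)
    (fun _ _ => ⟨hx, le_rfl⟩) k
  have hlist : ∀ (S : Finset (Fin n)), ∀ u ∈ S, u ∈ List.finRange n :=
    fun _ u _ => List.mem_finRange u
  rw [inv_indepSum_eq_chain hx (hlist _)]
  refine (abs_log_chain_sub_le (ε := 2 * ε) (fun S u => (hmem S u).1) (occRatio_nonneg hx)
    (fun S u hu => ?_) (by positivity) _ _ _).trans_eq (by rw [List.length_finRange])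
  refine (abs_log_sub_log_le (hmem S u).1 (occRatio_nonneg hx S u)).trans ?_
  gcongr
  -- The true ratio is replaced by the recursion with exact leaves. The rate α chosen for λ also
  -- serves the rounded activity x ≤ λ.
  refine abs_le_of_sq_le_sq ?_ hε
  rw [← treeRatio_occRatio hx k (hlist S) u]
  refine (sq_message_treeRatio_sub_le hx hα (hxl.trans h) (List.finRange n)
    (fun _ _ => ⟨hx, le_rfl⟩) (occRatio_mem hx) k fun _ _ => Iff.rfl).trans
    (le_trans ?_ (hcount S u hu))
  rw [mul_right_comm]
  gcongr
  · exact message_nonneg x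
  · exact message_mono hxl

lemma abs_log_indepSum_sub_le {lam x : ℝ} (hx : 0 < x) (hxl : x ≤ lam) :
    |Real.log (indepSum x H Finset.univ) - Real.log (indepSum lam H Finset.univ)| ≤
      n * Real.log (lam / x) := by
  obtain ⟨h1, h2⟩ := indepSum_le_of_le (G := H) hx hxl Finset.univ
  have h3 := indepSum_pos (G := H) hx.le Finset.univ
  have h4 : 0 < lam / x := div_pos (hx.trans_le hxl) hx
  have h5 := Real.log_le_log h3 h1
  have h6 := Real.log_le_log (h3.trans_le h1) h2
  rw [Real.log_mul (by positivity) h3.ne', Real.log_pow, Finset.card_univ, Fintype.card_fin] at h6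
  rw [abs_sub_comm, abs_of_nonneg (by linarith)]
  linarith

/-- The reciprocal of the computed quantity approximates the partition function. -/
lemma abs_sub_indepSum_le {lam x y α ε : ℝ} {m : ℕ} (hx : 0 < x) (hxl : x ≤ lam) (hα : 0 < α)
    (h : lam ≤ α * Real.exp (1 + α)) (hε : 0 ≤ ε) {k : ℕ} (hm : 1 ≤ m)
    (hcount : ∀ (S : Finset (Fin n)) u, u ∉ S →
      α ^ k * levelCount H (List.finRange n) k S u * message lam ^ 2 ≤ ε ^ 2)
    (hnε : n * (2 * ε) ≤ 1 / (4 * m)) (hlog : n * Real.log (lam / x) ≤ 1 / (4 * m))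
    (hy : y⁻¹ = chain (treeRatio x H (List.finRange n) (fun _ _ => x) k) (fun _ => True)
        (List.finRange n) Finset.univ) :
    |y - indepSum lam H Finset.univ| ≤ indepSum lam H Finset.univ / m := by
  have hmem := treeRatio_mem (G := H) hx.le (List.finRange n) (g := fun _ _ => x)
    (fun _ _ => ⟨hx.le, le_rfl⟩) k
  have hy0 : 0 < y := inv_pos.1 (hy ▸ (chain_mem (fun S u => (hmem S u).1) _ _ _).1)
  refine abs_sub_le_of_abs_log_sub_le hy0 (indepSum_pos (hx.le.trans hxl) _) hm ?_
  have h1 := abs_log_chain_treeRatio_sub_le hx.le hxl hα h hε hcount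
  have h2 := abs_log_indepSum_sub_le (H := H) hx hxl
  rw [← hy, Real.log_inv, Real.log_inv] at h1
  have h3 : (1 : ℝ) / (2 * m) = 1 / (4 * m) + 1 / (4 * m) := by
    have : (m : ℝ) ≠ 0 := by positivity
    field_simp; norm_num
  rw [h3]
  rw [abs_le] at h1 h2 ⊢
  constructor <;> linarith

end Family

/-- The number of steps of the recursion, bounded in terms of the depth parameter `q`. -/
def stepBound (c' e n q : ℕ) : ℕ := n + (n + 1) * (n * (1 + c' * (2 * q) ^ e))

/-- The binary length of the numbers that occur, bounded in terms of the number `T` of steps. -/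
def lengthBound (l n m kk q T : ℕ) : ℕ :=
  m + (T + 1 + n) + q + (l + kk + 1) * (T + 1) + (n * n + 4 + 8 * (T + 2))

/-- The bound on the cells is 2^W, where the summands of W = `lengthBound` answer the size
conditions one by one. T' replaces T, which depends on the graph, by a bound in terms of n and m. -/
lemma exists_runs_approxProgram_of_le (lam : ℝ) (c K l : ℕ) (hl : lam ≤ 2 ^ l) :
    ∃ C, ∀ (n m : ℕ) (H : SimpleGraph (Fin n)) (T T' : ℕ) (f' : Frame),
      (dfsStep n (adjacency m H) (digits lam (c * ((n + 1) * (m + 1))))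
        (2 ^ (c * ((n + 1) * (m + 1)))))^[T] [rootFrame (((n + 1) * (m + 1)) ^ K)] = [f'] →
      n ≤ f'.ptr → T ≤ T' →
      ∃ s t, (approxProgram c K).Runs (digits lam) (inputStore m H) s t ∧ s 0 = f'.vac ∧
        s 1 = f'.occ ∧ t ≤ C * (T' + 1 + c * ((n + 1) * (m + 1))) *
          (lengthBound l n m (c * ((n + 1) * (m + 1))) (((n + 1) * (m + 1)) ^ K) T' + 2) ^ 2 := by
  obtain ⟨C, hC⟩ := exists_runs_approxProgram c K
  refine ⟨C, fun n m H T T' f' hf hptr hT => ?_⟩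
  set kk := c * ((n + 1) * (m + 1))
  set q := ((n + 1) * (m + 1)) ^ K
  set W := lengthBound l n m kk q T' with hW
  have hself : ∀ {x : ℕ}, x ≤ W → x ≤ 2 ^ W := fun h => h.trans Nat.lt_two_pow_self.le
  have hpow : ∀ {x : ℕ}, x ≤ W → 2 ^ x ≤ 2 ^ W := fun h => Nat.pow_le_pow_right two_pos h
  have hND : digits lam kk + 2 ^ kk ≤ 2 ^ (l + kk + 1) := by
    have h1 : digits lam kk ≤ 2 ^ (l + kk) := by
      refine Nat.floor_le_of_le ?_
      push_cast
      rw [pow_add]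
      gcongr
    have h2 : 2 ^ kk ≤ 2 ^ (l + kk) := Nat.pow_le_pow_right two_pos (by omega)
    rw [pow_succ]
    omega
  have hprod : (l + kk + 1) * (T + 1) ≤ W := by
    have : (l + kk + 1) * (T + 1) ≤ (l + kk + 1) * (T' + 1) := Nat.mul_le_mul_left _ (by omega)
    rw [hW, lengthBound]; omega
  obtain ⟨s, t, hs, h0, h1, ht⟩ := hC (digits lam) n m H T (2 ^ W) f' hf hptr
    (hself (by rw [hW, lengthBound]; omega))
    (by
      refine le_trans ?_ (hpow (x := T' + 1 + n) (by rw [hW, lengthBound]; omega))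
      rw [pow_add]
      gcongr
      exact (by omega : T + 1 ≤ T' + 1).trans Nat.lt_two_pow_self.le)
    (hself (by rw [hW, lengthBound]; omega))
    (by
      refine (Nat.pow_le_pow_left hND _).trans ?_
      rw [← pow_mul]
      exact hpow hprod)
    (hself (by rw [hW, lengthBound]; omega))
  refine ⟨s, t, hs, h0, h1, ht.trans ?_⟩
  rw [Nat.size_pow]
  gcongr

lemma polyBounded_runningTime (C c c' e K l : ℕ) : PolyBounded fun n m =>
    C * (stepBound c' e n (((n + 1) * (m + 1)) ^ K) + 1 + c * ((n + 1) * (m + 1))) *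
      (lengthBound l n m (c * ((n + 1) * (m + 1))) (((n + 1) * (m + 1)) ^ K)
        (stepBound c' e n (((n + 1) * (m + 1)) ^ K)) + 2) ^ 2 := by
  have hn := PolyBounded.left
  have hm := PolyBounded.right
  have hc := PolyBounded.const
  have hb : PolyBounded fun n m => (n + 1) * (m + 1) := (hn.add (hc 1)).mul (hm.add (hc 1))
  have hq := hb.pow K
  have hk : PolyBounded fun n m => c * ((n + 1) * (m + 1)) := (hc c).mul hb
  have hT : PolyBounded fun n m => stepBound c' e n (((n + 1) * (m + 1)) ^ K) :=
    hn.add ((hn.add (hc 1)).mul (hn.mul ((hc 1).add ((hc c').mul (((hc 2).mul hq).pow e)))))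
  have hW : PolyBounded fun n m => lengthBound l n m (c * ((n + 1) * (m + 1)))
      (((n + 1) * (m + 1)) ^ K) (stepBound c' e n (((n + 1) * (m + 1)) ^ K)) :=
    (((hm.add ((hT.add (hc 1)).add hn)).add hq).add
      ((((hc l).add hk).add (hc 1)).mul (hT.add (hc 1)))).add
      (((hn.mul hn).add (hc 4)).add ((hc 8).mul (hT.add (hc 2))))
  exact ((hc C).mul ((hT.add (hc 1)).add hk)).mul ((hW.add (hc 2)).pow 2)

theorem hasFPTAS {ι : Type*} {V : ι → Type*} (G : ∀ i, SimpleGraph (V i))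
    (hG : ∀ (i : ι) (v : V i), ((G i).neighborSet v).Finite)
    {lam Δ : ℝ} (hlam : 0 < lam) (hΔ : 0 < Δ) (hcrit : lam < criticalActivity (Δ + 1))
    {a : ℝ} (hconn : ConnectiveConstantAtMost G Δ a) (hfin : ∀ i, Finite (V i)) :
    HasFPTAS lam G := by
  obtain ⟨α, hα, hαΔ, hαl⟩ := exists_contraction_rate hΔ hcrit
  obtain ⟨c, hc⟩ := hconn.1
  obtain ⟨c', hc'⟩ := exists_nat_ge c
  obtain ⟨e, he⟩ := pow_unbounded_of_one_lt Δ (show (1 : ℝ) < 2 by norm_num)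
  obtain ⟨l, hl⟩ := pow_unbounded_of_one_lt lam (show (1 : ℝ) < 2 by norm_num)
  obtain ⟨c₀, hc₀⟩ := exists_nat_ge (8 / lam)
  set A : ℝ := (1 + |c| * Δ) * message lam ^ 2 with hA
  have hA0 : 0 ≤ A := by positivity
  -- With ε² = A (αΔ)^k, the squared form of n · 2ε ≤ 1 / (4m) is 64 A (nm)² (αΔ)^k ≤ 1, and nm ≤ b.
  obtain ⟨K₀, hK₀⟩ := exists_error_exponent (A := 64 * A) (mul_pos hα hΔ) hαΔ (by positivity)
  obtain ⟨K₁, hK₁⟩ := exists_nat_ge |a|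
  -- K₀ provides the accuracy, and K₁ ≥ |a| brings the depth above the threshold a log n.
  set K := max K₀ K₁
  have haK : |a| ≤ K := hK₁.trans (by exact_mod_cast le_max_right _ _)
  obtain ⟨C, hC⟩ := exists_runs_approxProgram_of_le lam c₀ K l hl.le
  obtain ⟨C', k', hpoly⟩ := polyBounded_runningTime C c₀ c' e K l
  refine ⟨approxProgram c₀ K, C', k', fun i n σ m hm => ?_⟩
  set H := (G i).comap σ
  set b := (n + 1) * (m + 1) with hb
  have hnb : n * m ≤ b := Nat.mul_le_mul (by omega) (by omega)
  have hb2 : 2 ≤ b := by rw [hb]; nlinarith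
  have hnb' : n ≤ b := by rw [hb]; nlinarith
  have hq0 : 0 < b ^ K := by positivity
  -- The fuel b^K has length k + 1: the virtual root uses up one level and its children are
  -- evaluated to depth k.
  obtain ⟨k, hk⟩ : ∃ k, Nat.size (b ^ K) = k + 1 :=
    ⟨Nat.size (b ^ K) - 1, by have := Nat.size_pos.2 hq0; omega⟩
  have hlt : b ^ K < 2 ^ (k + 1) := hk ▸ Nat.lt_size_self _
  have hle : 2 ^ k ≤ b ^ K := Nat.lt_size.1 (by omega)
  have hsum : ∀ u, (∑ j ∈ Finset.Icc 1 (k + 1), (sawCount H u j : ℝ)) ≤ c * Δ ^ (k + 1) := by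
    intro u
    have hcard : Nat.card (V i) = n := by rw [← Nat.card_congr σ, Nat.card_eq_fintype_card,
      Fintype.card_fin]
    refine le_trans (Finset.sum_le_sum fun j _ => ?_) (hc i (hfin i) (σ u) (k + 1)
      (hcard ▸ mul_log_le haK hnb' (by omega) hlt))
    exact_mod_cast sawCount_comap_le (hG i) σ u j
  obtain ⟨hx, hxl, hlog⟩ := activity_error (n := n) hlam hc₀ hm le_rfl
  obtain ⟨f', hf, hptr, hocc, hvac, -, hval⟩ := dfs_root (n := n) (H := H)
    (a := adjacency m H) (N := digits lam (c₀ * b)) (D := 2 ^ (c₀ * b)) (by positivity)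
    (adjacency_ne_zero_iff m H) hk
  have hT : n + (n + 1) * childSum (nodeCount H (List.finRange n) k) (fun _ => True)
      (List.finRange n) Finset.univ ≤ stepBound c' e n (b ^ K) := by
    have := childSum_le (F := nodeCount H (List.finRange n) k) (fun _ => True)
      (List.finRange n) Finset.univ fun S u hu =>
        nodeCount_le hΔ hc' he.le hle (hsum u) hu
    rw [List.length_finRange] at this
    exact Nat.add_le_add_left (Nat.mul_le_mul_left _ this) _
  obtain ⟨s, t, hrun, hs0, hs1, ht⟩ := hC n m H _ _ f' hf hptr.ge hT
  refine ⟨s, t, hrun, ht.trans (hpoly n m hm), by omega, ?_⟩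
  rw [partitionFunction_eq_indepSum lam (G i) σ, hs0, hs1]
  have hm' : (1 : ℝ) ≤ m := by exact_mod_cast hm
  refine abs_sub_indepSum_le (ε := √(A * (α * Δ) ^ k)) hx hxl hα hαl (Real.sqrt_nonneg _) hm
    (fun S u hu => ?_) ?_ hlog (by rw [inv_div]; exact hval)
  · rw [Real.sq_sqrt (by positivity), hA]
    calc α ^ k * levelCount H (List.finRange n) k S u * message lam ^ 2
        ≤ ((1 + |c| * Δ) * (α * Δ) ^ k) * message lam ^ 2 :=
          mul_le_mul_of_nonneg_right (alpha_pow_mul_levelCount_le hα hΔ (hsum u) hu) (sq_nonneg _)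
      _ = _ := by ring
  · rw [le_div_iff₀ (by positivity)]
    refine (abs_le_of_sq_le_sq (b := 1) ?_ zero_le_one |> fun h => (le_abs_self _).trans h)
    have h1 := hK₀ K k b (le_max_left _ _) hb2 hlt
    have h2 : (n * m : ℝ) ≤ b := by exact_mod_cast hnb
    calc (n * (2 * √(A * (α * Δ) ^ k)) * (4 * m)) ^ 2
        = 64 * (n * m : ℝ) ^ 2 * √(A * (α * Δ) ^ k) ^ 2 := by ring
      _ = 64 * A * (n * m : ℝ) ^ 2 * (α * Δ) ^ k := by
          rw [Real.sq_sqrt (by positivity)]; ring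
      _ ≤ 64 * A * (b : ℝ) ^ 2 * (α * Δ) ^ k := by gcongr
      _ ≤ 1 ^ 2 := by simpa using h1

end HardCore

theorem theorem1 {ι : Type*} {V : ι → Type*} (G : ∀ i, SimpleGraph (V i))
    (hG : ∀ (i : ι) (v : V i), ((G i).neighborSet v).Finite)
    (lam Δ : ℝ) (hlam : 0 < lam) (hΔ : 0 < Δ) (hcrit : lam < HardCore.criticalActivity (Δ + 1))
    (a : ℝ) (hconn : HardCore.ConnectiveConstantAtMost G Δ a) :
    HardCore.StrongSpatialMixing lam G a ∧
      ((∀ i, Finite (V i)) → HardCore.HasFPTAS lam G) :=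
  ⟨HardCore.strongSpatialMixing G hG hlam hΔ hcrit hconn,
    HardCore.hasFPTAS G hG hlam hΔ hcrit hconn⟩
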